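/- Notation. Let $$\Phi(\xi,\mu)=\tfrac1{16}\xi^3-\tfrac38\xi\mu^2-\tfrac18\xi^2+\tfrac14\mu^2+\tfrac12\xi .$$ Fix $\psi\in C_c^\infty(\mathbb R)$ with $0\le\psi\le1$, $\psi=1$ on $B(0,100)$ and $\operatorname{supp}\psi\subset B(0,200)$, and put $$\chi_1(\xi,\mu)=[1-\psi(\xi/\mu)]\,[1-\psi(\xi)],\qquad \chi_2(\xi,\mu)=\psi(\xi/\mu)\,[1-\psi(\xi)],$$ where $\psi(\xi/\mu):=0$ if $\mu=0$. The Fourier transform is $\widehat g(\xi)=\int e^{-ix\xi}g(x)\,dx$; $\widehat f$ is the transform in all variables $(t,x,y)\mapsto(\tau,\xi,\mu)$ when $f$ is a function of $(t,x,y)$, and $\widehat f^{(t,y)}$, $\widehat f^{(t,x)}$ are the transforms in the indicated variables only. For $g$ a function of $(x,y)$, $$W_k(t)g(x,y)=\int_{\mathbb R^2}e^{ix\xi+iy\mu+it\Phi(\xi,\mu)}\,\widehat g(\xi,\mu)\,\chi_k(\xi,\mu)\,d\xi\,d\mu .$$ For $j\in\mathbb N$ let $Q_j$ be the Fourier multiplier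 in $(x,y)$ whose symbol is a function $m_j\in C_c^\infty(\mathbb R^2)$ with $m_j=1$ where $2^j\le\sqrt{\xi^2+\mu^2}\le2^{j+1}$ and $m_j=0$ unless $2^{j-1}\le\sqrt{\xi^2+\mu^2}\le2^{j+2}$. For $k=1,2$ let $\widetilde W_k(t)f(x,y)=\lim_{\varepsilon\to0^+}\widetilde W_{k,\varepsilon}(t)f(x,y)$, where $$\widetilde W_{k,\varepsilon}(t)f(x,y)=\int_{\varepsilon<|\tau-\Phi(\xi,\mu)|<1/\varepsilon}e^{ix\xi+iy\mu+it\tau}\,\frac{\widehat f(\tau,\xi,\mu)}{\tau-\Phi(\xi,\mu)}\,\chi_k(\xi,\mu)\,d\xi\,d\mu\,d\tau .$$ For $I\subset\mathbb R$ write $\|u\|_{L^p_xL^2_{y,t}(I)}=\big\|\,\|u\|_{L^2(t\in I,\ y\in\mathbb R)}\big\|_{L^p_x(\mathbb R)}$, and similarly with $x,y$ exchanged; $I=\mathbb R$ when omitted. Theorem. (i) (Kernels.) For every point the limits $$K_1(\tau,x,\mu)=\lim_{\varepsilon\to0^+}\int_{\varepsilon<|\tau-\Phi(\xi,\mu)|<1/\varepsilon}e^{ix\xi}\frac{\xi^2}{\tau-\Phi(\xi,\mu)}\chi_1(\xi,\mu)\,d\xi,$$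 $$K_2(\tau,\xi,y)=\lim_{\varepsilon\to0^+}\int_{\varepsilon<|\tau-\Phi(\xi,\mu)|<1/\varepsilon}e^{iy\mu}\frac{\xi\mu}{\tau-\Phi(\xi,\mu)}\chi_2(\xi,\mu)\,d\mu$$ exist, and $K_1,K_2$ are measurable and uniformly bounded on $\mathbb R^3$. For all $f\in C_c^\infty(\mathbb R^3)$, all $j\in\mathbb N$, and all values of the free variables, $$\lim_{\varepsilon\to0^+}\int_{\varepsilon<|\tau-\Phi|<1/\varepsilon}e^{ix\xi}\frac{\xi^2}{\tau-\Phi(\xi,\mu)}\widehat{Q_jf}(\tau,\xi,\mu)\chi_1(\xi,\mu)\,d\xi=\int_{\mathbb R}K_1(\tau,x-\tilde x,\mu)\,\widehat{Q_jf}^{(t,y)}(\tau,\tilde x,\mu)\,d\tilde x,$$ $$\lim_{\varepsilon\to0^+}\int_{\varepsilon<|\tau-\Phi|<1/\varepsilon}e^{iy\mu}\frac{\xi\mu}{\tau-\Phi(\xi,\mu)}\widehat{Q_jf}(\tau,\xi,\mu)\chi_2(\xi,\mu)\,d\mu=\int_{\mathbb R}K_2(\tau,\xi,y-\tilde y)\,\widehat{Q_jf}^{(t,x)}(\tau,\xi,\tilde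 y)\,d\tilde y,$$ the integrals on the right being absolutely convergent. (ii) (Smoothing effect.) There is a constant $C$, depending only on $\psi$, such that for all $j\in\mathbb N$, all admissible $m_j$ and all $f\in C_c^\infty(\mathbb R^3)$: the limits defining $\widetilde W_1(t)Q_jf$ and $\widetilde W_2(t)Q_jf$ exist at every $(t,x,y)\in\mathbb R^3$, are of class $C^2$ in $(x,y)$ for each $t$, and $$\|\partial_x^2\widetilde W_1(t)Q_jf\|_{L^\infty_xL^2_{y,t}}\le C\|Q_jf\|_{L^1_xL^2_{y,t}},\qquad \|\partial_x\partial_y\widetilde W_2(t)Q_jf\|_{L^\infty_yL^2_{x,t}}\le C\|Q_jf\|_{L^1_yL^2_{x,t}} .$$ (iii) (Double smoothing effect for the Duhamel term.) There is a constant $C$, depending only on $\psi$, such that for all $j\in\mathbb N$, all admissible $m_j$, all $F\in C_c^\infty(\mathbb R^3)$, and for $I=\mathbb R$ as well as $I=[0,\infty)$: the functions $\int_0^tW_k(t-t')Q_jF(t')\,dt'$, $k=1,2$, are of class $C^2$ in $(x,y)$ for each $t$, and $$\Big\|\partial_x^2\int_0^tW_1(t-t')Q_jF(t')\,dt'\Big\|_{L^\infty_xL^2_{y,t}(I)}\le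 C\|Q_jF\|_{L^1_xL^2_{y,t}(I)},$$ $$\Big\|\partial_x\partial_y\int_0^tW_2(t-t')Q_jF(t')\,dt'\Big\|_{L^\infty_yL^2_{x,t}(I)}\le C\|Q_jF\|_{L^1_yL^2_{x,t}(I)} .$$ -/

import Mathlib

open MeasureTheory Filter Topology Set
open scoped ENNReal NNReal ContDiff

noncomputable section

namespace Dysthe

/-- The dispersion relation of the two dimensional Dysthe equation. -/
def Phi (ξ μ : ℝ) : ℝ :=
  ξ ^ 3 / 16 - 3 / 8 * ξ * μ ^ 2 - ξ ^ 2 / 8 + μ ^ 2 / 4 + ξ / 2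

/-- The character `e^{iθ}`. -/
def cexpI (θ : ℝ) : ℂ := Complex.exp (Complex.I * (θ : ℂ))

/-- A smooth cut-off `ψ` with `0 ≤ ψ ≤ 1`, `ψ = 1` on `B(0,100)` and `supp ψ ⊂ B(0,200)`. -/
structure IsCutoff (ψ : ℝ → ℝ) : Prop where
  smooth : ContDiff ℝ ∞ ψ
  nonneg : ∀ s, 0 ≤ ψ s
  le_one : ∀ s, ψ s ≤ 1
  eq_one : ∀ s ∈ Metric.ball (0 : ℝ) 100, ψ s = 1
  supp : tsupport ψ ⊆ Metric.ball (0 : ℝ) 200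

/-- `ψ(ξ/μ)`; for `μ = 0` the quotient is infinite, where `ψ` vanishes (this only matters for
`ξ ≠ 0`, since the factor `1 - ψ(ξ)` below vanishes near `ξ = 0`). -/
def cutQuot (ψ : ℝ → ℝ) (ξ μ : ℝ) : ℝ := if μ = 0 then 0 else ψ (ξ / μ)

/-- `χ₁(ξ,μ) = (1 - ψ(ξ/μ)) (1 - ψ(ξ))`. -/
def chi1 (ψ : ℝ → ℝ) (ξ μ : ℝ) : ℝ := (1 - cutQuot ψ ξ μ) * (1 - ψ ξ)

/-- `χ₂(ξ,μ) = ψ(ξ/μ) (1 - ψ(ξ))`. -/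
def chi2 (ψ : ℝ → ℝ) (ξ μ : ℝ) : ℝ := cutQuot ψ ξ μ * (1 - ψ ξ)

/-- `m` is an admissible symbol of the dyadic frequency projection at frequency `2 ^ j`. -/
structure IsDyadicSymbol (j : ℕ) (m : ℝ × ℝ → ℂ) : Prop where
  smooth : ContDiff ℝ ∞ m
  compact : HasCompactSupport m
  eq_one : ∀ ξ μ : ℝ, (2 : ℝ) ^ (j : ℤ) ≤ √(ξ ^ 2 + μ ^ 2) →
    √(ξ ^ 2 + μ ^ 2) ≤ (2 : ℝ) ^ ((j : ℤ) + 1) → m (ξ, μ) = 1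
  eq_zero : ∀ ξ μ : ℝ, ¬ ((2 : ℝ) ^ ((j : ℤ) - 1) ≤ √(ξ ^ 2 + μ ^ 2) ∧
    √(ξ ^ 2 + μ ^ 2) ≤ (2 : ℝ) ^ ((j : ℤ) + 2)) → m (ξ, μ) = 0

/-! Fourier transforms, with the convention `∫ e^{-i x ξ} f(x) dx`. Points of space-time are
`(t, x, y)`, with dual variables `(τ, ξ, μ)`. -/

/-- Fourier transform in the space variables `(x, y)`. -/
def FTxy (g : ℝ × ℝ → ℂ) (ξ μ : ℝ) : ℂ :=
  ∫ z : ℝ × ℝ, cexpI (-(z.1 * ξ + z.2 * μ)) * g z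

/-- Fourier transform in all the variables `(t, x, y)`. -/
def FTtxy (f : ℝ × ℝ × ℝ → ℂ) (τ ξ μ : ℝ) : ℂ :=
  ∫ p : ℝ × ℝ × ℝ, cexpI (-(p.1 * τ + p.2.1 * ξ + p.2.2 * μ)) * f p

/-- Fourier transform in the variables `(t, y)` only. -/
def FTty (f : ℝ × ℝ × ℝ → ℂ) (τ x μ : ℝ) : ℂ :=
  ∫ z : ℝ × ℝ, cexpI (-(z.1 * τ + z.2 * μ)) * f (z.1, x, z.2)

/-- Fourier transform in the variables `(t, x)` only. -/
def FTtx (f : ℝ × ℝ × ℝ → ℂ) (τ ξ y : ℝ) : ℂ :=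
  ∫ z : ℝ × ℝ, cexpI (-(z.1 * τ + z.2 * ξ)) * f (z.1, z.2, y)

/-- The Fourier multiplier with symbol `m` on functions of `(x, y)`. -/
def multiplier (m : ℝ × ℝ → ℂ) (g : ℝ × ℝ → ℂ) (z : ℝ × ℝ) : ℂ :=
  (((2 * Real.pi) ^ 2 : ℝ) : ℂ)⁻¹ *
    ∫ ζ : ℝ × ℝ, cexpI (z.1 * ζ.1 + z.2 * ζ.2) * (m ζ * FTxy g ζ.1 ζ.2)

/-- The projection `Q` with symbol `m`, acting on space-time functions at each fixed time. -/
def Q (m : ℝ × ℝ → ℂ) (f : ℝ × ℝ × ℝ → ℂ) (p : ℝ × ℝ × ℝ) : ℂ :=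
  multiplier m (fun z => f (p.1, z)) p.2

/-- The frequency-localized linear flow `W_k(t) g (x, y)`, with `χ = χ_k`. -/
def W (χ : ℝ → ℝ → ℝ) (t : ℝ) (g : ℝ × ℝ → ℂ) (z : ℝ × ℝ) : ℂ :=
  ∫ ζ : ℝ × ℝ, cexpI (z.1 * ζ.1 + z.2 * ζ.2 + t * Phi ζ.1 ζ.2) *
    (FTxy g ζ.1 ζ.2 * (χ ζ.1 ζ.2 : ℂ))

/-- The Duhamel term `(t, x, y) ↦ ∫₀ᵗ W_k(t - t') F(t') dt' (x, y)`. -/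
def duhamel (χ : ℝ → ℝ → ℝ) (F : ℝ × ℝ × ℝ → ℂ) (p : ℝ × ℝ × ℝ) : ℂ :=
  ∫ s in (0 : ℝ)..p.1, W χ (p.1 - s) (fun z => F (s, z)) p.2

/-- The truncated operator `W̃_{k,ε}(t) f (x, y)`; the integration variable is
`q = (τ, ξ, μ)`. -/
def WtildeEps (χ : ℝ → ℝ → ℝ) (ε : ℝ) (f : ℝ × ℝ × ℝ → ℂ) (p : ℝ × ℝ × ℝ) : ℂ :=
  ∫ q in {q : ℝ × ℝ × ℝ | ε < |q.1 - Phi q.2.1 q.2.2| ∧ |q.1 - Phi q.2.1 q.2.2| < 1 / ε},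
    cexpI (p.2.1 * q.2.1 + p.2.2 * q.2.2 + p.1 * q.1) *
      (FTtxy f q.1 q.2.1 q.2.2 / ((q.1 - Phi q.2.1 q.2.2 : ℝ) : ℂ)) * (χ q.2.1 q.2.2 : ℂ)

/-- `W̃_k(t) f (x, y) = lim_{ε → 0} W̃_{k,ε}(t) f (x, y)`. -/
def Wtilde (χ : ℝ → ℝ → ℝ) (f : ℝ × ℝ × ℝ → ℂ) (p : ℝ × ℝ × ℝ) : ℂ :=
  limUnder (𝓝[>] (0 : ℝ)) (fun ε => WtildeEps χ ε f p)

/-- `∫_{ε < |τ - Φ(ξ,μ)| < 1/ε} e^{ixξ} ξ² / (τ - Φ(ξ,μ)) a(ξ) χ₁(ξ,μ) dξ`. -/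
def trunc1 (ψ : ℝ → ℝ) (a : ℝ → ℂ) (ε τ x μ : ℝ) : ℂ :=
  ∫ ξ in {ξ : ℝ | ε < |τ - Phi ξ μ| ∧ |τ - Phi ξ μ| < 1 / ε},
    cexpI (x * ξ) * ((ξ ^ 2 / (τ - Phi ξ μ) : ℝ) : ℂ) * a ξ * (chi1 ψ ξ μ : ℂ)

/-- `∫_{ε < |τ - Φ(ξ,μ)| < 1/ε} e^{iyμ} ξμ / (τ - Φ(ξ,μ)) a(μ) χ₂(ξ,μ) dμ`. -/
def trunc2 (ψ : ℝ → ℝ) (a : ℝ → ℂ) (ε τ ξ y : ℝ) : ℂ :=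
  ∫ μ in {μ : ℝ | ε < |τ - Phi ξ μ| ∧ |τ - Phi ξ μ| < 1 / ε},
    cexpI (y * μ) * ((ξ * μ / (τ - Phi ξ μ) : ℝ) : ℂ) * a μ * (chi2 ψ ξ μ : ℂ)

/-- The principal value kernel `K₁(τ, x, μ)`. -/
def K1 (ψ : ℝ → ℝ) (τ x μ : ℝ) : ℂ :=
  limUnder (𝓝[>] (0 : ℝ)) (fun ε => trunc1 ψ (fun _ => 1) ε τ x μ)

/-- The principal value kernel `K₂(τ, ξ, y)`. -/
def K2 (ψ : ℝ → ℝ) (τ ξ y : ℝ) : ℂ :=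
  limUnder (𝓝[>] (0 : ℝ)) (fun ε => trunc2 ψ (fun _ => 1) ε τ ξ y)

/-- Partial derivative in `x` of a function of `(t, x, y)`. -/
def dx (u : ℝ × ℝ × ℝ → ℂ) (p : ℝ × ℝ × ℝ) : ℂ :=
  deriv (fun s => u (p.1, s, p.2.2)) p.2.1

/-- Partial derivative in `y` of a function of `(t, x, y)`. -/
def dy (u : ℝ × ℝ × ℝ → ℂ) (p : ℝ × ℝ × ℝ) : ℂ :=
  deriv (fun s => u (p.1, p.2.1, s)) p.2.2

/-- The norm of `L^p_x L^q_{t,y}`, with `t` restricted to `I`. -/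
def normX (p q : ℝ≥0∞) (I : Set ℝ) (u : ℝ × ℝ × ℝ → ℂ) : ℝ≥0∞ :=
  eLpNorm (fun x : ℝ => eLpNorm (fun z : ℝ × ℝ => u (z.1, x, z.2)) q
    ((volume.restrict I).prod volume)) p volume

/-- The norm of `L^p_y L^q_{t,x}`, with `t` restricted to `I`. -/
def normY (p q : ℝ≥0∞) (I : Set ℝ) (u : ℝ × ℝ × ℝ → ℂ) : ℝ≥0∞ :=
  eLpNorm (fun y : ℝ => eLpNorm (fun z : ℝ × ℝ => u (z.1, z.2, y)) q
    ((volume.restrict I).prod volume)) p volume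

/-- At each time, `u` is of class `C²` in `(x, y)`. -/
def SpaceC2 (u : ℝ × ℝ × ℝ → ℂ) : Prop :=
  ∀ t : ℝ, ContDiff ℝ 2 (fun z : ℝ × ℝ => u (t, z))

end Dysthe

end

/-!
The idea is that, after the localization by `χ₁` or `χ₂`, each of the two multipliers has simple
poles only, with residues bounded uniformly in the frozen variables, so that its inverse Fourier
transform in the remaining frequency is a bounded function; a bounded kernel maps `L¹` to `L^∞`, and
Plancherel's theorem handles the two other variables.

**Kernels.** In the first region `|ξ| ≥ 100 max(1, |μ|)`, where `Φ(·, μ)` is strictly monotone on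
each half line and grows like `ξ³ / 16`. Hence `τ - Φ(·, μ)` has at most one zero there, it is
simple, and the residue of `ξ² χ₁ / (τ - Φ)` at it is bounded since `∂_ξ Φ` is comparable to `ξ²`
(`divDiff_bounds`). In the second region `|ξ| ≥ 100`, and `τ - Φ(ξ, ·)` is a quadratic polynomial
`b (μ² - λ)` with `b` comparable to `ξ`. In both cases there is a scale `M`, the size of the roots
when they lie in the support of the cut-off, such that the quotient is a combination of simple poles
truncated to distance `M / 2`, of `1 / ξ` truncated to `|ξ| > 2M`, and of an error bounded by the
Cauchy density of scale `M`, whose mass does not depend on `M`. This is `PVData`, proved in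
`pvData_chi1` and `pvData_quadratic`. For the poles the truncations `{ε < |τ - Φ| < 1/ε}` differ
from symmetric ones by sets of bounded logarithmic measure, and the symmetric truncations give
differences of the sine integral `Si`, which is bounded and has limits at infinity. So the truncated
Fourier transforms are bounded and converge (`pvBounded_of_data`); the same data bound the mass of
the quotient on the layers `{ε < |τ - Φ| < 2ε}`.

**Evolutions.** All the operators have the form `evolution φ w κ`, that is
`F ↦ ∫ κ(t, s) e^{i(t-s)φ(D)} w(D) F(s) ds`, with different time kernels `κ`. If `κ(t, s)` is the
oscillatory integral `osc h (t - s)` of a bounded `h` with bounded support, this is the space-time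
multiplier `h(τ - φ) w`. The choice `h = 1/σ` on `{ε < |σ| < 1/ε}` gives the truncated operators of
the theorem, and in the limit `κ = pvKer`, a multiple of `sgn(t - s)`. The choice of the normalized
indicator function of `{ε < |σ| < 2ε}` gives `κ = 1` in the limit. The Duhamel integral has the time
kernel `(sgn(t - s) + sgn s) / 2`, a combination of these two applied to `F` and to `sgn(s) F`; for
`t ≥ 0` only the values of `F` at positive times count.

**Estimates.** For `h` with bounded support, Plancherel's theorem in `(t, y)`, the convolution
structure in `x` and Minkowski's inequality bound `evolution` in `L^∞_x L²_{t,y}` by the `L¹_x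
L²_{t,y}` norm of `F` times the supremum of the kernels (`eLpNorm_evolution_osc_le`). Fatou's lemma
passes to the limiting time kernels. The functions `Q f` are `BandLimited`, which justifies all
interchanges of integrals. The second region is reduced to the same lemmas by exchanging `x` and
`y` (`swapXY`).
-/

open MeasureTheory Filter Topology Set
open scoped ENNReal NNReal ContDiff

noncomputable section

namespace Dysthe

/-! ### Plancherel's theorem and Minkowski's inequality -/

open scoped FourierTransform SchwartzMap in
/-- Plancherel's theorem for the Fourier integral of a function in `L¹ ∩ L²`: tested against smooth
compactly supported functions, the integral agrees with the unitary Fourier transform on `L²`. -/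
theorem eLpNorm_fourier_eq {E : Type*} [NormedAddCommGroup E] [InnerProductSpace ℝ E]
    [FiniteDimensional ℝ E] [MeasurableSpace E] [BorelSpace E] (g : E → ℂ)
    (h1 : Integrable g) (h2 : MemLp g 2) : eLpNorm (𝓕 g) 2 = eLpNorm g 2 := by
  set G : Lp (α := E) ℂ 2 volume := h2.toLp g with hG
  have hcont : Continuous (𝓕 g) :=
    VectorFourier.fourierIntegral_continuous (μ := (volume : Measure E)) Real.continuous_fourierChar
      (by exact continuous_inner) h1
  have key : (𝓕 G : Lp (α := E) ℂ 2 volume) =ᵐ[volume] 𝓕 g := by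
    apply ae_eq_of_integral_contDiff_smul_eq
    · exact ((Lp.memLp _).locallyIntegrable (by norm_num))
    · exact hcont.locallyIntegrable
    intro φ hφ hc
    have hc' : HasCompactSupport (fun x => (φ x : ℂ)) :=
      hc.comp_left (g := fun r : ℝ => (r : ℂ)) (by simp)
    have hφ' : ContDiff ℝ ∞ (fun x => (φ x : ℂ)) := Complex.ofRealCLM.contDiff.comp hφ
    let Φ : 𝓢(E, ℂ) := hc'.toSchwartzMap hφ'
    have e1 := congrArg (fun T => T Φ) (Lp.fourier_toTemperedDistribution_eq G)
    simp only [Lp.toTemperedDistribution_apply] at e1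
    rw [TemperedDistribution.fourier_apply, Lp.toTemperedDistribution_apply] at e1
    have e2 : ∫ x, (𝓕 Φ) x • G x = ∫ x, (𝓕 Φ) x • g x := by
      apply integral_congr_ae
      filter_upwards [h2.coeFn_toLp] with x hx
      rw [hx]
    have e3 : ∫ x, (𝓕 Φ) x • g x = ∫ x, Φ x • 𝓕 g x := by
      have := VectorFourier.integral_fourierIntegral_smul_eq_flip (μ := (volume : Measure E))
        (ν := (volume : Measure E)) (L := innerₗ E) Real.continuous_fourierChar
        (by exact continuous_inner) Φ.integrable h1
      rw [flip_innerₗ] at this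
      exact this
    have e4 : ∫ x, φ x • (𝓕 G : Lp (α := E) ℂ 2 volume) x =
        ∫ x, Φ x • (𝓕 G : Lp (α := E) ℂ 2 volume) x := by
      congr 1
    have e5 : ∫ x, φ x • 𝓕 g x = ∫ x, Φ x • 𝓕 g x := by
      congr 1
    rw [e4, e5, ← e3, ← e2, e1]
  rw [← eLpNorm_congr_ae key, ← eLpNorm_congr_ae h2.coeFn_toLp]
  have := Lp.norm_fourier_eq G
  rw [← Lp.enorm_def, ← Lp.enorm_def]
  rw [enorm_eq_nnnorm, enorm_eq_nnnorm]
  congr 1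
  exact NNReal.eq this

theorem measurePreserving_equivRealProd :
    MeasurePreserving Complex.measurableEquivRealProd volume volume :=
  Complex.volume_preserving_equiv_real_prod

/-- Plancherel's identity on `ℝ × ℝ`, for the transform without `2π` in the phase. -/
theorem eLpNorm_fourier_prod_eq (g : ℝ × ℝ → ℂ) (h1 : Integrable g) (h2 : MemLp g 2) :
    eLpNorm (fun w : ℝ × ℝ => ∫ z : ℝ × ℝ, cexpI (-(z.1 * w.1 + z.2 * w.2)) * g z) 2 =
      ENNReal.ofReal (2 * Real.pi) * eLpNorm g 2 := by
  set e := Complex.measurableEquivRealProd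
  have hmp : MeasurePreserving e volume volume := measurePreserving_equivRealProd
  set H := fun w : ℝ × ℝ => ∫ z : ℝ × ℝ, cexpI (-(z.1 * w.1 + z.2 * w.2)) * g z with hH
  have k1 := eLpNorm_fourier_eq (fun v : ℂ => g (e v)) ((hmp.integrable_comp_emb
    e.measurableEmbedding).2 h1) (h2.comp_measurePreserving hmp)
  have k2 : (FourierTransform.fourier (fun v : ℂ => g (e v)) : ℂ → ℂ) =
      fun w => H ((2 * Real.pi) • e w) := by
    ext w
    rw [Real.fourier_eq']
    simp only [hH]
    rw [← hmp.integral_comp e.measurableEmbedding]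
    congr 1
    ext v
    simp only [smul_eq_mul, cexpI, Complex.inner]
    congr 2
    have : (e v).1 = v.re ∧ (e v).2 = v.im ∧ (e w).1 = w.re ∧ (e w).2 = w.im :=
      ⟨rfl, rfl, rfl, rfl⟩
    simp [this]
    ring
  have hHc : Continuous H := by
    have : H = VectorFourier.fourierIntegral Real.fourierChar (volume : Measure (ℝ × ℝ))
        (((2 * Real.pi)⁻¹ : ℝ) • ((LinearMap.mul ℝ ℝ).compl₁₂ (LinearMap.fst ℝ ℝ ℝ)
          (LinearMap.fst ℝ ℝ ℝ) +
          (LinearMap.mul ℝ ℝ).compl₁₂ (LinearMap.snd ℝ ℝ ℝ) (LinearMap.snd ℝ ℝ ℝ))) g := by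
      ext w
      simp only [hH, VectorFourier.fourierIntegral, Real.fourierChar_apply, Circle.smul_def,
        smul_eq_mul, cexpI]
      congr 1
      ext z
      congr 2
      have : (Real.pi : ℂ) ≠ 0 := by exact_mod_cast Real.pi_ne_zero
      simp
      field_simp
    rw [this]
    apply VectorFourier.fourierIntegral_continuous (μ := (volume : Measure (ℝ × ℝ)))
      Real.continuous_fourierChar _ h1
    simp
    fun_prop
  rw [k2] at k1
  rw [show (fun w : ℂ => H ((2 * Real.pi) • e w)) = (fun z => H ((2 * Real.pi) • z)) ∘ e from rfl,
    eLpNorm_comp_measurePreserving (by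
      apply Continuous.aestronglyMeasurable
      exact hHc.comp (continuous_const_smul _)) hmp] at k1
  rw [show (fun v => g (e v)) = g ∘ e from rfl,
    eLpNorm_comp_measurePreserving h2.1 hmp] at k1
  have hpi : (2 * Real.pi) ≠ 0 := by positivity
  have k3 := Measure.map_addHaar_smul (volume : Measure (ℝ × ℝ)) hpi
  have k4 : eLpNorm H 2 (Measure.map ((2 * Real.pi) • ·) (volume : Measure (ℝ × ℝ))) =
      eLpNorm (fun z : ℝ × ℝ => H ((2 * Real.pi) • z)) 2 :=
    eLpNorm_map_measure hHc.aestronglyMeasurable (by fun_prop)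
  rw [k3, eLpNorm_smul_measure_of_ne_top (by norm_num), k1] at k4
  rw [← k4]
  simp only [Module.finrank_prod, Module.finrank_self, smul_eq_mul]
  rw [← mul_assoc]
  have : ENNReal.ofReal (2 * Real.pi) *
      ENNReal.ofReal |((2 * Real.pi) ^ (1 + 1))⁻¹| ^ (1 / (2 : ℝ≥0∞)).toReal = 1 := by
    rw [abs_of_pos (by positivity), ENNReal.ofReal_rpow_of_pos (by positivity),
      ← ENNReal.ofReal_mul (by positivity)]
    rw [ENNReal.ofReal_eq_one]
    have : (1 / (2 : ℝ≥0∞)).toReal = 1 / 2 := by simp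
    rw [this, Real.inv_rpow (by positivity), ← Real.sqrt_eq_rpow, one_add_one_eq_two,
      Real.sqrt_sq (by positivity)]
    field_simp
  rw [this, one_mul]

theorem eLpNorm_fourierInv_prod_eq (g : ℝ × ℝ → ℂ) (h1 : Integrable g) (h2 : MemLp g 2) :
    eLpNorm (fun w : ℝ × ℝ => ∫ z : ℝ × ℝ, cexpI (z.1 * w.1 + z.2 * w.2) * g z) 2 =
      ENNReal.ofReal (2 * Real.pi) * eLpNorm g 2 := by
  have hn : MeasurePreserving (fun z : ℝ × ℝ => -z) volume volume :=
    Measure.measurePreserving_neg _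
  have := eLpNorm_fourier_prod_eq (fun z => g (-z)) h1.comp_neg (h2.comp_measurePreserving hn)
  rw [show (fun z => g (-z)) = g ∘ (fun z => -z) from rfl,
    eLpNorm_comp_measurePreserving h2.1 hn] at this
  rw [← this]
  congr 1
  ext w
  rw [← integral_neg_eq_self]
  congr 1
  ext z
  simp [cexpI]
  left
  ring_nf

/-- Minkowski's integral inequality in `L²`. -/
theorem eLpNorm_two_lintegral_le {α β : Type*} [MeasurableSpace α] [MeasurableSpace β]
    {μ : Measure α} {ν : Measure β} [SFinite μ] [SFinite ν] (f : α → β → ℝ≥0∞)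
    (hf : Measurable (Function.uncurry f)) :
    eLpNorm (fun a => ∫⁻ b, f a b ∂ν) 2 μ ≤ ∫⁻ b, eLpNorm (fun a => f a b) 2 μ ∂ν := by
  have hfa : ∀ b, Measurable fun a => f a b := fun b =>
    hf.comp (measurable_id.prodMk measurable_const)
  have hfb : ∀ a, Measurable fun b => f a b := fun b =>
    hf.comp (measurable_const.prodMk measurable_id)
  have hN : ∀ h : α → ℝ≥0∞, eLpNorm h 2 μ = (∫⁻ a, h a ^ (2 : ℝ) ∂μ) ^ (1 / 2 : ℝ) := by
    intro h
    rw [eLpNorm_eq_lintegral_rpow_enorm_toReal (by norm_num) (by norm_num)]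
    simp
  set N : β → ℝ≥0∞ := fun b => eLpNorm (fun a => f a b) 2 μ with hNdef
  have hNm : Measurable N := by
    simp only [hNdef, hN]
    apply Measurable.pow_const
    apply Measurable.lintegral_prod_right' (f := fun p : β × α => f p.2 p.1 ^ (2 : ℝ))
    exact (hf.comp measurable_swap).pow_const _
  rw [hN]
  have : ∫⁻ a, (∫⁻ b, f a b ∂ν) ^ (2 : ℝ) ∂μ ≤ (∫⁻ b, N b ∂ν) ^ (2 : ℝ) := by
    calc ∫⁻ a, (∫⁻ b, f a b ∂ν) ^ (2 : ℝ) ∂μ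
        = ∫⁻ a, ∫⁻ b, ∫⁻ b', f a b * f a b' ∂ν ∂ν ∂μ := by
          congr 1
          ext a
          rw [ENNReal.rpow_two, sq, ← lintegral_mul_const _ (hfb a)]
          congr 1
          ext b
          rw [lintegral_const_mul _ (hfb a)]
      _ = ∫⁻ b, ∫⁻ b', ∫⁻ a, f a b * f a b' ∂μ ∂ν ∂ν := by
          rw [lintegral_lintegral_swap]
          · congr 1
            ext b
            rw [lintegral_lintegral_swap]
            apply Measurable.aemeasurable
            have h1 : Measurable fun p : α × β => f p.1 b := (hfa b).comp measurable_fst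
            exact h1.mul hf
          · apply Measurable.aemeasurable
            apply Measurable.lintegral_prod_right' (f := fun p : (α × β) × β =>
              f p.1.1 p.1.2 * f p.1.1 p.2)
            exact (hf.comp measurable_fst).mul (hf.comp
              ((measurable_fst.comp measurable_fst).prodMk measurable_snd))
      _ ≤ ∫⁻ b, ∫⁻ b', N b * N b' ∂ν ∂ν := by
          refine lintegral_mono fun b => lintegral_mono fun b' => ?_
          simp only [hNdef, hN]
          exact ENNReal.lintegral_mul_le_Lp_mul_Lq μ Real.HolderConjugate.two_two
            (hfa b).aemeasurable (hfa b').aemeasurable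
      _ = (∫⁻ b, N b ∂ν) ^ (2 : ℝ) := by
          rw [ENNReal.rpow_two, sq, ← lintegral_mul_const _ hNm]
          congr 1
          ext b
          rw [lintegral_const_mul _ hNm]
  calc (∫⁻ a, (∫⁻ b, f a b ∂ν) ^ (2 : ℝ) ∂μ) ^ (1 / 2 : ℝ)
      ≤ ((∫⁻ b, N b ∂ν) ^ (2 : ℝ)) ^ (1 / 2 : ℝ) := by gcongr
    _ = ∫⁻ b, N b ∂ν := by rw [← ENNReal.rpow_mul]; simp

/-! ### The character and the sine integral -/

theorem norm_cexpI (θ : ℝ) : ‖cexpI θ‖ = 1 := by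
  rw [cexpI, mul_comm]; exact Complex.norm_exp_ofReal_mul_I θ

theorem cexpI_add (a b : ℝ) : cexpI (a + b) = cexpI a * cexpI b := by
  simp only [cexpI, ← Complex.exp_add]
  congr 1
  push_cast
  ring

@[fun_prop]
theorem continuous_cexpI : Continuous cexpI := by
  unfold cexpI
  fun_prop

@[fun_prop]
theorem measurable_cexpI : Measurable cexpI := continuous_cexpI.measurable

theorem cexpI_sub_cexpI_neg (a : ℝ) : cexpI a - cexpI (-a) = 2 * Complex.I * (Real.sin a : ℂ) := by
  have h := Complex.two_sin (a : ℂ)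
  simp only [cexpI, Complex.ofReal_sin, Complex.ofReal_neg]
  rw [show 2 * Complex.I * Complex.sin a = Complex.I * (2 * Complex.sin a) by ring, h]
  rw [show Complex.I * ((Complex.exp (-↑a * Complex.I) - Complex.exp (↑a * Complex.I)) * Complex.I)
    = -(Complex.exp (-↑a * Complex.I) - Complex.exp (↑a * Complex.I)) by
      linear_combination (Complex.exp (-↑a * Complex.I) - Complex.exp (↑a * Complex.I)) *
        Complex.I_mul_I]
  rw [show Complex.I * (a : ℂ) = a * Complex.I by ring,
    show Complex.I * -(a : ℂ) = -a * Complex.I by ring]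
  ring

/-- The sine integral `∫₀ˣ sin v / v dv`. -/
def Si (x : ℝ) : ℝ := ∫ v in (0 : ℝ)..x, Real.sinc v

theorem hasDerivAt_Si (x : ℝ) : HasDerivAt Si (Real.sinc x) x :=
  intervalIntegral.integral_hasDerivAt_right (Real.continuous_sinc.intervalIntegrable _ _)
    (Real.continuous_sinc.stronglyMeasurableAtFilter _ _) Real.continuous_sinc.continuousAt

@[fun_prop]
theorem continuous_Si : Continuous Si :=
  continuous_iff_continuousAt.2 fun x => (hasDerivAt_Si x).continuousAt

@[simp] theorem Si_zero : Si 0 = 0 := by simp [Si]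

theorem Si_neg (x : ℝ) : Si (-x) = -Si x := by
  have h := intervalIntegral.integral_comp_neg (a := 0) (b := x) Real.sinc
  simp only [Real.sinc_neg, neg_zero] at h
  rw [Si, Si, intervalIntegral.integral_symm, ← h]

theorem hasDerivAt_Si_add_cos_div {v : ℝ} (hv0 : v ≠ 0) :
    HasDerivAt (fun v => Si v + Real.cos v / v) (-(Real.cos v / v ^ 2)) v := by
  have := (hasDerivAt_Si v).add ((Real.hasDerivAt_cos v).div (hasDerivAt_id v) hv0)
  convert! this using 1
  rw [Real.sinc_of_ne_zero hv0]
  simp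
  field_simp
  ring

/-- One integration by parts turns `Si` into `-cos v / v` up to the integral of `cos v / v²`, which
`1 / v` dominates: `Si v + cos v / v - 1 / v` is increasing. -/
theorem Si_add_cos_sub_le {a b : ℝ} (ha : 0 < a) (hab : a ≤ b) :
    Si a + Real.cos a / a - 1 / a ≤ Si b + Real.cos b / b - 1 / b := by
  have h1 : MonotoneOn (fun v => (Si v + Real.cos v / v) - 1 / v) (Icc a b) := by
    apply monotoneOn_of_hasDerivWithinAt_nonneg (convex_Icc a b)
      (f' := fun v => -(Real.cos v / v ^ 2) + 1 / v ^ 2)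
    · intro v hv
      have hv0 : v ≠ 0 := (ha.trans_le hv.1).ne'
      exact ((hasDerivAt_Si_add_cos_div hv0).continuousAt.sub
        (by fun_prop (disch := assumption))).continuousWithinAt
    · intro v hv
      have hv := interior_subset hv
      have hv0 : v ≠ 0 := (ha.trans_le hv.1).ne'
      have := (hasDerivAt_Si_add_cos_div hv0).sub (hasDerivAt_inv hv0)
      apply HasDerivAt.hasDerivWithinAt
      convert! this using 1
      · ext; simp
      · field_simp; ring
    · intro v hv
      have := Real.cos_le_one v
      rw [← sub_eq_neg_add, ← sub_div]
      apply div_nonneg <;> nlinarith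
  exact h1 (left_mem_Icc.2 hab) (right_mem_Icc.2 hab) hab

/-- The counterpart of `Si_add_cos_sub_le`: `Si v + cos v / v + 1 / v` is decreasing. -/
theorem Si_add_cos_add_le {a b : ℝ} (ha : 0 < a) (hab : a ≤ b) :
    Si b + Real.cos b / b + 1 / b ≤ Si a + Real.cos a / a + 1 / a := by
  have h2 : AntitoneOn (fun v => (Si v + Real.cos v / v) + 1 / v) (Icc a b) := by
    apply antitoneOn_of_hasDerivWithinAt_nonpos (convex_Icc a b)
      (f' := fun v => -(Real.cos v / v ^ 2) - 1 / v ^ 2)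
    · intro v hv
      have hv0 : v ≠ 0 := (ha.trans_le hv.1).ne'
      exact ((hasDerivAt_Si_add_cos_div hv0).continuousAt.add
        (by fun_prop (disch := assumption))).continuousWithinAt
    · intro v hv
      have hv := interior_subset hv
      have hv0 : v ≠ 0 := (ha.trans_le hv.1).ne'
      have := (hasDerivAt_Si_add_cos_div hv0).add (hasDerivAt_inv hv0)
      apply HasDerivAt.hasDerivWithinAt
      convert! this using 1
      · ext; simp
      · field_simp; ring
    · intro v hv
      have := Real.neg_one_le_cos v
      rw [show -(Real.cos v / v ^ 2) - 1 / v ^ 2 = -((1 + Real.cos v) / v ^ 2) by ring]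
      apply neg_nonpos.2
      apply div_nonneg <;> nlinarith
  exact h2 (left_mem_Icc.2 hab) (right_mem_Icc.2 hab) hab

theorem abs_Si_sub_Si_le {a b : ℝ} (ha : 0 < a) (hab : a ≤ b) : |Si b - Si a| ≤ 3 / a := by
  have m1 := Si_add_cos_sub_le ha hab
  have m2 := Si_add_cos_add_le ha hab
  have hb : 0 < b := ha.trans_le hab
  have ca : |Real.cos a / a| ≤ 1 / a := by
    rw [abs_div, abs_of_pos ha]; gcongr; exact Real.abs_cos_le_one a
  have cb : |Real.cos b / b| ≤ 1 / b := by
    rw [abs_div, abs_of_pos hb]; gcongr; exact Real.abs_cos_le_one b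
  have hba : 1 / b ≤ 1 / a := one_div_le_one_div_of_le ha hab
  have h3 : 3 / a = 3 * (1 / a) := by ring
  rw [abs_le] at ca cb ⊢
  constructor <;> linarith [ca.1, ca.2, cb.1, cb.2]

theorem abs_Si_le (x : ℝ) : |Si x| ≤ 4 := by
  have h01 : ∀ y : ℝ, 0 ≤ y → y ≤ 1 → |Si y| ≤ 1 := by
    intro y hy0 hy1
    have := intervalIntegral.norm_integral_le_of_norm_le_const (a := 0) (b := y) (C := 1)
      (f := Real.sinc) (fun v _ => Real.abs_sinc_le_one v)
    rw [Real.norm_eq_abs] at this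
    rw [Si]
    refine this.trans ?_
    rw [sub_zero, abs_of_nonneg hy0]
    linarith
  have hpos : ∀ y : ℝ, 0 ≤ y → |Si y| ≤ 4 := by
    intro y hy
    rcases le_total y 1 with h | h
    · linarith [h01 y hy h]
    · have h1 := abs_Si_sub_Si_le one_pos h
      have h2 := h01 1 zero_le_one le_rfl
      have := abs_sub_abs_le_abs_sub (Si y) (Si 1)
      linarith
  rcases le_total 0 x with h | h
  · exact hpos x h
  · have := hpos (-x) (by linarith)
    rwa [Si_neg, abs_neg] at this

theorem exists_tendsto_Si : ∃ L, Tendsto Si atTop (𝓝 L) := by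
  apply cauchySeq_tendsto_of_complete
  rw [Metric.cauchySeq_iff']
  intro e he
  refine ⟨max 1 (6 / e), fun b hb => ?_⟩
  have h1 : (0 : ℝ) < max 1 (6 / e) := lt_of_lt_of_le one_pos (le_max_left _ _)
  rw [Real.dist_eq]
  refine (abs_Si_sub_Si_le h1 hb).trans_lt ?_
  rw [div_lt_iff₀ h1]
  have : 6 ≤ e * max 1 (6 / e) := by
    calc (6 : ℝ) = e * (6 / e) := by field_simp
      _ ≤ _ := by gcongr; exact le_max_right _ _
  linarith

/-- The value of the Dirichlet integral `∫₀^∞ sin v / v dv`. -/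
def SiTop : ℝ := exists_tendsto_Si.choose

theorem tendsto_Si : Tendsto Si atTop (𝓝 SiTop) := exists_tendsto_Si.choose_spec

/-- The value is `π / 2`; only its positivity matters. -/
theorem SiTop_pos : 0 < SiTop := by
  have hpi := Real.pi_pos
  have h1 : Si 1 - 1 / 2 ≤ SiTop := by
    refine ge_of_tendsto tendsto_Si ?_
    filter_upwards [eventually_ge_atTop 1] with b hb
    have := Si_add_cos_sub_le one_pos hb
    have h2 := Real.one_sub_sq_div_two_le_cos (x := 1)
    have h3 : Real.cos b / b ≤ 1 / b := by
      gcongr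
      exact Real.cos_le_one b
    rw [div_one, div_one] at this
    linarith
  have h2 : 2 / Real.pi ≤ Si 1 := by
    have hm : ∫ v in (0 : ℝ)..1, 2 / Real.pi ≤ Si 1 := by
      apply intervalIntegral.integral_mono_on zero_le_one (by simp)
        (Real.continuous_sinc.intervalIntegrable _ _)
      rintro v ⟨hv0, hv1⟩
      rcases hv0.eq_or_lt with rfl | hv
      · rw [Real.sinc_zero, div_le_one hpi]
        exact Real.two_le_pi
      · rw [Real.sinc_of_ne_zero hv.ne', le_div_iff₀ hv]
        exact Real.mul_le_sin hv0 (by linarith [Real.two_le_pi])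
    simpa using hm
  have h3 : 1 / 2 < 2 / Real.pi := by
    rw [div_lt_div_iff₀ (by norm_num) hpi]
    linarith [Real.pi_lt_four]
  linarith

theorem tendsto_Si_mul (x : ℝ) :
    Tendsto (fun r => Si (x * r)) atTop (𝓝 (SiTop * SignType.sign x)) := by
  rcases lt_trichotomy x 0 with h | rfl | h
  · have : Tendsto (fun r => -Si (-x * r)) atTop (𝓝 (-SiTop)) :=
      (tendsto_Si.comp (tendsto_id.const_mul_atTop (by linarith))).neg
    simp only [← Si_neg, neg_mul, neg_neg] at this
    simpa [sign_neg h] using this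
  · simp
  · have : Tendsto (fun r => Si (x * r)) atTop (𝓝 SiTop) :=
      tendsto_Si.comp (tendsto_id.const_mul_atTop h)
    simpa [sign_pos h] using this

/-! ### Truncations of the oscillating singular kernel -/

/-- The oscillating singular kernel `e^{ixu} / u`. -/
def oscKer (x u : ℝ) : ℂ := cexpI (x * u) * ((u⁻¹ : ℝ) : ℂ)

theorem norm_oscKer (x u : ℝ) : ‖oscKer x u‖ = |u|⁻¹ := by
  rw [oscKer, norm_mul, norm_cexpI, one_mul, Complex.norm_real, Real.norm_eq_abs, abs_inv]

@[fun_prop]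
theorem measurable_oscKer (x : ℝ) : Measurable (oscKer x) := by
  unfold oscKer
  fun_prop

theorem oscKer_add_oscKer_neg (x u : ℝ) :
    oscKer x u + oscKer x (-u) = 2 * Complex.I * ((Real.sin (x * u) / u : ℝ) : ℂ) := by
  have := cexpI_sub_cexpI_neg (x * u)
  simp only [oscKer, mul_neg, inv_neg, Complex.ofReal_neg]
  rw [← sub_eq_add_neg, ← sub_mul, this]
  push_cast
  ring

/-- The symmetric shell `{r₁ < |u| < r₂}`. -/
def shell (a b : ℝ) : Set ℝ := {u | a < |u| ∧ |u| < b}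

theorem measurableSet_shell (a b : ℝ) : MeasurableSet (shell a b) :=
  (measurableSet_lt measurable_const measurable_norm).inter
    (measurableSet_lt measurable_norm measurable_const)

/-- The logarithmic measure of a symmetric shell depends only on the ratio of its radii. -/
theorem integral_inv_shell {a b : ℝ} (ha : 0 < a) (hab : a ≤ b) :
    IntegrableOn (fun u : ℝ => |u|⁻¹) {u : ℝ | a ≤ |u| ∧ |u| ≤ b} ∧
    ∫ u in {u : ℝ | a ≤ |u| ∧ |u| ≤ b}, |u|⁻¹ = 2 * Real.log (b / a) := by
  have hset : {u : ℝ | a ≤ |u| ∧ |u| ≤ b} = Icc a b ∪ Icc (-b) (-a) := by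
    ext u
    simp only [mem_ofPred_eq, mem_union, mem_Icc]
    constructor
    · rintro ⟨h1, h2⟩
      rcases le_total 0 u with h | h
      · left; rw [abs_of_nonneg h] at h1 h2; exact ⟨h1, h2⟩
      · right; rw [abs_of_nonpos h] at h1 h2; constructor <;> linarith
    · rintro (⟨h1, h2⟩ | ⟨h1, h2⟩)
      · rw [abs_of_nonneg (by linarith)]; exact ⟨h1, h2⟩
      · rw [abs_of_nonpos (by linarith)]; constructor <;> linarith
  have hdisj : Disjoint (Icc a b) (Icc (-b) (-a)) := by
    rw [Set.disjoint_left]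
    rintro u ⟨h1, _⟩ ⟨_, h2⟩
    linarith
  have hc : ContinuousOn (fun u : ℝ => |u|⁻¹) (Icc a b) := by
    apply ContinuousOn.inv₀ (by fun_prop)
    rintro u ⟨h1, _⟩
    exact (abs_pos.2 (by linarith)).ne'
  have hc' : ContinuousOn (fun u : ℝ => |u|⁻¹) (Icc (-b) (-a)) := by
    apply ContinuousOn.inv₀ (by fun_prop)
    rintro u ⟨_, h1⟩
    exact (abs_pos_of_neg (by linarith)).ne'
  have hi : IntegrableOn (fun u : ℝ => |u|⁻¹) (Icc a b) volume := hc.integrableOn_Icc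
  have hi' : IntegrableOn (fun u : ℝ => |u|⁻¹) (Icc (-b) (-a)) volume := hc'.integrableOn_Icc
  rw [hset]
  refine ⟨hi.union hi', ?_⟩
  rw [setIntegral_union hdisj measurableSet_Icc hi hi']
  have e1 : ∫ u in Icc a b, |u|⁻¹ = Real.log (b / a) := by
    rw [← integral_inv_of_pos ha (ha.trans_le hab), integral_Icc_eq_integral_Ioc,
      intervalIntegral.integral_of_le hab]
    apply setIntegral_congr_fun measurableSet_Ioc
    rintro u ⟨h1, _⟩
    simp only
    rw [abs_of_pos (ha.trans h1)]
  have e2 : ∫ u in Icc (-b) (-a), |u|⁻¹ = Real.log (b / a) := by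
    rw [integral_Icc_eq_integral_Ioc, ← intervalIntegral.integral_of_le (by linarith)]
    have := intervalIntegral.integral_comp_neg (a := a) (b := b) (fun u : ℝ => |u|⁻¹)
    rw [← this, ← e1, integral_Icc_eq_integral_Ioc, intervalIntegral.integral_of_le hab]
    simp
  rw [e1, e2]
  ring

theorem integrableOn_oscKer (x : ℝ) {a b : ℝ} (ha : 0 < a) {S : Set ℝ}
    (hS : S ⊆ {u : ℝ | a ≤ |u| ∧ |u| ≤ b}) : IntegrableOn (oscKer x) S := by
  rcases le_or_gt a b with hab | hab
  · refine Integrable.mono ((integral_inv_shell ha hab).1.mono_set hS)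
      (measurable_oscKer x).aestronglyMeasurable (ae_of_all _ fun u => ?_)
    rw [norm_oscKer]
    simp
  · have : S = ∅ := by
      rw [Set.eq_empty_iff_forall_notMem]
      intro u hu
      have := hS hu
      simp only [mem_ofPred_eq] at this
      linarith
    simp [this]

theorem norm_setIntegral_oscKer_le (x : ℝ) {a b : ℝ} (ha : 0 < a) (hab : a ≤ b) {S : Set ℝ}
    (hS : S ⊆ {u : ℝ | a ≤ |u| ∧ |u| ≤ b}) :
    ‖∫ u in S, oscKer x u‖ ≤ 2 * Real.log (b / a) := by
  rw [← (integral_inv_shell ha hab).2]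
  refine (norm_integral_le_integral_norm _).trans ?_
  simp only [norm_oscKer]
  exact setIntegral_mono_set (integral_inv_shell ha hab).1 (ae_of_all _ fun u => by positivity)
    (LE.le.eventuallyLE hS)

theorem setIntegral_inv_abs_le {a b : ℝ} (ha : 0 < a) (hab : a ≤ b) {S : Set ℝ}
    (hS : S ⊆ {u : ℝ | a ≤ |u| ∧ |u| ≤ b}) :
    ∫ u in S, |u|⁻¹ ≤ 2 * Real.log (b / a) := by
  rw [← (integral_inv_shell ha hab).2]
  exact setIntegral_mono_set (integral_inv_shell ha hab).1 (ae_of_all _ fun u => by positivity)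
    (LE.le.eventuallyLE hS)

/-- Over a symmetric shell the even part `cos (xu)` of the character cancels, and the odd part
integrates to a difference of values of the sine integral. -/
theorem setIntegral_oscKer_shell (x : ℝ) {a b : ℝ} (ha : 0 < a) (hab : a ≤ b) :
    ∫ u in shell a b, oscKer x u = 2 * Complex.I * ((Si (x * b) - Si (x * a) : ℝ) : ℂ) := by
  have hset : shell a b = Ioo a b ∪ Ioo (-b) (-a) := by
    ext u
    simp only [shell, mem_ofPred_eq, mem_union, mem_Ioo]
    constructor
    · rintro ⟨h1, h2⟩
      rcases le_total 0 u with h | h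
      · left; rw [abs_of_nonneg h] at h1 h2; exact ⟨h1, h2⟩
      · right; rw [abs_of_nonpos h] at h1 h2; constructor <;> linarith
    · rintro (⟨h1, h2⟩ | ⟨h1, h2⟩)
      · rw [abs_of_nonneg (by linarith)]; exact ⟨h1, h2⟩
      · rw [abs_of_nonpos (by linarith)]; constructor <;> linarith
  have hdisj : Disjoint (Ioo a b) (Ioo (-b) (-a)) := by
    rw [Set.disjoint_left]
    rintro u ⟨h1, _⟩ ⟨_, h2⟩
    linarith
  have hI : IntegrableOn (oscKer x) (shell a b) :=
    integrableOn_oscKer x ha (b := b) fun u hu => ⟨hu.1.le, hu.2.le⟩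
  have h1 : IntegrableOn (oscKer x) (Ioo a b) := hI.mono_set (hset ▸ subset_union_left)
  have h2 : IntegrableOn (oscKer x) (Ioo (-b) (-a)) := hI.mono_set (hset ▸ subset_union_right)
  rw [hset, setIntegral_union hdisj measurableSet_Ioo h1 h2,
    ← integral_Ioc_eq_integral_Ioo, ← integral_Ioc_eq_integral_Ioo,
    ← intervalIntegral.integral_of_le hab, ← intervalIntegral.integral_of_le (by linarith),
    ← intervalIntegral.integral_comp_neg]
  have i1 : IntervalIntegrable (oscKer x) volume a b := by
    rw [intervalIntegrable_iff_integrableOn_Ioo_of_le hab]; exact h1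
  have i2 : IntervalIntegrable (fun u => oscKer x (-u)) volume a b := by
    rw [← intervalIntegrable_iff_integrableOn_Ioo_of_le (by linarith)] at h2
    have := (IntervalIntegrable.iff_comp_neg (f := oscKer x) (a := -b) (b := -a)).1 h2
    simpa using this.symm
  rw [← intervalIntegral.integral_add i1 i2]
  simp only [oscKer_add_oscKer_neg]
  rw [intervalIntegral.integral_const_mul, intervalIntegral.integral_ofReal]
  congr 2
  have hd : ∀ u ∈ uIcc a b, HasDerivAt (fun u => Si (x * u)) (Real.sin (x * u) / u) u := by
    intro u hu
    rw [uIcc_of_le hab] at hu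
    have hu0 : u ≠ 0 := (ha.trans_le hu.1).ne'
    have := (hasDerivAt_Si (x * u)).comp u ((hasDerivAt_id u).const_mul x)
    convert! this using 1
    rcases eq_or_ne x 0 with rfl | hx
    · simp
    · rw [Real.sinc_of_ne_zero (mul_ne_zero hx hu0)]
      simp
      field_simp
  refine intervalIntegral.integral_eq_sub_of_hasDerivAt hd ?_
  apply ContinuousOn.intervalIntegrable
  rw [uIcc_of_le hab]
  apply ContinuousOn.div (by fun_prop) (by fun_prop)
  intro u hu
  exact (ha.trans_le hu.1).ne'

theorem norm_setIntegral_oscKer_shell_le (x : ℝ) {a b : ℝ} (ha : 0 < a) :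
    ‖∫ u in shell a b, oscKer x u‖ ≤ 16 := by
  rcases le_or_gt a b with hab | hab
  · rw [setIntegral_oscKer_shell x ha hab, norm_mul, norm_mul, Complex.norm_I, Complex.norm_real,
      Real.norm_eq_abs]
    have h1 := abs_Si_le (x * b)
    have h2 := abs_Si_le (x * a)
    have h3 := abs_sub (Si (x * b)) (Si (x * a))
    have : ‖(2 : ℂ)‖ = 2 := by simp
    rw [this]
    linarith
  · have : shell a b = ∅ := by
      rw [Set.eq_empty_iff_forall_notMem]
      rintro u ⟨h1, h2⟩
      linarith
    simp [this]

theorem setIntegral_sub_setIntegral {E : Type*} [NormedAddCommGroup E] [NormedSpace ℝ E]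
    {f : ℝ → E} {S T : Set ℝ} (hS : MeasurableSet S) (hT : MeasurableSet T)
    (fS : IntegrableOn f S) (fT : IntegrableOn f T) :
    (∫ u in S, f u) - ∫ u in T, f u = (∫ u in S \ T, f u) - ∫ u in T \ S, f u := by
  have h1 := integral_inter_add_sdiff hT fS
  have h2 := integral_inter_add_sdiff hS fT
  rw [← h1, ← h2, inter_comm T S]
  abel

/-- If a set lies between two symmetric shells whose radii are comparable, the integral of
`e^{ixu} / u` over it is bounded: over the inner shell only the odd part `sin (xu) / u` counts, and
the remainder has bounded logarithmic measure. -/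
theorem norm_setIntegral_oscKer_le_of_shell (x : ℝ) {a b l : ℝ} (ha : 0 < a) (hb : 0 < b)
    (hl : 1 ≤ l) {S : Set ℝ} (hm : MeasurableSet S) (h1 : shell (l * a) (b / l) ⊆ S)
    (h2 : S ⊆ {u : ℝ | a / l ≤ |u| ∧ |u| ≤ l * b}) :
    ‖∫ u in S, oscKer x u‖ ≤ 16 + 8 * Real.log l := by
  have hl0 : 0 < l := by linarith
  have hla : 0 < a / l := by positivity
  have iS : IntegrableOn (oscKer x) S := integrableOn_oscKer x hla h2
  have iT := iS.mono_set h1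
  have hmT := measurableSet_shell (l * a) (b / l)
  have hT := norm_setIntegral_oscKer_shell_le x (a := l * a) (b := b / l) (by positivity)
  have hll : a / l ≤ l * a := by
    rw [div_le_iff₀ hl0]
    nlinarith [mul_nonneg ha.le (by nlinarith : (0 : ℝ) ≤ l * l - 1)]
  have hlb : b / l ≤ l * b := by
    rw [div_le_iff₀ hl0]
    nlinarith [mul_nonneg hb.le (by nlinarith : (0 : ℝ) ≤ l * l - 1)]
  have key := setIntegral_sub_setIntegral hm hmT iS iT
  rw [sdiff_eq_empty.2 h1] at key
  simp only [Measure.restrict_empty, integral_zero_measure, sub_zero] at key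
  have hm1 : MeasurableSet {u : ℝ | |u| ≤ l * a} :=
    measurableSet_le measurable_norm measurable_const
  have hmD := hm.diff hmT
  have iD : IntegrableOn (oscKer x) (S \ shell (l * a) (b / l)) := iS.mono_set sdiff_subset
  have hsplit := integral_inter_add_sdiff hm1 iD
  have n1 := norm_setIntegral_oscKer_le x hla hll
    (S := (S \ shell (l * a) (b / l)) ∩ {u | |u| ≤ l * a}) (fun u hu => ⟨(h2 hu.1.1).1, hu.2⟩)
  have n2 := norm_setIntegral_oscKer_le x (by positivity : 0 < b / l) hlb
    (S := (S \ shell (l * a) (b / l)) \ {u | |u| ≤ l * a}) (fun u hu => by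
      refine ⟨?_, (h2 hu.1.1).2⟩
      by_contra hcon
      exact hu.1.2 ⟨not_le.1 hu.2, not_le.1 hcon⟩)
  have e1 : Real.log (l * a / (a / l)) = 2 * Real.log l := by
    rw [show l * a / (a / l) = l ^ 2 by field_simp, Real.log_pow]; norm_num
  have e2 : Real.log (l * b / (b / l)) = 2 * Real.log l := by
    rw [show l * b / (b / l) = l ^ 2 by field_simp, Real.log_pow]; norm_num
  rw [e1] at n1
  rw [e2] at n2
  have : ∫ u in S, oscKer x u = (∫ u in shell (l * a) (b / l), oscKer x u) +
      ((∫ u in (S \ shell (l * a) (b / l)) ∩ {u | |u| ≤ l * a}, oscKer x u) +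
      ∫ u in (S \ shell (l * a) (b / l)) \ {u | |u| ≤ l * a}, oscKer x u) := by
    rw [hsplit, ← key]; abel
  rw [this]
  refine (norm_add_le _ _).trans ?_
  have := norm_add_le (∫ u in (S \ shell (l * a) (b / l)) ∩ {u | |u| ≤ l * a}, oscKer x u)
      (∫ u in (S \ shell (l * a) (b / l)) \ {u | |u| ≤ l * a}, oscKer x u)
  linarith

/-- Two families of truncations of `e^{ixu} / u` have the same limit if their symmetric differences
lie in shells of ratio tending to `1`. -/
theorem tendsto_setIntegral_oscKer_sub (x : ℝ) {ι : Type*} {F : Filter ι} {S T : ι → Set ℝ}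
    {r : ι → ℝ} (hr : ∀ᶠ i in F, 0 < r i) (hS : ∀ᶠ i in F, MeasurableSet (S i))
    (hT : ∀ᶠ i in F, MeasurableSet (T i))
    (iS : ∀ᶠ i in F, IntegrableOn (oscKer x) (S i)) (iT : ∀ᶠ i in F, IntegrableOn (oscKer x) (T i))
    (hST : ∀ l : ℝ, 1 < l → ∀ᶠ i in F, ∀ u, u ∈ S i \ T i ∪ T i \ S i →
      r i / l ≤ |u| ∧ |u| ≤ l * r i) :
    Tendsto (fun i => (∫ u in S i, oscKer x u) - ∫ u in T i, oscKer x u) F (𝓝 0) := by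
  rw [Metric.tendsto_nhds]
  intro e he
  -- shells of ratio `l²` have logarithmic measure `4 log l`, so `l = exp (e / 16)` makes it small
  have hl : 1 < Real.exp (e / 16) := Real.one_lt_exp_iff.2 (by positivity)
  filter_upwards [hr, hS, hT, iS, iT, hST _ hl] with i hr hS hT iS iT hST
  set l := Real.exp (e / 16)
  have hl0 : 0 < l := by linarith
  have h0 : 0 < r i / l := by positivity
  have hle : r i / l ≤ l * r i := by
    rw [div_le_iff₀ hl0]
    nlinarith [mul_nonneg hr.le (by nlinarith : (0 : ℝ) ≤ l * l - 1)]
  rw [dist_zero_right, setIntegral_sub_setIntegral hS hT iS iT]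
  have n1 := norm_setIntegral_oscKer_le x h0 hle (fun u hu => hST u (Or.inl hu))
  have n2 := norm_setIntegral_oscKer_le x h0 hle (fun u hu => hST u (Or.inr hu))
  have e1 : Real.log (l * r i / (r i / l)) = 2 * (e / 16) := by
    rw [show l * r i / (r i / l) = l ^ 2 by field_simp, Real.log_pow, Real.log_exp]; norm_num
  rw [e1] at n1 n2
  have := norm_sub_le (∫ u in S i \ T i, oscKer x u) (∫ u in T i \ S i, oscKer x u)
  linarith

/-! ### Uniformly bounded principal values -/

/-- The truncation `{ε < |g| < 1/ε}`. -/
def band (g : ℝ → ℝ) (ε : ℝ) : Set ℝ := {ξ | ε < |g ξ| ∧ |g ξ| < 1 / ε}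

/-- The level layer `{ε < |g| < 2ε}`. -/
def layer (g : ℝ → ℝ) (ε : ℝ) : Set ℝ := {ξ | ε < |g ξ| ∧ |g ξ| < 2 * ε}

theorem measurableSet_band {g : ℝ → ℝ} (hg : Measurable g) (ε : ℝ) : MeasurableSet (band g ε) :=
  (measurableSet_lt measurable_const hg.norm).inter (measurableSet_lt hg.norm measurable_const)

theorem measurableSet_layer {g : ℝ → ℝ} (hg : Measurable g) (ε : ℝ) : MeasurableSet (layer g ε) :=
  (measurableSet_lt measurable_const hg.norm).inter (measurableSet_lt hg.norm measurable_const)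

/-- `k` is integrable on all the truncations `{ε < |g| < 1/ε}`, the truncated Fourier transforms of
`k` are bounded by `B` and converge as `ε → 0`, and `k` has mass at most `B` on the layers
`{ε < |g| < 2ε}`. -/
structure PVBounded (B : ℝ) (g k : ℝ → ℝ) : Prop where
  integrableOn_band : ∀ ε, 0 < ε → IntegrableOn k (band g ε)
  norm_le : ∀ ε, 0 < ε → ∀ x, ‖∫ ξ in band g ε, cexpI (x * ξ) * (k ξ : ℂ)‖ ≤ B
  exists_tendsto : ∀ x, ∃ L, Tendsto (fun ε => ∫ ξ in band g ε, cexpI (x * ξ) * (k ξ : ℂ))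
    (𝓝[>] 0) (𝓝 L)
  integrableOn_layer : ∀ ε, 0 < ε → IntegrableOn k (layer g ε)
  layer_le : ∀ ε, 0 < ε → ∫ ξ in layer g ε, |k ξ| ≤ B

theorem integrableOn_cexpI_mul {k : ℝ → ℝ} {S : Set ℝ} (h : IntegrableOn k S) (x : ℝ) :
    IntegrableOn (fun ξ => cexpI (x * ξ) * (k ξ : ℂ)) S := by
  refine Integrable.mono h.norm ?_ (ae_of_all _ fun ξ => ?_)
  · exact (Continuous.aestronglyMeasurable (by fun_prop)).mul
      (Complex.continuous_ofReal.comp_aestronglyMeasurable h.aestronglyMeasurable)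
  · simp [norm_cexpI]

namespace PVBounded
variable {B B' : ℝ} {g k k' : ℝ → ℝ}

theorem mono (h : PVBounded B g k) (hB : B ≤ B') : PVBounded B' g k where
  integrableOn_band := h.integrableOn_band
  norm_le ε hε x := (h.norm_le ε hε x).trans hB
  exists_tendsto := h.exists_tendsto
  integrableOn_layer := h.integrableOn_layer
  layer_le ε hε := (h.layer_le ε hε).trans hB

/-- Values of the kernel on the zero set of `g`, where `w / g` is a junk value, do not matter. -/
theorem congr (hg : Measurable g) (h : PVBounded B g k) (hk : ∀ ξ, g ξ ≠ 0 → k ξ = k' ξ) :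
    PVBounded B g k' := by
  have h1 : ∀ ε, 0 < ε → EqOn k k' (band g ε) := fun ε hε ξ hξ =>
    hk ξ (abs_pos.1 (hε.trans hξ.1))
  have h2 : ∀ ε, 0 < ε → EqOn k k' (layer g ε) := fun ε hε ξ hξ =>
    hk ξ (abs_pos.1 (hε.trans hξ.1))
  have h3 : ∀ ε, 0 < ε → ∀ x, ∫ ξ in band g ε, cexpI (x * ξ) * (k' ξ : ℂ) =
      ∫ ξ in band g ε, cexpI (x * ξ) * (k ξ : ℂ) := fun ε hε x =>
    setIntegral_congr_fun (measurableSet_band hg ε) fun ξ hξ => by simp only [h1 ε hε hξ]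
  refine ⟨fun ε hε => (h.integrableOn_band ε hε).congr_fun (h1 ε hε) (measurableSet_band hg ε),
    fun ε hε x => ?_, fun x => ?_,
    fun ε hε => (h.integrableOn_layer ε hε).congr_fun (h2 ε hε) (measurableSet_layer hg ε),
    fun ε hε => ?_⟩
  · rw [h3 ε hε]; exact h.norm_le ε hε x
  · obtain ⟨L, hL⟩ := h.exists_tendsto x
    refine ⟨L, hL.congr' ?_⟩
    filter_upwards [self_mem_nhdsWithin] with ε hε
    rw [h3 ε hε]
  · have : ∫ ξ in layer g ε, |k' ξ| = ∫ ξ in layer g ε, |k ξ| :=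
      setIntegral_congr_fun (measurableSet_layer hg ε) fun ξ hξ => by simp only [h2 ε hε hξ]
    rw [this]; exact h.layer_le ε hε

theorem add (h : PVBounded B g k) (h' : PVBounded B' g k') :
    PVBounded (B + B') g (fun ξ => k ξ + k' ξ) := by
  have e : ∀ ε, 0 < ε → ∀ x, ∫ ξ in band g ε, cexpI (x * ξ) * ((k ξ + k' ξ : ℝ) : ℂ) =
      (∫ ξ in band g ε, cexpI (x * ξ) * (k ξ : ℂ)) +
        ∫ ξ in band g ε, cexpI (x * ξ) * (k' ξ : ℂ) := by
    intro ε hε x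
    rw [← integral_add (integrableOn_cexpI_mul (h.integrableOn_band ε hε) x)
      (integrableOn_cexpI_mul (h'.integrableOn_band ε hε) x)]
    congr 1
    ext ξ
    push_cast
    ring
  refine ⟨fun ε hε => (h.integrableOn_band ε hε).add (h'.integrableOn_band ε hε),
    fun ε hε x => ?_, fun x => ?_,
    fun ε hε => (h.integrableOn_layer ε hε).add (h'.integrableOn_layer ε hε), fun ε hε => ?_⟩
  · rw [e ε hε]
    exact (norm_add_le _ _).trans (add_le_add (h.norm_le ε hε x) (h'.norm_le ε hε x))
  · obtain ⟨L, hL⟩ := h.exists_tendsto x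
    obtain ⟨L', hL'⟩ := h'.exists_tendsto x
    refine ⟨L + L', (hL.add hL').congr' ?_⟩
    filter_upwards [self_mem_nhdsWithin] with ε hε
    rw [e ε hε]
  · have i1 := (h.integrableOn_layer ε hε).abs
    have i2 := (h'.integrableOn_layer ε hε).abs
    refine le_trans ?_ (add_le_add (h.layer_le ε hε) (h'.layer_le ε hε))
    rw [← integral_add i1 i2]
    exact integral_mono ((h.integrableOn_layer ε hε).add (h'.integrableOn_layer ε hε)).abs
      (i1.add i2) fun ξ => abs_add_le _ _

theorem const_mul (h : PVBounded B g k) (c : ℝ) : PVBounded (|c| * B) g (fun ξ => c * k ξ) := by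
  have e : ∀ ε x, ∫ ξ in band g ε, cexpI (x * ξ) * ((c * k ξ : ℝ) : ℂ) =
      c * ∫ ξ in band g ε, cexpI (x * ξ) * (k ξ : ℂ) := by
    intro ε x
    rw [← integral_const_mul]
    congr 1
    ext ξ
    push_cast
    ring
  refine ⟨fun ε hε => (h.integrableOn_band ε hε).const_mul c, fun ε hε x => ?_, fun x => ?_,
    fun ε hε => (h.integrableOn_layer ε hε).const_mul c, fun ε hε => ?_⟩
  · rw [e, norm_mul, Complex.norm_real, Real.norm_eq_abs]
    gcongr
    exact h.norm_le ε hε x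
  · obtain ⟨L, hL⟩ := h.exists_tendsto x
    simp only [e]
    exact ⟨_, hL.const_mul _⟩
  · simp only [abs_mul]
    rw [integral_const_mul]
    gcongr
    exact h.layer_le ε hε

theorem zero (hB : 0 ≤ B) : PVBounded B g (fun _ => 0) := by
  refine ⟨fun _ _ => integrableOn_zero, ?_, fun x => ⟨0, ?_⟩, fun _ _ => integrableOn_zero, ?_⟩ <;>
    simp [hB]

/-- For an integrable kernel the truncation only removes the zero set of `g` in the limit. -/
theorem of_integrable (hg : Measurable g) (hk : Integrable k) (hB : ∫ ξ, |k ξ| ≤ B) :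
    PVBounded B g k := by
  have hset : ∀ S : Set ℝ, ∫ ξ in S, |k ξ| ≤ B := fun S =>
    (setIntegral_le_integral hk.abs (ae_of_all _ fun _ => abs_nonneg _)).trans hB
  refine ⟨fun _ _ => hk.integrableOn, fun ε hε x => ?_, fun x => ?_, fun _ _ => hk.integrableOn,
    fun ε hε => hset _⟩
  · refine (norm_integral_le_integral_norm _).trans ?_
    simpa [norm_cexpI] using hset (band g ε)
  · refine ⟨∫ ξ, {ξ | g ξ ≠ 0}.indicator (fun ξ => cexpI (x * ξ) * (k ξ : ℂ)) ξ, ?_⟩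
    simp_rw [← integral_indicator (measurableSet_band hg _)]
    have hk' := integrableOn_univ.1 (integrableOn_cexpI_mul hk.integrableOn x)
    refine tendsto_integral_filter_of_dominated_convergence (fun ξ => |k ξ|) ?_ ?_ hk.abs ?_
    · exact Eventually.of_forall fun ε => hk'.1.indicator (measurableSet_band hg ε)
    · refine Eventually.of_forall fun ε => ae_of_all _ fun ξ => ?_
      refine (norm_indicator_le_norm_self _ _).trans ?_
      simp [norm_cexpI]
    · refine ae_of_all _ fun ξ => ?_
      apply tendsto_const_nhds.congr'
      rcases eq_or_ne (g ξ) 0 with h0 | h0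
      · filter_upwards [self_mem_nhdsWithin] with ε hε
        have hε : 0 < ε := hε
        rw [indicator_of_notMem (by simp [h0]), indicator_of_notMem]
        rintro ⟨h1, -⟩
        rw [h0, abs_zero] at h1
        linarith
      · have h1 := abs_pos.2 h0
        have h2 : 0 < min |g ξ| (1 / (|g ξ|)) := lt_min h1 (by positivity)
        filter_upwards [Ioo_mem_nhdsGT h2] with ε hε
        rw [indicator_of_mem (by exact h0), indicator_of_mem]
        refine ⟨hε.2.trans_le (min_le_left _ _), ?_⟩
        rw [lt_div_comm₀ h1 hε.1]
        exact hε.2.trans_le (min_le_right _ _)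

end PVBounded

/-- `g` vanishes to first order at `ξ₀`: on the ball of radius `δ` it is comparable to `|ξ - ξ₀|`
with ratio of the bounds at most `l²`, and asymptotically proportional to it. -/
def NearRoot (l δ : ℝ) (g : ℝ → ℝ) (ξ₀ : ℝ) : Prop :=
  (∃ d > 0, ∀ u, |u| < δ → d / l * |u| ≤ |g (ξ₀ + u)| ∧ |g (ξ₀ + u)| ≤ l * d * |u|) ∧
  ∃ d > 0, ∀ r, 1 < r → ∃ η > 0, ∀ u, |u| < η →
    d / r * |u| ≤ |g (ξ₀ + u)| ∧ |g (ξ₀ + u)| ≤ r * d * |u|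

/-- `g` grows like a power: for `|u| > R` it is comparable to `|u| ^ n`, and asymptotically
proportional to it. -/
def FarPower (l R : ℝ) (g : ℝ → ℝ) : Prop :=
  ∃ d > 0, ∃ n : ℕ, n ≠ 0 ∧
    (∀ u, R < |u| → (d / l * |u|) ^ n ≤ |g u| ∧ |g u| ≤ (l * d * |u|) ^ n) ∧
    ∀ r, 1 < r → ∃ ρ, ∀ u, ρ < |u| → (d / r * |u|) ^ n ≤ |g u| ∧ |g u| ≤ (r * d * |u|) ^ n

theorem two_mul_log_le {l : ℝ} (hl : 1 ≤ l) : 2 * Real.log (2 * l ^ 2) ≤ 16 + 8 * Real.log l := by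
  rw [Real.log_mul (by norm_num) (by positivity), Real.log_pow]
  have := Real.log_two_lt_d9
  have := Real.log_nonneg hl
  push_cast
  linarith

/-- The truncated singular kernel at a simple root. -/
def nearKer (δ ξ₀ ξ : ℝ) : ℝ := if |ξ - ξ₀| < δ then (ξ - ξ₀)⁻¹ else 0

/-- The kernel `1 / ξ` truncated to large `ξ`. -/
def farKer (R ξ : ℝ) : ℝ := if R < |ξ| then ξ⁻¹ else 0

theorem measurable_nearKer (δ ξ₀ : ℝ) : Measurable (nearKer δ ξ₀) :=
  Measurable.ite (measurableSet_lt (by fun_prop) measurable_const) (by fun_prop) measurable_const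

theorem measurable_farKer (R : ℝ) : Measurable (farKer R) :=
  Measurable.ite (measurableSet_lt measurable_const measurable_norm) (by fun_prop) measurable_const

/-- At a simple root, `{ε < |g| < 1/ε}` is a symmetric truncation at `|u| ~ ε` up to a fixed factor,
and asymptotically up to a factor close to `1`. -/
theorem pvBounded_near_zero {g : ℝ → ℝ} (hg : Measurable g) {l δ : ℝ} (hl : 1 ≤ l) (hδ : 0 < δ)
    (h : NearRoot l δ g 0) : PVBounded (16 + 8 * Real.log l) g (nearKer δ 0) := by
  obtain ⟨⟨d, hd, hb⟩, d', hd', hlim⟩ := h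
  simp only [zero_add] at hb hlim
  have hl0 : 0 < l := by linarith
  set D : Set ℝ := {u | |u| < δ} with hD
  have mD : MeasurableSet D := measurableSet_lt measurable_norm measurable_const
  have hker : ∀ (x : ℝ), (fun u => cexpI (x * u) * (nearKer δ 0 u : ℂ)) =
      D.indicator (oscKer x) := by
    intro x
    ext u
    by_cases hu : |u| < δ
    · rw [indicator_of_mem (by exact hu)]; simp [nearKer, hu, oscKer]
    · rw [indicator_of_notMem (by exact hu)]; simp [nearKer, hu]
  have hker' : (fun u => |nearKer δ 0 u|) = D.indicator (fun u => |u|⁻¹) := by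
    ext u
    by_cases hu : |u| < δ
    · rw [indicator_of_mem (by exact hu)]; simp [nearKer, hu, abs_inv]
    · rw [indicator_of_notMem (by exact hu)]; simp [nearKer, hu]
  have mS : ∀ ε, MeasurableSet (band g ε ∩ D) := fun ε => (measurableSet_band hg ε).inter mD
  have hS1 : ∀ ε, 0 < ε → shell (l * (ε / d)) (min δ (1 / (ε * d)) / l) ⊆ band g ε ∩ D := by
    intro ε hε u hu
    obtain ⟨h1, h2⟩ := hu
    rw [lt_div_iff₀ hl0] at h2
    have h3 : |u| * l < δ := h2.trans_le (min_le_left _ _)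
    have h4 : |u| * l < 1 / (ε * d) := h2.trans_le (min_le_right _ _)
    have hu : |u| < δ := by nlinarith [abs_nonneg u]
    obtain ⟨b1, b2⟩ := hb u hu
    refine ⟨⟨?_, ?_⟩, hu⟩
    · refine lt_of_lt_of_le ?_ b1
      calc ε = d / l * (l * (ε / d)) := by field_simp
        _ < _ := by gcongr
    · refine b2.trans_lt ?_
      calc l * d * |u| = d * (|u| * l) := by ring
        _ < d * (1 / (ε * d)) := by gcongr
        _ = 1 / ε := by field_simp
  have hS2 : ∀ ε, 0 < ε → band g ε ∩ D ⊆
      {u | ε / d / l ≤ |u| ∧ |u| ≤ l * min δ (1 / (ε * d))} := by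
    rintro ε hε u ⟨⟨h1, h2⟩, hu⟩
    have hu : |u| < δ := hu
    obtain ⟨b1, b2⟩ := hb u hu
    constructor
    · rw [div_div, div_le_iff₀ (by positivity)]
      linarith
    · rw [← div_le_iff₀' hl0]
      apply le_min
      · rw [div_le_iff₀ hl0]; nlinarith
      · rw [le_div_iff₀ (by positivity)]
        have : d / l * |u| ≤ 1 / ε := by linarith
        rw [le_div_iff₀ hε] at this
        calc |u| / l * (ε * d) = d / l * |u| * ε := by ring
          _ ≤ 1 := this
  have hL : ∀ ε, 0 < ε → layer g ε ∩ D ⊆ {u | ε / (l * d) ≤ |u| ∧ |u| ≤ 2 * l * ε / d} := by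
    rintro ε hε u ⟨⟨h1, h2⟩, hu⟩
    obtain ⟨b1, b2⟩ := hb u hu
    constructor
    · rw [div_le_iff₀ (by positivity)]
      linarith
    · have : d / l * |u| ≤ 2 * ε := by linarith
      rw [le_div_iff₀ hd]
      calc |u| * d = l * (d / l * |u|) := by field_simp
        _ ≤ l * (2 * ε) := by gcongr
        _ = _ := by ring
  have hleL : ∀ ε, 0 < ε → ε / (l * d) ≤ 2 * l * ε / d := by
    intro ε hε
    rw [div_le_div_iff₀ (by positivity) hd]
    have : 1 ≤ 2 * l * l := by nlinarith
    nlinarith [mul_pos hε hd]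
  have iS : ∀ ε, 0 < ε → ∀ x, IntegrableOn (oscKer x) (band g ε ∩ D) := fun ε hε x =>
    integrableOn_oscKer x (by positivity) (hS2 ε hε)
  have absint : ∀ S : Set ℝ, IntegrableOn (oscKer 0) (S ∩ D) → IntegrableOn (nearKer δ 0) S := by
    intro S h
    have e : IntegrableOn (D.indicator (oscKer 0)) S := by
      rw [integrableOn_indicator_iff mD, inter_comm]; exact h
    rw [← hker] at e
    refine Integrable.mono e (measurable_nearKer δ 0).aestronglyMeasurable (ae_of_all _ fun u => ?_)
    simp [norm_cexpI]
  refine ⟨fun ε hε => absint _ (iS ε hε 0), fun ε hε x => ?_, fun x => ?_,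
    fun ε hε => absint _ (integrableOn_oscKer 0 (by positivity) (hL ε hε)), fun ε hε => ?_⟩
  · rw [hker, setIntegral_indicator mD]
    exact norm_setIntegral_oscKer_le_of_shell x (by positivity : 0 < ε / d)
      (lt_min hδ (by positivity)) hl (mS ε) (hS1 ε hε) (hS2 ε hε)
  · simp only [hker, setIntegral_indicator mD]
    have hT : Tendsto (fun ε => ∫ u in shell (ε / d') δ, oscKer x u) (𝓝[>] 0)
        (𝓝 (2 * Complex.I * ((Si (x * δ) - Si (x * (0 / d')) : ℝ) : ℂ))) := by
      have h1 : Tendsto (fun ε => 2 * Complex.I * ((Si (x * δ) - Si (x * (ε / d')) : ℝ) : ℂ))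
          (𝓝[>] 0) (𝓝 (2 * Complex.I * ((Si (x * δ) - Si (x * (0 / d')) : ℝ) : ℂ))) :=
        (Continuous.tendsto (by fun_prop) 0).mono_left nhdsWithin_le_nhds
      refine h1.congr' ?_
      filter_upwards [Ioo_mem_nhdsGT (by positivity : 0 < δ * d')] with ε hε
      rw [setIntegral_oscKer_shell x (div_pos hε.1 hd') ((div_le_iff₀ hd').2 hε.2.le)]
    have hpos : ∀ᶠ ε : ℝ in 𝓝[>] 0, 0 < ε := self_mem_nhdsWithin
    have hsub := tendsto_setIntegral_oscKer_sub x (F := 𝓝[>] (0 : ℝ))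
      (S := fun ε => band g ε ∩ D) (T := fun ε => shell (ε / d') δ) (r := fun ε => ε / d')
      (hpos.mono fun ε hε => div_pos hε hd') (Eventually.of_forall mS)
      (Eventually.of_forall fun ε => measurableSet_shell _ _) (hpos.mono fun ε hε => iS ε hε x)
      (hpos.mono fun ε hε => integrableOn_oscKer x (div_pos hε hd') (b := δ)
        fun u hu => ⟨hu.1.le, hu.2.le⟩) ?_
    · have := hsub.add hT
      simp only [sub_add_cancel] at this
      exact ⟨_, this⟩
    intro r hr
    have hr0 : 0 < r := by linarith
    obtain ⟨η, hη, hη'⟩ := hlim r hr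
    have hsmall : 0 < min (min (η * d') (η * d / l)) (1 / (l * d * δ)) := by positivity
    filter_upwards [Ioo_mem_nhdsGT hsmall] with ε hε u hu
    obtain ⟨hε0, hε1⟩ := hε
    have c1 : ε < η * d' := hε1.trans_le ((min_le_left _ _).trans (min_le_left _ _))
    have c2 : ε < η * d / l := hε1.trans_le ((min_le_left _ _).trans (min_le_right _ _))
    have c3 : ε < 1 / (l * d * δ) := hε1.trans_le (min_le_right _ _)
    rw [lt_div_iff₀ hl0] at c2
    rw [lt_div_iff₀ (by positivity)] at c3
    rw [div_div, div_le_iff₀ (by positivity), ← mul_div_assoc, le_div_iff₀ hd']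
    rcases hu with ⟨⟨⟨g1, g2⟩, uD⟩, hu⟩ | ⟨⟨u1, u2⟩, hu⟩
    · have uD : |u| < δ := uD
      have hle : |u| ≤ ε / d' := by
        by_contra hc
        exact hu ⟨not_le.1 hc, uD⟩
      rw [le_div_iff₀ hd'] at hle
      obtain ⟨b1, b2⟩ := hη' u (by nlinarith)
      constructor
      · linarith
      · nlinarith
    · have hg' : |g u| ≤ ε := by
        by_contra hc
        refine hu ⟨⟨not_le.1 hc, ?_⟩, u2⟩
        rw [lt_div_iff₀ hε0]
        have := (hb u u2).2
        have h3 : |g u| ≤ l * d * δ := this.trans (by gcongr)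
        nlinarith
      rw [div_lt_iff₀ hd'] at u1
      have h4 : |u| < η := by
        have := (hb u u2).1.trans hg'
        rw [div_mul_eq_mul_div, div_le_iff₀ hl0] at this
        nlinarith
      obtain ⟨b1, b2⟩ := hη' u h4
      constructor
      · nlinarith
      · have := b1.trans hg'
        rw [div_mul_eq_mul_div, div_le_iff₀ hr0] at this
        linarith
  · rw [hker', setIntegral_indicator mD]
    refine (setIntegral_inv_abs_le (by positivity) (hleL ε hε) (hL ε hε)).trans ?_
    rw [show 2 * l * ε / d / (ε / (l * d)) = 2 * l ^ 2 by field_simp]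
    exact two_mul_log_le hl

/-- Translation of the variable changes the truncated Fourier transforms by a unimodular factor. -/
theorem PVBounded.of_translate {B : ℝ} {g k : ℝ → ℝ} (hg : Measurable g) (a : ℝ)
    (h : PVBounded B (fun u => g (a + u)) (fun u => k (a + u))) : PVBounded B g k := by
  have hmp : MeasurePreserving (fun u : ℝ => a + u) volume volume :=
    measurePreserving_add_left volume a
  have hemb : MeasurableEmbedding (fun u : ℝ => a + u) := measurableEmbedding_addLeft a
  have hint : ∀ S : Set ℝ, IntegrableOn (fun u => k (a + u)) ((fun u => a + u) ⁻¹' S) →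
      IntegrableOn k S := fun S hS => (hmp.integrableOn_comp_preimage hemb).1 hS
  have hI : ∀ ε x, ∫ ξ in band g ε, cexpI (x * ξ) * (k ξ : ℂ) = cexpI (x * a) *
      ∫ u in band (fun u => g (a + u)) ε, cexpI (x * u) * (k (a + u) : ℂ) := by
    intro ε x
    rw [← hmp.setIntegral_preimage_emb hemb, ← integral_const_mul]
    refine setIntegral_congr_fun ((measurableSet_band hg ε).preimage hmp.measurable) fun u _ => ?_
    simp only [mul_add, cexpI_add, mul_assoc]
  refine ⟨fun ε hε => hint _ (h.integrableOn_band ε hε), fun ε hε x => ?_, fun x => ?_,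
    fun ε hε => hint _ (h.integrableOn_layer ε hε), fun ε hε => ?_⟩
  · rw [hI, norm_mul, norm_cexpI, one_mul]
    exact h.norm_le ε hε x
  · obtain ⟨L, hL⟩ := h.exists_tendsto x
    simp only [hI]
    exact ⟨_, hL.const_mul _⟩
  · rw [← hmp.setIntegral_preimage_emb hemb]
    exact h.layer_le ε hε

theorem pvBounded_near {g : ℝ → ℝ} (hg : Measurable g) {l δ ξ₀ : ℝ} (hl : 1 ≤ l) (hδ : 0 < δ)
    (h : NearRoot l δ g ξ₀) : PVBounded (16 + 8 * Real.log l) g (nearKer δ ξ₀) := by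
  apply PVBounded.of_translate hg ξ₀
  have h0 : NearRoot l δ (fun u => g (ξ₀ + u)) 0 := by
    simpa [NearRoot] using h
  have := pvBounded_near_zero (hg.comp (measurable_const_add ξ₀)) hl hδ h0
  convert! this using 1
  ext u
  simp [nearKer]

/-- At infinity, `{ε < |g| < 1/ε}` truncates at `|u| ~ ε^{-1/n}` up to a fixed factor, and
asymptotically up to a factor close to `1`. For `ε` not small it also truncates from below. -/
theorem pvBounded_far {g : ℝ → ℝ} (hg : Measurable g) {l R : ℝ} (hl : 1 ≤ l) (hR : 0 < R)
    (h : FarPower l R g) : PVBounded (16 + 8 * Real.log l) g (farKer R) := by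
  obtain ⟨d, hd, n, hn, hb, hlim⟩ := h
  have hl0 : 0 < l := by linarith
  set D : Set ℝ := {u | R < |u|} with hD
  have mD : MeasurableSet D := measurableSet_lt measurable_const measurable_norm
  have hker : ∀ (x : ℝ), (fun u => cexpI (x * u) * (farKer R u : ℂ)) = D.indicator (oscKer x) := by
    intro x
    ext u
    by_cases hu : R < |u|
    · rw [indicator_of_mem (by exact hu)]; simp [farKer, hu, oscKer]
    · rw [indicator_of_notMem (by exact hu)]; simp [farKer, hu]
  have hker' : (fun u => |farKer R u|) = D.indicator (fun u => |u|⁻¹) := by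
    ext u
    by_cases hu : R < |u|
    · rw [indicator_of_mem (by exact hu)]; simp [farKer, hu, abs_inv]
    · rw [indicator_of_notMem (by exact hu)]; simp [farKer, hu]
  have mS : ∀ ε, MeasurableSet (band g ε ∩ D) := fun ε => (measurableSet_band hg ε).inter mD
  have root : ∀ ε : ℝ, 0 < ε → ∃ e : ℝ, 0 < e ∧ e ^ n = ε := fun ε hε =>
    ⟨ε ^ (1 / n : ℝ), by positivity, by
      rw [← Real.rpow_natCast, ← Real.rpow_mul hε.le]; field_simp; simp⟩
  have hS1 : ∀ e, 0 < e → shell (l * max R (e / d)) ((1 / (e * d)) / l) ⊆ band g (e ^ n) ∩ D := by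
    intro e he u hu
    obtain ⟨h1, h2⟩ := hu
    have h3 : l * R < |u| := lt_of_le_of_lt (by gcongr; exact le_max_left _ _) h1
    have h4 : l * (e / d) < |u| := lt_of_le_of_lt (by gcongr; exact le_max_right _ _) h1
    have hu : R < |u| := by nlinarith
    obtain ⟨b1, b2⟩ := hb u hu
    refine ⟨⟨lt_of_lt_of_le ?_ b1, b2.trans_lt ?_⟩, hu⟩
    · refine pow_lt_pow_left₀ ?_ he.le hn
      calc e = d / l * (l * (e / d)) := by field_simp
        _ < _ := by gcongr
    · rw [← one_div_pow]
      refine pow_lt_pow_left₀ ?_ (by positivity) hn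
      calc l * d * |u| < l * d * ((1 / (e * d)) / l) := by gcongr
        _ = 1 / e := by field_simp
  have hS2 : ∀ e, 0 < e → band g (e ^ n) ∩ D ⊆
      {u | max R (e / d) / l ≤ |u| ∧ |u| ≤ l * (1 / (e * d))} := by
    rintro e he u ⟨⟨h1, h2⟩, hu⟩
    have hu : R < |u| := hu
    obtain ⟨b1, b2⟩ := hb u hu
    constructor
    · rw [div_le_iff₀ hl0]
      apply max_le
      · nlinarith [abs_nonneg u]
      · rw [div_le_iff₀ hd]
        have := lt_of_pow_lt_pow_left₀ n (by positivity) (h1.trans_le b2)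
        linarith
    · rw [← one_div_pow] at h2
      have := lt_of_pow_lt_pow_left₀ n (by positivity) (b1.trans_lt h2)
      calc |u| = (l / d) * (d / l * |u|) := by field_simp
        _ ≤ (l / d) * (1 / e) := by gcongr
        _ = _ := by field_simp
  have hL : ∀ e, 0 < e → layer g (e ^ n) ∩ D ⊆ {u | e / (l * d) ≤ |u| ∧ |u| ≤ 2 * l * e / d} := by
    rintro e he u ⟨⟨h1, h2⟩, hu⟩
    obtain ⟨b1, b2⟩ := hb u hu
    constructor
    · have := lt_of_pow_lt_pow_left₀ n (by positivity) (h1.trans_le b2)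
      rw [div_le_iff₀ (by positivity)]
      linarith
    · have h3 : 2 * e ^ n ≤ (2 * e) ^ n := by
        rw [mul_pow]
        gcongr
        exact le_self_pow₀ (by norm_num) hn
      have := lt_of_pow_lt_pow_left₀ n (by positivity) (b1.trans_lt (h2.trans_le h3))
      rw [le_div_iff₀ hd]
      calc |u| * d = l * (d / l * |u|) := by field_simp
        _ ≤ l * (2 * e) := by gcongr
        _ = _ := by ring
  have hleL : ∀ ε, 0 < ε → ε / (l * d) ≤ 2 * l * ε / d := by
    intro ε hε
    rw [div_le_div_iff₀ (by positivity) hd]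
    have : 1 ≤ 2 * l * l := by nlinarith
    nlinarith [mul_pos hε hd]
  have iS : ∀ ε, 0 < ε → ∀ x, IntegrableOn (oscKer x) (band g ε ∩ D) := by
    intro ε hε x
    obtain ⟨e, he, rfl⟩ := root ε hε
    exact integrableOn_oscKer x (by positivity) (hS2 e he)
  have absint : ∀ S : Set ℝ, IntegrableOn (oscKer 0) (S ∩ D) → IntegrableOn (farKer R) S := by
    intro S h
    have e : IntegrableOn (D.indicator (oscKer 0)) S := by
      rw [integrableOn_indicator_iff mD, inter_comm]; exact h
    rw [← hker] at e
    refine Integrable.mono e (measurable_farKer R).aestronglyMeasurable (ae_of_all _ fun u => ?_)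
    simp [norm_cexpI]
  refine ⟨fun ε hε => absint _ (iS ε hε 0), fun ε hε x => ?_, fun x => ?_,
    fun ε hε => ?_, fun ε hε => ?_⟩
  · obtain ⟨e, he, rfl⟩ := root ε hε
    rw [hker, setIntegral_indicator mD]
    exact norm_setIntegral_oscKer_le_of_shell x (lt_max_of_lt_left hR)
      (by positivity) hl (mS _) (hS1 e he) (hS2 e he)
  · simp only [hker, setIntegral_indicator mD]
    set ρ : ℝ → ℝ := fun ε => 1 / (ε ^ (1 / n : ℝ) * d) with hρ
    have hρlim : Tendsto ρ (𝓝[>] 0) atTop := by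
      have hn' : (0 : ℝ) < 1 / n := by positivity
      have h1 : Tendsto (fun ε : ℝ => ε ^ (1 / n : ℝ) * d) (𝓝[>] 0) (𝓝[>] 0) := by
        rw [tendsto_nhdsWithin_iff]
        constructor
        · have : Tendsto (fun ε : ℝ => ε ^ (1 / n : ℝ) * d) (𝓝 0) (𝓝 ((0 : ℝ) ^ (1 / n : ℝ) * d)) :=
            ((Real.continuousAt_rpow_const _ _ (Or.inr hn'.le)).mul_const d)
          rw [Real.zero_rpow hn'.ne', zero_mul] at this
          exact this.mono_left nhdsWithin_le_nhds
        · filter_upwards [self_mem_nhdsWithin] with ε hε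
          have hε : 0 < ε := hε
          exact mem_Ioi.2 (by positivity)
      simpa [hρ, Function.comp_def] using tendsto_inv_nhdsGT_zero.comp h1
    have hT : Tendsto (fun ε => ∫ u in shell R (ρ ε), oscKer x u) (𝓝[>] 0)
        (𝓝 (2 * Complex.I * ((SiTop * SignType.sign x - Si (x * R) : ℝ) : ℂ))) := by
      have h1 : Tendsto (fun b : ℝ => 2 * Complex.I * ((Si (x * b) - Si (x * R) : ℝ) : ℂ)) atTop
          (𝓝 (2 * Complex.I * ((SiTop * SignType.sign x - Si (x * R) : ℝ) : ℂ))) :=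
        ((Complex.continuous_ofReal.tendsto _).comp
          ((tendsto_Si_mul x).sub_const _)).const_mul _
      refine (h1.comp hρlim).congr' ?_
      filter_upwards [hρlim.eventually_ge_atTop R] with ε hε
      rw [setIntegral_oscKer_shell x hR hε]
      rfl
    have hpos : ∀ᶠ ε : ℝ in 𝓝[>] 0, 0 < ε := self_mem_nhdsWithin
    have hsub := tendsto_setIntegral_oscKer_sub x (F := 𝓝[>] (0 : ℝ))
      (S := fun ε => band g ε ∩ D) (T := fun ε => shell R (ρ ε)) (r := ρ)
      (hρlim.eventually_gt_atTop 0) (Eventually.of_forall mS)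
      (Eventually.of_forall fun ε => measurableSet_shell _ _) (hpos.mono fun ε hε => iS ε hε x)
      (hpos.mono fun ε hε => integrableOn_oscKer x hR (b := ρ ε)
        fun u hu => ⟨hu.1.le, hu.2.le⟩) ?_
    · have := hsub.add hT
      simp only [sub_add_cancel] at this
      exact ⟨_, this⟩
    intro r hr
    have hr0 : 0 < r := by linarith
    obtain ⟨η, hη⟩ := hlim r hr
    have hsmall : 0 < (d / l * R) ^ n := by positivity
    filter_upwards [Ioo_mem_nhdsGT hsmall, hρlim.eventually_gt_atTop (l * η),
      hρlim.eventually_gt_atTop η] with ε hε hρ1 hρ2 u hu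
    obtain ⟨hε0, hε1⟩ := hε
    set e := ε ^ (1 / n : ℝ) with he
    have he0 : 0 < e := by positivity
    have hen : e ^ n = ε := by
      rw [he, ← Real.rpow_natCast, ← Real.rpow_mul hε0.le]; field_simp; simp
    have hρe : ρ ε = 1 / (e * d) := rfl
    have hρ0 : 0 < ρ ε := by rw [hρe]; positivity
    rcases hu with ⟨⟨⟨g1, g2⟩, uD⟩, hu⟩ | ⟨⟨u1, u2⟩, hu⟩
    · have uD : R < |u| := uD
      have hle : ρ ε ≤ |u| := by
        by_contra hc
        exact hu ⟨uD, not_le.1 hc⟩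
      obtain ⟨b1, b2⟩ := hη u (by linarith)
      constructor
      · rw [div_le_iff₀ hr0]; nlinarith
      · rw [← hen, ← one_div_pow] at g2
        have := lt_of_pow_lt_pow_left₀ n (by positivity) (b1.trans_lt g2)
        calc |u| = (r / d) * (d / r * |u|) := by field_simp
          _ ≤ (r / d) * (1 / e) := by gcongr
          _ = _ := by rw [hρe]; field_simp
    · have hg' : 1 / ε ≤ |g u| := by
        by_contra hc
        refine hu ⟨⟨?_, not_le.1 hc⟩, u1⟩
        refine hε1.trans_le (le_trans ?_ (hb u u1).1)
        gcongr
      rw [← hen, ← one_div_pow] at hg'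
      have h4 : η < |u| := by
        have := le_of_pow_le_pow_left₀ hn (by positivity) (hg'.trans (hb u u1).2)
        have h5 : ρ ε ≤ l * |u| := by
          calc ρ ε = (1 / e) / d := by rw [hρe]; field_simp
            _ ≤ (l * d * |u|) / d := by gcongr
            _ = _ := by field_simp
        nlinarith
      obtain ⟨b1, b2⟩ := hη u h4
      constructor
      · rw [div_le_iff₀ hr0]
        have := le_of_pow_le_pow_left₀ hn (by positivity) (hg'.trans b2)
        calc ρ ε = (1 / e) / d := by rw [hρe]; field_simp
          _ ≤ (r * d * |u|) / d := by gcongr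
          _ = _ := by field_simp
      · nlinarith
  · obtain ⟨e, he, rfl⟩ := root ε hε
    exact absint _ (integrableOn_oscKer 0 (by positivity) (hL e he))
  · obtain ⟨e, he, rfl⟩ := root ε hε
    rw [hker', setIntegral_indicator mD]
    refine (setIntegral_inv_abs_le (by positivity) (hleL e he) (hL e he)).trans ?_
    rw [show 2 * l * e / d / (e / (l * d)) = 2 * l ^ 2 by field_simp]
    exact two_mul_log_le hl

/-- The mass of the Cauchy density does not depend on its scale. -/
theorem integrable_cauchy {M : ℝ} (hM : 0 < M) : Integrable (fun ξ : ℝ => M / (M ^ 2 + ξ ^ 2)) ∧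
    ∫ ξ : ℝ, M / (M ^ 2 + ξ ^ 2) = Real.pi := by
  have e : (fun ξ : ℝ => M / (M ^ 2 + ξ ^ 2)) = fun ξ => M⁻¹ * (1 + (M⁻¹ * ξ) ^ 2)⁻¹ := by
    ext ξ
    field_simp
  rw [e]
  constructor
  · exact (integrable_inv_one_add_sq.comp_mul_left' (inv_ne_zero hM.ne')).const_mul _
  · rw [integral_const_mul, Measure.integral_comp_mul_left (fun x : ℝ => (1 + x ^ 2)⁻¹),
      integral_univ_inv_one_add_sq]
    rw [inv_inv, abs_of_pos hM, smul_eq_mul]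
    field_simp

/-- The quotient `w / g` is, up to an error bounded by `Λ` times a Cauchy density, a combination of
simple poles at two roots of `g` (truncated to distances comparable with the scale `M`) and of
`1 / ξ` at infinity. -/
def PVData (Λ : ℝ) (g w : ℝ → ℝ) : Prop :=
  ∃ M > 0, ∃ ξ₀ ξ₁ c₀ c₁ c₂ : ℝ, |c₀| ≤ Λ ∧ |c₁| ≤ Λ ∧ |c₂| ≤ Λ ∧
    (c₀ = 0 ∨ NearRoot Λ (M / 2) g ξ₀) ∧ (c₁ = 0 ∨ NearRoot Λ (M / 2) g ξ₁) ∧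
    FarPower Λ (2 * M) g ∧
    ∀ ξ, g ξ ≠ 0 → |w ξ / g ξ - (c₀ * nearKer (M / 2) ξ₀ ξ + c₁ * nearKer (M / 2) ξ₁ ξ +
      c₂ * farKer (2 * M) ξ)| ≤ Λ * (M / (M ^ 2 + ξ ^ 2))

/-- The bound of the principal value integrals in terms of the constant of `PVData`. -/
def pvConst (Λ : ℝ) : ℝ := 3 * (Λ * (16 + 8 * Real.log Λ)) + Λ * Real.pi

/-- The poles and `1 / ξ` have bounded principal values, and the error is bounded in `L¹`. -/
theorem pvBounded_of_data {Λ : ℝ} (hΛ : 1 ≤ Λ) {g w : ℝ → ℝ} (hg : Measurable g)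
    (hw : Measurable w) (h : PVData Λ g w) : PVBounded (pvConst Λ) g (fun ξ => w ξ / g ξ) := by
  obtain ⟨M, hM, ξ₀, ξ₁, c₀, c₁, c₂, hc₀, hc₁, hc₂, h₀, h₁, h₂, hk⟩ := h
  have hlog := Real.log_nonneg hΛ
  have hB : 0 ≤ 16 + 8 * Real.log Λ := by positivity
  have near : ∀ c ξ', |c| ≤ Λ → (c = 0 ∨ NearRoot Λ (M / 2) g ξ') →
      PVBounded (Λ * (16 + 8 * Real.log Λ)) g (fun ξ => c * nearKer (M / 2) ξ' ξ) := by
    rintro c ξ' hc (rfl | h)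
    · simp only [zero_mul]
      exact PVBounded.zero (by positivity)
    · exact ((pvBounded_near hg hΛ (by positivity) h).const_mul c).mono (by gcongr)
  have far : PVBounded (Λ * (16 + 8 * Real.log Λ)) g (fun ξ => c₂ * farKer (2 * M) ξ) :=
    ((pvBounded_far hg hΛ (by positivity) h₂).const_mul c₂).mono (by gcongr)
  set k : ℝ → ℝ := {ξ | g ξ ≠ 0}.indicator fun ξ => w ξ / g ξ -
    (c₀ * nearKer (M / 2) ξ₀ ξ + c₁ * nearKer (M / 2) ξ₁ ξ + c₂ * farKer (2 * M) ξ) with hkdef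
  have hkm : Measurable k := by
    apply Measurable.indicator
    · exact (hw.div hg).sub ((((measurable_nearKer _ _).const_mul _).add
        ((measurable_nearKer _ _).const_mul _)).add ((measurable_farKer _).const_mul _))
    · exact (measurableSet_eq_fun hg measurable_const).compl
  have hkb : ∀ ξ, |k ξ| ≤ Λ * (M / (M ^ 2 + ξ ^ 2)) := by
    intro ξ
    by_cases h0 : g ξ = 0
    · rw [hkdef, indicator_of_notMem (by simp [h0])]
      simp only [abs_zero]
      positivity
    · rw [hkdef, indicator_of_mem (by exact h0)]
      exact hk ξ h0
  obtain ⟨ic, vc⟩ := integrable_cauchy hM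
  have ik : Integrable k := (ic.const_mul Λ).mono' hkm.aestronglyMeasurable (ae_of_all _ hkb)
  have rest : PVBounded (Λ * Real.pi) g k := by
    apply PVBounded.of_integrable hg ik
    rw [← vc, ← integral_const_mul]
    exact integral_mono ik.abs (ic.const_mul Λ) hkb
  refine ((((near c₀ ξ₀ hc₀ h₀).add (near c₁ ξ₁ hc₁ h₁)).add far).add rest).congr hg
    (k' := fun ξ => w ξ / g ξ) (fun ξ hξ => ?_) |>.mono ?_
  · rw [hkdef, indicator_of_mem (by exact hξ)]
    ring
  · rw [pvConst]
    linarith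

/-! ### The cut-offs -/

namespace IsCutoff

theorem eq_zero {ψ : ℝ → ℝ} (hψ : IsCutoff ψ) {s : ℝ} (hs : 200 ≤ |s|) : ψ s = 0 := by
  by_contra h
  have h1 := hψ.supp (subset_tsupport ψ h)
  rw [mem_ball_zero_iff, Real.norm_eq_abs] at h1
  linarith

theorem eq_one' {ψ : ℝ → ℝ} (hψ : IsCutoff ψ) {s : ℝ} (hs : |s| ≤ 100) : ψ s = 1 := by
  have h1 : EqOn ψ (fun _ => 1) (closure (Metric.ball (0 : ℝ) 100)) :=
    EqOn.closure (fun s hs => hψ.eq_one s hs) hψ.smooth.continuous continuous_const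
  apply h1
  rw [closure_ball _ (by norm_num)]
  simpa using hs

theorem hasCompactSupport {ψ : ℝ → ℝ} (hψ : IsCutoff ψ) : HasCompactSupport ψ :=
  HasCompactSupport.of_support_subset_isCompact (isCompact_closedBall (0 : ℝ) 200)
    ((subset_tsupport ψ).trans (hψ.supp.trans Metric.ball_subset_closedBall))

/-- A scale invariant form of the Lipschitz continuity of the cut-off. -/
theorem exists_abs_sub_le {ψ : ℝ → ℝ} (hψ : IsCutoff ψ) :
    ∃ L : ℝ, 1 ≤ L ∧ ∀ a b : ℝ, a ≠ 0 → |ψ a - ψ b| ≤ L * (|a - b| / |a|) := by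
  obtain ⟨K, hK⟩ := ContDiff.lipschitzWith_of_hasCompactSupport hψ.hasCompactSupport
    (hψ.smooth.of_le (by simp)) one_ne_zero
  refine ⟨400 * K + 2, by linarith [K.2], fun a b ha => ?_⟩
  have ha' := abs_pos.2 ha
  have hK0 : (0 : ℝ) ≤ K := K.2
  rw [mul_div_assoc', le_div_iff₀ ha']
  have h1 : |ψ a - ψ b| ≤ 1 := by
    rw [abs_le]
    constructor <;> linarith [hψ.nonneg a, hψ.nonneg b, hψ.le_one a, hψ.le_one b]
  have h2 : |ψ a - ψ b| ≤ K * |a - b| := by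
    simpa [Real.dist_eq] using hK.dist_le_mul a b
  have h3 := abs_nonneg (a - b)
  -- for `|a| > 400` either both values vanish or `|a - b| ≥ |a| / 2`
  rcases le_or_gt |a| 400 with h | h
  · nlinarith [mul_nonneg hK0 h3, abs_nonneg (ψ a - ψ b)]
  · rcases le_or_gt 200 |b| with hb | hb
    · rw [hψ.eq_zero (by linarith : 200 ≤ |a|), hψ.eq_zero hb]
      simp only [sub_self, abs_zero, zero_mul]
      positivity
    · have := abs_sub_abs_le_abs_sub a b
      nlinarith [mul_nonneg hK0 h3]

end IsCutoff

theorem measurable_cutQuot {ψ : ℝ → ℝ} (hψ : IsCutoff ψ) :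
    Measurable (fun p : ℝ × ℝ => cutQuot ψ p.1 p.2) := by
  have := hψ.smooth.continuous.measurable
  exact Measurable.ite (measurable_snd (measurableSet_singleton 0)) measurable_const
    (this.comp (measurable_fst.div measurable_snd))

theorem measurable_chi1 {ψ : ℝ → ℝ} (hψ : IsCutoff ψ) :
    Measurable (fun p : ℝ × ℝ => chi1 ψ p.1 p.2) :=
  ((measurable_cutQuot hψ).const_sub 1).mul
    ((hψ.smooth.continuous.measurable.comp measurable_fst).const_sub 1)

theorem measurable_chi2 {ψ : ℝ → ℝ} (hψ : IsCutoff ψ) :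
    Measurable (fun p : ℝ × ℝ => chi2 ψ p.1 p.2) :=
  (measurable_cutQuot hψ).mul
    ((hψ.smooth.continuous.measurable.comp measurable_fst).const_sub 1)

theorem cutQuot_mem {ψ : ℝ → ℝ} (hψ : IsCutoff ψ) (ξ μ : ℝ) :
    0 ≤ cutQuot ψ ξ μ ∧ cutQuot ψ ξ μ ≤ 1 := by
  unfold cutQuot
  split_ifs
  · simp
  · exact ⟨hψ.nonneg _, hψ.le_one _⟩

theorem chi1_mem {ψ : ℝ → ℝ} (hψ : IsCutoff ψ) (ξ μ : ℝ) : 0 ≤ chi1 ψ ξ μ ∧ chi1 ψ ξ μ ≤ 1 := by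
  have h1 := cutQuot_mem hψ ξ μ
  have h2 := hψ.nonneg ξ
  have h3 := hψ.le_one ξ
  unfold chi1
  constructor
  · exact mul_nonneg (by linarith [h1.2]) (by linarith)
  · exact mul_le_one₀ (by linarith [h1.1]) (by linarith) (by linarith)

theorem chi2_mem {ψ : ℝ → ℝ} (hψ : IsCutoff ψ) (ξ μ : ℝ) : 0 ≤ chi2 ψ ξ μ ∧ chi2 ψ ξ μ ≤ 1 := by
  have h1 := cutQuot_mem hψ ξ μ
  have h2 := hψ.nonneg ξ
  have h3 := hψ.le_one ξ
  unfold chi2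
  constructor
  · exact mul_nonneg h1.1 (by linarith)
  · exact mul_le_one₀ h1.2 (by linarith) (by linarith)

theorem chi1_eq_zero {ψ : ℝ → ℝ} (hψ : IsCutoff ψ) {ξ μ : ℝ} (h : |ξ| ≤ 100 * max 1 |μ|) :
    chi1 ψ ξ μ = 0 := by
  unfold chi1
  rcases le_total |μ| 1 with h1 | h1
  · rw [max_eq_left h1] at h
    rw [hψ.eq_one' (by linarith : |ξ| ≤ 100)]
    simp
  · rw [max_eq_right h1] at h
    have h0 : μ ≠ 0 := abs_pos.1 (by linarith)
    rw [cutQuot, if_neg h0, hψ.eq_one']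
    · simp
    · rw [abs_div, div_le_iff₀ (by linarith)]
      exact h

theorem chi1_eq_one {ψ : ℝ → ℝ} (hψ : IsCutoff ψ) {ξ μ : ℝ} (h : 200 * max 1 |μ| ≤ |ξ|) :
    chi1 ψ ξ μ = 1 := by
  unfold chi1 cutQuot
  have h1 := le_max_left 1 |μ|
  have h2 := le_max_right 1 |μ|
  rw [hψ.eq_zero (by linarith : 200 ≤ |ξ|)]
  split_ifs with h0
  · simp
  · rw [hψ.eq_zero]
    · simp
    · rw [abs_div, le_div_iff₀ (abs_pos.2 h0)]
      linarith

theorem abs_mul_sub_mul_le {a b c d : ℝ} (ha : |a| ≤ 1) (hd : |d| ≤ 1) :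
    |a * b - c * d| ≤ |b - d| + |a - c| := by
  rw [show a * b - c * d = a * (b - d) + (a - c) * d by ring]
  refine (abs_add_le _ _).trans ?_
  rw [abs_mul, abs_mul]
  nlinarith [abs_nonneg (b - d), abs_nonneg (a - c)]

theorem abs_chi1_sub_le {ψ : ℝ → ℝ} (hψ : IsCutoff ψ) {L : ℝ} (hL1 : 1 ≤ L)
    (hL : ∀ a b : ℝ, a ≠ 0 → |ψ a - ψ b| ≤ L * (|a - b| / |a|)) (μ ξ : ℝ) {η : ℝ} (hη : η ≠ 0) :
    |chi1 ψ ξ μ - chi1 ψ η μ| ≤ 2 * L * (|ξ - η| / |η|) := by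
  unfold chi1
  have h1 := cutQuot_mem hψ ξ μ
  refine (abs_mul_sub_mul_le ?_ ?_).trans ?_
  · rw [abs_le]; constructor <;> linarith
  · rw [abs_le]; constructor <;> linarith [hψ.nonneg η, hψ.le_one η]
  · have e1 : |1 - ψ ξ - (1 - ψ η)| ≤ L * (|ξ - η| / |η|) := by
      have := hL η ξ hη
      rwa [abs_sub_comm η ξ, show ψ η - ψ ξ = 1 - ψ ξ - (1 - ψ η) by ring] at this
    have e2 : |1 - cutQuot ψ ξ μ - (1 - cutQuot ψ η μ)| ≤ L * (|ξ - η| / |η|) := by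
      unfold cutQuot
      split_ifs with h0
      · simp only [sub_zero, sub_self, abs_zero]
        positivity
      · have := hL (η / μ) (ξ / μ) (div_ne_zero hη h0)
        rw [← sub_div, abs_div, abs_div, div_div_div_cancel_right₀ (abs_ne_zero.2 h0),
          abs_sub_comm η ξ] at this
        rwa [show 1 - ψ (ξ / μ) - (1 - ψ (η / μ)) = ψ (η / μ) - ψ (ξ / μ) by ring]
    linarith

theorem chi2_eq_zero {ψ : ℝ → ℝ} (hψ : IsCutoff ψ) {ξ μ : ℝ} (h : 200 * |μ| ≤ |ξ|) :
    chi2 ψ ξ μ = 0 := by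
  unfold chi2 cutQuot
  split_ifs with h0
  · simp
  · rw [hψ.eq_zero, zero_mul]
    rw [abs_div, le_div_iff₀ (abs_pos.2 h0)]
    exact h

theorem chi2_eq {ψ : ℝ → ℝ} (hψ : IsCutoff ψ) {ξ μ : ℝ} (h : |ξ| ≤ 100 * |μ|) (hμ : μ ≠ 0) :
    chi2 ψ ξ μ = 1 - ψ ξ := by
  unfold chi2 cutQuot
  rw [if_neg hμ, hψ.eq_one', one_mul]
  rw [abs_div, div_le_iff₀ (abs_pos.2 hμ)]
  exact h

theorem abs_chi2_sub_le {ψ : ℝ → ℝ} (hψ : IsCutoff ψ) {L : ℝ} (hL1 : 1 ≤ L)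
    (hL : ∀ a b : ℝ, a ≠ 0 → |ψ a - ψ b| ≤ L * (|a - b| / |a|)) (ξ μ : ℝ) {η : ℝ} (hη : η ≠ 0) :
    |chi2 ψ ξ μ - chi2 ψ ξ η| ≤ L * (|μ - η| / |η|) := by
  have hη' := abs_pos.2 hη
  rcases eq_or_ne μ 0 with rfl | hμ
  · have h1 : chi2 ψ ξ 0 = 0 := by simp [chi2, cutQuot]
    have h2 := chi2_mem hψ ξ η
    rw [h1, zero_sub, abs_neg, zero_sub, abs_neg, div_self hη'.ne', abs_of_nonneg h2.1]
    linarith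
  rcases eq_or_ne ξ 0 with rfl | hξ
  · have : ψ 0 = 1 := hψ.eq_one' (by simp)
    simp only [chi2, this, sub_self, mul_zero, abs_zero]
    positivity
  · unfold chi2 cutQuot
    rw [if_neg hμ, if_neg hη, ← sub_mul, abs_mul]
    have h1 : |1 - ψ ξ| ≤ 1 := by
      rw [abs_le]; constructor <;> linarith [hψ.nonneg ξ, hψ.le_one ξ]
    have h2 := hL (ξ / μ) (ξ / η) (div_ne_zero hξ hμ)
    have h3 : |ξ / μ - ξ / η| / |ξ / μ| = |μ - η| / |η| := by
      rw [← abs_div, ← abs_div, ← abs_neg]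
      congr 1
      field_simp
      ring
    rw [h3] at h2
    nlinarith [abs_nonneg (ψ (ξ / μ) - ψ (ξ / η))]

/-! ### General criteria for roots and growth -/

/-- A root is simple if `g` is `ξ - ξ₀` times a continuous factor that does not vanish. -/
theorem NearRoot.of_factor {l δ : ℝ} {g h : ℝ → ℝ} {ξ₀ d : ℝ} (hd : 0 < d)
    (hg : ∀ u, |g (ξ₀ + u)| = |u| * h u) (hb : ∀ u, |u| < δ → d / l ≤ h u ∧ h u ≤ l * d)
    (hc : ContinuousAt h 0) (h0 : 0 < h 0) : NearRoot l δ g ξ₀ := by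
  refine ⟨⟨d, hd, fun u hu => ?_⟩, h 0, h0, fun r hr => ?_⟩
  · obtain ⟨h1, h2⟩ := hb u hu
    rw [hg]
    constructor <;> nlinarith [abs_nonneg u]
  · have h1 : h 0 / r < h 0 := div_lt_self h0 hr
    have h2 : h 0 < r * h 0 := by nlinarith
    obtain ⟨η, hη, hη'⟩ := Metric.eventually_nhds_iff.1
      (hc.eventually (Ioo_mem_nhds h1 h2))
    refine ⟨η, hη, fun u hu => ?_⟩
    obtain ⟨h3, h4⟩ := hη' (y := u) (by simpa using hu)
    rw [hg]
    constructor <;> nlinarith [abs_nonneg u]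

/-- Growth of `g` from its leading term `a u^{m+1}`, for example if `g` is a polynomial. -/
theorem FarPower.of_leading {l R : ℝ} {g : ℝ → ℝ} {a K : ℝ} (m : ℕ) (ha : a ≠ 0) (hl : 0 < l)
    (hb : ∀ u, R < |u| → |a| * |u| ^ (m + 1) ≤ l ^ (m + 1) * |g u| ∧
      |g u| ≤ l ^ (m + 1) * |a| * |u| ^ (m + 1))
    (hg : ∀ u, 1 ≤ |u| → |g u - a * u ^ (m + 1)| ≤ K * |u| ^ m) : FarPower l R g := by
  have ha' := abs_pos.2 ha
  obtain ⟨d, hd, hda⟩ : ∃ d : ℝ, 0 < d ∧ d ^ (m + 1) = |a| :=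
    ⟨|a| ^ (1 / (m + 1 : ℕ) : ℝ), by positivity, by
      rw [← Real.rpow_natCast, ← Real.rpow_mul ha'.le]; field_simp; simp⟩
  refine ⟨d, hd, m + 1, by simp, fun u hu => ?_, fun r hr => ?_⟩
  · obtain ⟨h1, h2⟩ := hb u hu
    rw [mul_pow, mul_pow, mul_pow, div_pow, hda]
    refine ⟨?_, h2⟩
    rw [div_mul_eq_mul_div, div_le_iff₀ (by positivity)]
    linarith
  · have hr0 : 0 < r := by linarith
    set q := r ^ (m + 1) with hq
    have hq1 : 1 < q := one_lt_pow₀ hr (by simp)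
    have hq0 : 0 < q := by linarith
    refine ⟨max 1 (q * K / (|a| * (q - 1))), fun u hu => ?_⟩
    have hu1 : 1 < |u| := (le_max_left _ _).trans_lt hu
    have hu2 : q * K / (|a| * (q - 1)) < |u| := (le_max_right _ _).trans_lt hu
    have hqa : 0 < |a| * (q - 1) := mul_pos ha' (by linarith)
    rw [div_lt_iff₀ hqa] at hu2
    have h1 := hg u hu1.le
    have hum : 0 < |u| ^ m := by positivity
    have h2 : |a * u ^ (m + 1)| = |a| * (|u| ^ m * |u|) := by
      rw [abs_mul, abs_pow, pow_succ]
    have h3 := abs_sub_abs_le_abs_sub (g u) (a * u ^ (m + 1))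
    have h4 := abs_sub_abs_le_abs_sub (a * u ^ (m + 1)) (g u)
    rw [abs_sub_comm (a * u ^ (m + 1))] at h4
    rw [h2] at h3 h4
    have h5 : q * (K * |u| ^ m) ≤ |u| * (|a| * (q - 1)) * |u| ^ m := by
      nlinarith
    rw [mul_pow, mul_pow, mul_pow, div_pow, hda, pow_succ |u|, ← hq]
    constructor
    · rw [div_mul_eq_mul_div, div_le_iff₀ hq0]
      nlinarith
    · have h6 : K * |u| ^ m ≤ |u| * (|a| * (q - 1)) * |u| ^ m := by
        rcases le_or_gt K 0 with hK | hK
        · have : 0 ≤ |u| * (|a| * (q - 1)) * |u| ^ m := by positivity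
          nlinarith
        · nlinarith [mul_pos hK hum]
      nlinarith

/-! ### The quotient in the first region -/

/-- The divided difference of `Φ(·, μ)`. -/
def divDiff (μ η ξ : ℝ) : ℝ :=
  (ξ ^ 2 + ξ * η + η ^ 2) / 16 - 3 / 8 * μ ^ 2 - (ξ + η) / 8 + 1 / 2

theorem Phi_sub_Phi (μ ξ η : ℝ) : Phi ξ μ - Phi η μ = (ξ - η) * divDiff μ η ξ := by
  unfold Phi divDiff
  ring

/-- The divided difference is positive and comparable to `ξ² + η²`: since `|η|` is large and
`|μ| ≤ |η| / 100`, the quadratic form `(ξ² + ξη + η²) / 16` dominates the other terms. -/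
theorem divDiff_bounds {μ η : ℝ} (h1 : 100 ≤ |η|) (h2 : 100 * |μ| ≤ |η|) (ξ : ℝ) :
    (ξ ^ 2 + η ^ 2) / 40 ≤ divDiff μ η ξ ∧ divDiff μ η ξ ≤ (ξ ^ 2 + η ^ 2) / 10 := by
  have a1 : |η| ≤ η ^ 2 / 100 := by rw [← sq_abs]; nlinarith
  have a2 := abs_le.1 a1
  have a3 : μ ^ 2 ≤ η ^ 2 / 10000 := by
    rw [← sq_abs μ, ← sq_abs η]; nlinarith [abs_nonneg μ, abs_nonneg η]
  have a4 : (10000 : ℝ) ≤ η ^ 2 := by rw [← sq_abs]; nlinarith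
  have a5 := sq_nonneg (ξ / 10 - 5)
  have a6 := sq_nonneg (ξ / 10 + 5)
  have a7 := sq_nonneg (ξ + η)
  have a8 := sq_nonneg (ξ - η)
  have a9 := sq_nonneg μ
  unfold divDiff
  constructor <;> nlinarith

/-- Beyond `p` the function `Φ(·, μ) - Φ(p, μ)` is at least `ξ - p`, so `Φ(·, μ)` attains `τ`. -/
theorem exists_root_ge {μ p τ : ℝ} (h1 : 100 ≤ p) (h2 : 100 * |μ| ≤ p) (hτ : Phi p μ ≤ τ) :
    ∃ ξ, p ≤ ξ ∧ Phi ξ μ = τ := by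
  have hp : |p| = p := abs_of_pos (by linarith)
  have hT : 0 ≤ τ - Phi p μ := by linarith
  have hu : τ ≤ Phi (p + (τ - Phi p μ)) μ := by
    have e := Phi_sub_Phi μ (p + (τ - Phi p μ)) p
    have b := (divDiff_bounds (μ := μ) (η := p) (by rwa [hp]) (by rwa [hp])
      (p + (τ - Phi p μ))).1
    have : 1 ≤ divDiff μ p (p + (τ - Phi p μ)) := by
      nlinarith [sq_nonneg (p + (τ - Phi p μ))]
    nlinarith
  have hc : ContinuousOn (fun ξ => Phi ξ μ) (Icc p (p + (τ - Phi p μ))) := by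
    unfold Phi
    fun_prop
  obtain ⟨ξ, hξ, e⟩ := intermediate_value_Icc (by linarith) hc ⟨hτ, hu⟩
  exact ⟨ξ, hξ.1, e⟩

theorem exists_root_le {μ p τ : ℝ} (h1 : 100 ≤ p) (h2 : 100 * |μ| ≤ p) (hτ : τ ≤ Phi (-p) μ) :
    ∃ ξ, ξ ≤ -p ∧ Phi ξ μ = τ := by
  have hp : |(-p)| = p := by rw [abs_neg]; exact abs_of_pos (by linarith)
  have hT : 0 ≤ Phi (-p) μ - τ := by linarith
  set T := Phi (-p) μ - τ with hTdef
  have hu : Phi (-p - T) μ ≤ τ := by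
    have e := Phi_sub_Phi μ (-p - T) (-p)
    have b := (divDiff_bounds (μ := μ) (η := -p) (by rwa [hp]) (by rwa [hp]) (-p - T)).1
    have : 1 ≤ divDiff μ (-p) (-p - T) := by
      nlinarith [sq_nonneg (-p - T)]
    nlinarith
  have hc : ContinuousOn (fun ξ => Phi ξ μ) (Icc (-p - T) (-p)) := by
    unfold Phi
    fun_prop
  obtain ⟨ξ, hξ, e⟩ := intermediate_value_Icc (by linarith) hc ⟨hu, hτ⟩
  exact ⟨ξ, hξ.2, e⟩

/-- Size of `τ - Φ(ξ, μ)` for `ξ` far beyond points where `Φ(·, μ)` lies below and above `τ`. -/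
theorem abs_sub_Phi_bounds {μ τ M η₁ η₂ : ℝ} (h1 : 100 ≤ M) (h2 : 100 * |μ| ≤ M)
    (e1 : |η₁| = M) (e2 : |η₂| = M) (t1 : Phi η₁ μ ≤ τ) (t2 : τ ≤ Phi η₂ μ) {ξ : ℝ}
    (hξ : 2 * M < |ξ|) :
    |ξ| ^ 3 / 80 ≤ |τ - Phi ξ μ| ∧ |τ - Phi ξ μ| ≤ 3 / 16 * |ξ| ^ 3 := by
  have d1 := Phi_sub_Phi μ ξ η₁
  have d2 := Phi_sub_Phi μ ξ η₂
  have b1 := divDiff_bounds (μ := μ) (η := η₁) (by rwa [e1]) (by rwa [e1]) ξ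
  have b2 := divDiff_bounds (μ := μ) (η := η₂) (by rwa [e2]) (by rwa [e2]) ξ
  have s1 : η₁ ^ 2 = M ^ 2 := by rw [← sq_abs, e1]
  have s2 : η₂ ^ 2 = M ^ 2 := by rw [← sq_abs, e2]
  rw [s1] at b1
  rw [s2] at b2
  have a1 := abs_le.1 e1.le
  have a2 := abs_le.1 e2.le
  have main : ∀ x D : ℝ, 2 * M < x → (x ^ 2 + M ^ 2) / 40 ≤ D → D ≤ (x ^ 2 + M ^ 2) / 10 →
      ∀ y, x - M ≤ y → y ≤ x + M → x ^ 3 / 80 ≤ y * D ∧ y * D ≤ 3 / 16 * x ^ 3 := by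
    intro x D hx hD1 hD2 y hy1 hy2
    have hx0 : 0 < x := by linarith
    have hM2 : M ^ 2 ≤ x ^ 2 / 4 := by nlinarith
    have hD3 : x ^ 2 / 40 ≤ D := by nlinarith [sq_nonneg M]
    have hD4 : D ≤ x ^ 2 / 8 := by nlinarith
    have hD0 : 0 ≤ D := by nlinarith [sq_nonneg x]
    constructor
    · calc x ^ 3 / 80 = x / 2 * (x ^ 2 / 40) := by ring
        _ ≤ y * D := by gcongr <;> linarith
    · calc y * D ≤ 3 / 2 * x * (x ^ 2 / 8) := by gcongr; linarith
        _ = _ := by ring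
  rcases lt_abs.1 hξ with h | h
  · have m1 := main ξ _ h b1.1 b1.2 (ξ - η₁) (by linarith) (by linarith)
    have m2 := main ξ _ h b2.1 b2.2 (ξ - η₂) (by linarith) (by linarith)
    have hx3 : 0 < ξ ^ 3 := by have : 0 < ξ := by linarith
                               positivity
    rw [abs_of_pos (by linarith : 0 < ξ), abs_of_nonpos (by nlinarith)]
    constructor <;> linarith
  · have m1 := main (-ξ) _ h (by simpa using b1.1) (by simpa using b1.2) (-(ξ - η₁))
      (by linarith) (by linarith)
    have m2 := main (-ξ) _ h (by simpa using b2.1) (by simpa using b2.2) (-(ξ - η₂))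
      (by linarith) (by linarith)
    have hx3 : 0 < (-ξ) ^ 3 := by have : 0 < -ξ := by linarith
                                  positivity
    rw [abs_of_neg (by linarith : ξ < 0), abs_of_nonneg (by nlinarith)]
    constructor <;> linarith

/-- If `τ` lies between values of `Φ(·, μ)` at points of size `M`, it is at most of size `M³`. -/
theorem abs_le_of_Phi_between {μ τ M η₁ η₂ : ℝ} (h1 : 100 ≤ M) (h2 : 100 * |μ| ≤ M)
    (e1 : |η₁| = M) (e2 : |η₂| = M) (t1 : Phi η₁ μ ≤ τ) (t2 : τ ≤ Phi η₂ μ) :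
    |τ| ≤ M ^ 3 / 10 := by
  have key : ∀ η : ℝ, |η| = M → |Phi η μ| ≤ M ^ 3 / 10 := by
    intro η e
    have m2 : μ ^ 2 ≤ M ^ 2 / 10000 := by
      rw [← sq_abs μ]; nlinarith [abs_nonneg μ]
    have m0 := sq_nonneg μ
    have M2 : 100 * M ≤ M ^ 2 := by nlinarith
    have M3 : 100 * M ^ 2 ≤ M ^ 3 := by nlinarith [sq_nonneg M]
    have hmu : M * μ ^ 2 ≤ M ^ 3 / 10000 := by nlinarith
    have hmu0 : 0 ≤ M * μ ^ 2 := by positivity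
    rw [abs_le]
    unfold Phi
    rcases abs_choice η with h | h
    · have : η = M := by rw [← e, h]
      rw [this]
      constructor <;> nlinarith
    · have : η = -M := by rw [← e, h, neg_neg]
      rw [this]
      constructor <;> nlinarith
  have k1 := abs_le.1 (key _ e1)
  have k2 := abs_le.1 (key _ e2)
  rw [abs_le]
  constructor <;> linarith [k1.1, k2.2]

theorem farPower_Phi {μ τ M η₁ η₂ l : ℝ} (hl : 4 ≤ l) (h1 : 100 ≤ M) (h2 : 100 * |μ| ≤ M)
    (e1 : |η₁| = M) (e2 : |η₂| = M) (t1 : Phi η₁ μ ≤ τ) (t2 : τ ≤ Phi η₂ μ) :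
    FarPower l (2 * M) (fun ξ => τ - Phi ξ μ) := by
  apply FarPower.of_leading (a := -1 / 16) (K := |τ| + μ ^ 2 + 1) 2 (by norm_num) (by linarith)
  · intro u hu
    obtain ⟨b1, b2⟩ := abs_sub_Phi_bounds h1 h2 e1 e2 t1 t2 hu
    have hl3 : 64 ≤ l ^ (2 + 1) := by
      calc (64 : ℝ) = 4 ^ 3 := by norm_num
        _ ≤ l ^ 3 := by gcongr
    have : |(-1 / 16 : ℝ)| = 1 / 16 := by norm_num
    rw [this]
    have hu3 : 0 ≤ |u| ^ 3 := by positivity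
    norm_num
    norm_num at hl3
    constructor
    · nlinarith [abs_nonneg (τ - Phi u μ)]
    · nlinarith
  · intro u hu
    have e : τ - Phi u μ - -1 / 16 * u ^ (2 + 1) =
        τ + 3 / 8 * (u * μ ^ 2) + u ^ 2 / 8 - μ ^ 2 / 4 - u / 2 := by
      unfold Phi
      ring
    rw [e]
    have hu2 : |u| ≤ |u| ^ 2 := by nlinarith
    have c1 : |u * μ ^ 2| ≤ μ ^ 2 * |u| ^ 2 := by
      rw [abs_mul, abs_of_nonneg (sq_nonneg μ)]
      nlinarith [sq_nonneg μ]
    have c2 : μ ^ 2 ≤ μ ^ 2 * |u| ^ 2 := by nlinarith [sq_nonneg μ]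
    have c3 : |τ| ≤ |τ| * |u| ^ 2 := by nlinarith [abs_nonneg τ]
    have c4 := abs_le.1 c1
    have c5 := abs_le.1 (le_refl |τ|)
    have c6 := abs_le.1 (le_refl |u|)
    have c7 := sq_abs u
    have := sq_nonneg μ
    rw [abs_le]
    constructor <;> nlinarith

/-- As the leading term of `τ - Φ(ξ, μ)` is `-ξ³ / 16`, the quotient `ξ² / (τ - Φ(ξ, μ))` is
`-16 / ξ` up to an error of order `M / ξ²`. -/
theorem abs_far_error_Phi_le {μ τ M η₁ η₂ : ℝ} (h1 : 100 ≤ M) (h2 : 100 * |μ| ≤ M)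
    (e1 : |η₁| = M) (e2 : |η₂| = M) (t1 : Phi η₁ μ ≤ τ) (t2 : τ ≤ Phi η₂ μ) {ξ : ℝ}
    (hξ : 2 * M < |ξ|) :
    |ξ ^ 2 / (τ - Phi ξ μ) - -16 * ξ⁻¹| ≤ 80 * (M / ξ ^ 2) := by
  have b1 := (abs_sub_Phi_bounds h1 h2 e1 e2 t1 t2 hξ).1
  have hτ := abs_le_of_Phi_between h1 h2 e1 e2 t1 t2
  have hx0 : 0 < |ξ| := by linarith
  have hξ0 : ξ ≠ 0 := abs_pos.1 hx0
  have hg0 : τ - Phi ξ μ ≠ 0 := abs_pos.1 (lt_of_lt_of_le (by positivity) b1)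
  have e : ξ ^ 2 / (τ - Phi ξ μ) - -16 * ξ⁻¹ =
      (16 * τ + 6 * (ξ * μ ^ 2) + 2 * ξ ^ 2 - 4 * μ ^ 2 - 8 * ξ) / (ξ * (τ - Phi ξ μ)) := by
    field_simp
    unfold Phi
    ring
  rw [e, abs_div, abs_mul]
  have num : |16 * τ + 6 * (ξ * μ ^ 2) + 2 * ξ ^ 2 - 4 * μ ^ 2 - 8 * ξ| ≤ M * ξ ^ 2 := by
    have m2 : μ ^ 2 ≤ M ^ 2 / 10000 := by
      rw [← sq_abs μ]; nlinarith [abs_nonneg μ]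
    have x2 : ξ ^ 2 = |ξ| ^ 2 := (sq_abs ξ).symm
    have c1 : |ξ * μ ^ 2| ≤ M * ξ ^ 2 / 10000 := by
      rw [abs_mul, abs_of_nonneg (sq_nonneg μ), x2]
      calc |ξ| * μ ^ 2 ≤ |ξ| * (M ^ 2 / 10000) := by gcongr
        _ ≤ M * |ξ| ^ 2 / 10000 := by nlinarith [mul_pos hx0 (by linarith : 0 < M)]
    have c4 := abs_le.1 c1
    have c5 := abs_le.1 hτ
    have c6 := abs_le.1 (le_refl |ξ|)
    have c8 : M ^ 3 ≤ M * ξ ^ 2 / 4 := by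
      rw [x2]
      have : M ^ 2 ≤ |ξ| ^ 2 / 4 := by nlinarith
      nlinarith
    have c9 : 100 * ξ ^ 2 ≤ M * ξ ^ 2 := by nlinarith [sq_nonneg ξ]
    have c10 : |ξ| ≤ ξ ^ 2 / 200 := by rw [x2]; nlinarith
    have c11 : μ ^ 2 ≤ ξ ^ 2 := by rw [x2]; nlinarith
    have := sq_nonneg μ
    rw [abs_le]
    constructor <;> nlinarith
  rw [div_le_iff₀ (mul_pos hx0 (abs_pos.2 hg0))]
  refine num.trans ?_
  calc M * ξ ^ 2 = 80 * (M / ξ ^ 2) * (|ξ| * (|ξ| ^ 3 / 80)) := by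
        rw [← sq_abs ξ]
        field_simp
    _ ≤ _ := by gcongr

/-- On the scale `M` the Cauchy density dominates `1 / M`, beyond it `M / ξ ^ 2`. -/
theorem cauchy_ge_of_le {M ξ : ℝ} (hM : 0 < M) (h : |ξ| ≤ 2 * M) :
    1 / (5 * M) ≤ M / (M ^ 2 + ξ ^ 2) := by
  have : ξ ^ 2 ≤ 4 * M ^ 2 := by rw [← sq_abs]; nlinarith [abs_nonneg ξ]
  rw [div_le_div_iff₀ (by positivity) (by positivity)]
  nlinarith

theorem cauchy_ge_of_ge {M ξ : ℝ} (hM : 0 < M) (h : 2 * M < |ξ|) :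
    4 / 5 * (M / ξ ^ 2) ≤ M / (M ^ 2 + ξ ^ 2) := by
  have h1 : 4 * M ^ 2 ≤ ξ ^ 2 := by rw [← sq_abs ξ]; nlinarith [abs_nonneg ξ]
  have h0 : 0 < ξ ^ 2 := by nlinarith
  rw [← mul_div_assoc, div_le_div_iff₀ (by positivity) (by positivity)]
  nlinarith

/-- Near a root `η` of size `M` the quotient is a simple pole up to an error of size `1 / M`. -/
theorem abs_near_error_chi1_le {ψ : ℝ → ℝ} (hψ : IsCutoff ψ) {L : ℝ} (hL1 : 1 ≤ L)
    (hL : ∀ a b : ℝ, a ≠ 0 → |ψ a - ψ b| ≤ L * (|a - b| / |a|)) {μ η M ξ : ℝ} (hM : M = |η|)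
    (hM1 : 100 ≤ M) (hM2 : 100 * |μ| ≤ M) (hg' : ξ - η ≠ 0) (hξM : |ξ| ≤ 3 / 2 * M) :
    |ξ ^ 2 * chi1 ψ ξ μ / -((ξ - η) * divDiff μ η ξ) -
      -(η ^ 2 * chi1 ψ η μ) / divDiff μ η η * (ξ - η)⁻¹| ≤ 4000 * L * (1 / (5 * M)) := by
  have hM0 : 0 < M := by linarith
  have hη0 : η ≠ 0 := abs_pos.1 (by rw [← hM]; exact hM0)
  have hD := divDiff_bounds (μ := μ) (η := η) (by rwa [← hM]) (by rwa [← hM])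
  have hs : η ^ 2 = M ^ 2 := by rw [hM, sq_abs]
  rw [hs] at hD
  have hDpos : ∀ ξ, 0 < divDiff μ η ξ := fun ξ =>
    lt_of_lt_of_le (by positivity) (hD ξ).1
  have hD0 := hD η
  rw [hs] at hD0
  have e : ξ ^ 2 * chi1 ψ ξ μ / -((ξ - η) * divDiff μ η ξ) -
      -(η ^ 2 * chi1 ψ η μ) / divDiff μ η η * (ξ - η)⁻¹ =
      -((chi1 ψ ξ μ - chi1 ψ η μ) * (ξ ^ 2 / divDiff μ η ξ) + chi1 ψ η μ *
        ((ξ ^ 2 * divDiff μ η η - η ^ 2 * divDiff μ η ξ) /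
          (divDiff μ η ξ * divDiff μ η η))) / (ξ - η) := by
    have := (hDpos ξ).ne'
    have := (hDpos η).ne'
    field_simp
    ring
  rw [e, abs_div, abs_neg, div_le_iff₀ (abs_pos.2 hg')]
  have t1 : |(chi1 ψ ξ μ - chi1 ψ η μ) * (ξ ^ 2 / divDiff μ η ξ)| ≤
      2 * L * (|ξ - η| / M) * 40 := by
    rw [abs_mul]
    have := abs_chi1_sub_le hψ hL1 hL μ ξ hη0
    rw [← hM] at this
    gcongr
    rw [abs_of_nonneg (div_nonneg (sq_nonneg _) (hDpos ξ).le), div_le_iff₀ (hDpos ξ)]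
    nlinarith [(hD ξ).1, sq_nonneg M]
  have t2 : |chi1 ψ η μ * ((ξ ^ 2 * divDiff μ η η - η ^ 2 * divDiff μ η ξ) /
          (divDiff μ η ξ * divDiff μ η η))| ≤ 600 * (|ξ - η| / M) := by
    have hχη := chi1_mem hψ η μ
    have e3 : ξ ^ 2 * divDiff μ η η - η ^ 2 * divDiff μ η ξ =
        (ξ - η) * ((ξ + η) * divDiff μ η η - η ^ 2 * ((ξ + 2 * η) / 16 - 1 / 8)) := by
      unfold divDiff
      ring
    have e4 : |(ξ + η) * divDiff μ η η - η ^ 2 * ((ξ + 2 * η) / 16 - 1 / 8)| ≤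
        3 / 4 * M ^ 3 := by
      refine (abs_sub _ _).trans ?_
      rw [abs_mul, abs_mul, abs_of_pos (hDpos η), abs_of_nonneg (sq_nonneg η), hs]
      have f1 : |ξ + η| ≤ 5 / 2 * M := (abs_add_le _ _).trans (by linarith)
      have f2 : |(ξ + 2 * η) / 16 - 1 / 8| ≤ M / 4 := by
        have g1 := abs_le.1 hξM
        have g2 := abs_le.1 hM.ge
        rw [abs_le]
        constructor <;> linarith
      have f3 : divDiff μ η η ≤ M ^ 2 / 5 := by linarith [hD0.2]
      calc _ ≤ 5 / 2 * M * (M ^ 2 / 5) + M ^ 2 * (M / 4) := by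
            gcongr
            exact (hDpos η).le
        _ = _ := by ring
    rw [abs_mul, abs_div, e3, abs_mul, abs_of_nonneg hχη.1,
      abs_of_pos (mul_pos (hDpos ξ) (hDpos η))]
    have e5 : M ^ 4 / 800 ≤ divDiff μ η ξ * divDiff μ η η := by
      calc M ^ 4 / 800 = (M ^ 2 / 40) * (M ^ 2 / 20) := by ring
        _ ≤ _ := by
          gcongr
          · exact (hDpos ξ).le
          · nlinarith [(hD ξ).1, sq_nonneg ξ]
          · linarith [hD0.1]
    calc _ ≤ 1 * (|ξ - η| * (3 / 4 * M ^ 3) / (M ^ 4 / 800)) := by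
          gcongr
          · have := hDpos ξ
            have := hDpos η
            positivity
          · exact hχη.2
      _ = _ := by field_simp; ring
  refine (abs_add_le _ _).trans ((add_le_add t1 t2).trans ?_)
  rw [show 4000 * L * (1 / (5 * M)) * |ξ - η| = 800 * L * (|ξ - η| / M) by field_simp; ring]
  have : 0 ≤ |ξ - η| / M := by positivity
  nlinarith

/-- At distance at least `M / 2` from the root the quotient itself is of size `1 / M`. -/
theorem abs_quotient_chi1_le {ψ : ℝ → ℝ} (hψ : IsCutoff ψ) {L : ℝ} (hL1 : 1 ≤ L) {μ η M ξ : ℝ}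
    (hM0 : 0 < M) (hg' : ξ - η ≠ 0) (hn : M / 2 ≤ |ξ - η|)
    (hD : (ξ ^ 2 + M ^ 2) / 40 ≤ divDiff μ η ξ) (hDpos : 0 < divDiff μ η ξ) :
    |ξ ^ 2 * chi1 ψ ξ μ / -((ξ - η) * divDiff μ η ξ)| ≤ 4000 * L * (1 / (5 * M)) := by
  have hχ := chi1_mem hψ ξ μ
  rw [abs_div, abs_neg, abs_mul, abs_mul, abs_of_nonneg (sq_nonneg ξ),
    abs_of_nonneg hχ.1, abs_of_pos (hDpos),
    div_le_iff₀ (mul_pos (abs_pos.2 hg') (hDpos))]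
  have h3 : (M / 2) * (ξ ^ 2 / 40) ≤ |ξ - η| * divDiff μ η ξ := by
    gcongr
    nlinarith [hD, sq_nonneg M]
  calc ξ ^ 2 * chi1 ψ ξ μ ≤ ξ ^ 2 * 1 := by gcongr; exact hχ.2
    _ = 80 / M * (M / 2 * (ξ ^ 2 / 40)) := by field_simp; ring
    _ ≤ 4000 * L * (1 / (5 * M)) * (|ξ - η| * divDiff μ η ξ) := by
      gcongr
      rw [mul_one_div, div_le_div_iff₀ hM0 (by positivity)]
      nlinarith

/-- The case of a root `η` in the region `|η| ≥ p` that contains the support of the cut-off. The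
scale is `|η|`, and there is no other root, as the divided difference at `η` is positive. -/
theorem pvData_chi1_of_root {ψ : ℝ → ℝ} (hψ : IsCutoff ψ) {L : ℝ} (hL1 : 1 ≤ L)
    (hL : ∀ a b : ℝ, a ≠ 0 → |ψ a - ψ b| ≤ L * (|a - b| / |a|))
    {τ μ p : ℝ} (hp : p = 100 * max 1 |μ|) (hp1 : 100 ≤ p) (hp2 : 100 * |μ| ≤ p)
    {η : ℝ} (hη : p ≤ |η|) (hτ : Phi η μ = τ) :
    PVData (4000 * L) (fun ξ => τ - Phi ξ μ) (fun ξ => ξ ^ 2 * chi1 ψ ξ μ) := by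
  have hχ1 : ∀ ξ, 2 * p ≤ |ξ| → chi1 ψ ξ μ = 1 := fun ξ h =>
    chi1_eq_one hψ (by rw [hp] at h; linarith)
  set M := |η| with hM
  have hM1 : 100 ≤ M := hp1.trans hη
  have hM2 : 100 * |μ| ≤ M := hp2.trans hη
  have hM0 : 0 < M := by linarith
  have hη0 : η ≠ 0 := abs_pos.1 (by rw [← hM]; exact hM0)
  have hD := divDiff_bounds (μ := μ) (η := η) hM1 hM2
  have hs : η ^ 2 = M ^ 2 := (sq_abs η).symm
  rw [hs] at hD
  have hfac : ∀ ξ, τ - Phi ξ μ = -((ξ - η) * divDiff μ η ξ) := by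
    intro ξ
    rw [← Phi_sub_Phi, hτ]
    ring
  have hDpos : ∀ ξ, 0 < divDiff μ η ξ := fun ξ =>
    lt_of_lt_of_le (by positivity) (hD ξ).1
  have hD0 := hD η
  rw [hs] at hD0
  have hc0 : |(-(η ^ 2 * chi1 ψ η μ) / divDiff μ η η)| ≤ 4000 * L := by
    rw [abs_div, abs_of_pos (hDpos η), div_le_iff₀ (hDpos η), abs_neg, abs_mul,
      abs_of_nonneg (sq_nonneg η), abs_of_nonneg (chi1_mem hψ η μ).1, hs]
    have := chi1_mem hψ η μ
    nlinarith [hDpos η, sq_nonneg M]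
  -- the residue at `η`, no second root, and `-16 / ξ` at infinity
  refine ⟨M, hM0, η, 0, -(η ^ 2 * chi1 ψ η μ) / divDiff μ η η, 0, -16, hc0, ?_, ?_, Or.inr ?_,
    Or.inl rfl, ?_, ?_⟩
  · simp; linarith
  · norm_num; linarith
  · apply NearRoot.of_factor (h := fun u => divDiff μ η (η + u)) (d := M ^ 2 / 10) (by positivity)
    · intro u
      rw [hfac, abs_neg, abs_mul, abs_of_pos (hDpos _)]
      simp
    · intro u hu
      have hu2 := abs_lt.1 hu
      have b := hD (η + u)
      have q1 : (η + u) ^ 2 ≤ 9 / 4 * M ^ 2 := by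
        have : |η + u| ≤ 3 / 2 * M := by
          have := abs_add_le η u
          linarith
        rw [← sq_abs]
        nlinarith [abs_nonneg (η + u)]
      constructor
      · rw [div_le_iff₀ (by linarith)]
        nlinarith [sq_nonneg (η + u), sq_nonneg M]
      · nlinarith [sq_nonneg M]
    · unfold divDiff
      fun_prop
    · exact hDpos _
  · exact farPower_Phi (by linarith) hM1 hM2 hM.symm hM.symm hτ.le hτ.ge
  · intro ξ hg
    beta_reduce at hg ⊢
    have hg' : (ξ - η) ≠ 0 := by
      rintro h
      exact hg (by rw [hfac, h]; simp)
    have hχ := chi1_mem hψ ξ μ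
    rcases lt_or_ge |ξ - η| (M / 2) with hn | hn
    · -- near the root
      have hξM : |ξ| ≤ 3 / 2 * M := by
        have := abs_add_le (ξ - η) η
        rw [sub_add_cancel] at this
        linarith
      have hfar : farKer (2 * M) ξ = 0 := by
        rw [farKer, if_neg]; linarith
      have hnear : nearKer (M / 2) η ξ = (ξ - η)⁻¹ := if_pos hn
      rw [hfar, hnear, hfac]
      simp only [zero_mul, mul_zero, add_zero]
      exact (abs_near_error_chi1_le hψ hL1 hL hM hM1 hM2 hg' hξM).trans
        (mul_le_mul_of_nonneg_left (cauchy_ge_of_le hM0 (by linarith)) (by linarith))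
    · have hnear : nearKer (M / 2) η ξ = 0 := if_neg (not_lt.2 hn)
      rw [hnear]
      simp only [mul_zero, zero_mul, zero_add]
      rcases le_or_gt |ξ| (2 * M) with hm | hm
      · -- the intermediate region
        have hfar : farKer (2 * M) ξ = 0 := by
          rw [farKer, if_neg]; linarith
        rw [hfar, hfac, mul_zero, sub_zero]
        refine le_trans ?_ (mul_le_mul_of_nonneg_left (cauchy_ge_of_le hM0 hm) (by linarith))
        exact abs_quotient_chi1_le hψ hL1 hM0 hg' hn (hD ξ).1 (hDpos ξ)
      · have hfar : farKer (2 * M) ξ = ξ⁻¹ := if_pos hm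
        rw [hfar, hχ1 ξ (by linarith), mul_one]
        refine (abs_far_error_Phi_le hM1 hM2 hM.symm hM.symm hτ.le hτ.ge hm).trans ?_
        refine le_trans ?_ (mul_le_mul_of_nonneg_left (cauchy_ge_of_ge hM0 hm) (by linarith))
        have : 0 ≤ M / ξ ^ 2 := by positivity
        nlinarith

/-- The case without roots in the region `|ξ| ≥ p`. The scale is `p`. The function `τ - Φ(·, μ)`
may be small near `|ξ| = p`, but there the cut-off compensates, being Lipschitz and
zero at `|ξ| = p`. -/
theorem pvData_chi1_of_no_root {ψ : ℝ → ℝ} (hψ : IsCutoff ψ) {L : ℝ} (hL1 : 1 ≤ L)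
    (hL : ∀ a b : ℝ, a ≠ 0 → |ψ a - ψ b| ≤ L * (|a - b| / |a|))
    {τ μ p : ℝ} (hp : p = 100 * max 1 |μ|) (hp1 : 100 ≤ p) (hp2 : 100 * |μ| ≤ p)
    (h' : Phi (-p) μ < τ) (h : τ < Phi p μ) :
    PVData (4000 * L) (fun ξ => τ - Phi ξ μ) (fun ξ => ξ ^ 2 * chi1 ψ ξ μ) := by
  have hχ1 : ∀ ξ, 2 * p ≤ |ξ| → chi1 ψ ξ μ = 1 := fun ξ h =>
    chi1_eq_one hψ (by rw [hp] at h; linarith)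
  have hp0 : 0 < p := by linarith
  have ep : |p| = p := abs_of_pos hp0
  have ep' : |(-p)| = p := by rw [abs_neg, ep]
  refine ⟨p, hp0, 0, 0, 0, 0, -16, ?_, ?_, ?_, Or.inl rfl, Or.inl rfl, ?_, ?_⟩
  · simp; linarith
  · simp; linarith
  · norm_num; linarith
  · exact farPower_Phi (by linarith) hp1 hp2 ep' ep h'.le h.le
  · intro ξ hg
    beta_reduce at hg ⊢
    have hχ := chi1_mem hψ ξ μ
    simp only [zero_mul, zero_add]
    rcases le_or_gt |ξ| (2 * p) with hm | hm
    · have hfar : farKer (2 * p) ξ = 0 := by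
        rw [farKer, if_neg]; linarith
      rw [hfar, mul_zero, sub_zero]
      refine le_trans ?_ (mul_le_mul_of_nonneg_left (cauchy_ge_of_le hp0 hm) (by linarith))
      rcases le_or_gt |ξ| p with hz | hz
      · rw [chi1_eq_zero hψ (hp ▸ hz)]
        simp only [mul_zero, zero_div, abs_zero]
        positivity
      · -- the cut-off vanishes to first order at the boundary of its support
        obtain ⟨η, hη, hle, hge⟩ : ∃ η, |η| = p ∧ |ξ - η| = |ξ| - p ∧
            |ξ - η| * divDiff μ η ξ ≤ |τ - Phi ξ μ| := by
          rcases lt_abs.1 hz with h0 | h0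
          · have hb := divDiff_bounds (μ := μ) (η := p) (by rwa [ep]) (by rwa [ep]) ξ
            refine ⟨p, ep, ?_, ?_⟩
            · rw [abs_of_pos (by linarith), abs_of_pos (by linarith)]
            · rw [abs_of_pos (by linarith), ← Phi_sub_Phi]
              rw [abs_sub_comm]
              exact le_trans (by linarith) (le_abs_self _)
          · have hb := divDiff_bounds (μ := μ) (η := -p) (by rwa [ep']) (by rwa [ep']) ξ
            refine ⟨-p, ep', ?_, ?_⟩
            · rw [abs_of_neg (by linarith), abs_of_neg (by linarith)]
              ring
            · rw [abs_of_neg (by linarith), neg_mul, ← Phi_sub_Phi]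
              exact le_trans (by linarith) (le_abs_self _)
        have hη0 : η ≠ 0 := abs_pos.1 (by linarith)
        have hb := (divDiff_bounds (μ := μ) (η := η) (by rwa [hη]) (by rwa [hη]) ξ).1
        have hχη : chi1 ψ η μ = 0 := chi1_eq_zero hψ (hp ▸ hη.le)
        have hlip := abs_chi1_sub_le hψ hL1 hL μ ξ hη0
        rw [hχη, sub_zero, abs_of_nonneg hχ.1, hη] at hlip
        rw [abs_div, div_le_iff₀ (abs_pos.2 hg), abs_mul, abs_of_nonneg (sq_nonneg ξ),
          abs_of_nonneg hχ.1]
        have hlow : |ξ - η| * (ξ ^ 2 / 40) ≤ |τ - Phi ξ μ| := by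
          refine le_trans ?_ hge
          gcongr
          nlinarith [sq_nonneg η]
        calc ξ ^ 2 * chi1 ψ ξ μ ≤ ξ ^ 2 * (2 * L * (|ξ - η| / p)) := by gcongr
          _ = 80 * L / p * (|ξ - η| * (ξ ^ 2 / 40)) := by field_simp; ring
          _ ≤ 4000 * L * (1 / (5 * p)) * |τ - Phi ξ μ| := by
            gcongr
            rw [mul_one_div, div_le_div_iff₀ hp0 (by positivity)]
            nlinarith
    · have hfar : farKer (2 * p) ξ = ξ⁻¹ := if_pos hm
      rw [hfar, hχ1 ξ hm.le, mul_one]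
      refine (abs_far_error_Phi_le hp1 hp2 ep' ep h'.le h.le hm).trans ?_
      refine le_trans ?_ (mul_le_mul_of_nonneg_left (cauchy_ge_of_ge hp0 hm) (by linarith))
      have : 0 ≤ p / ξ ^ 2 := by positivity
      nlinarith

theorem pvData_chi1 {ψ : ℝ → ℝ} (hψ : IsCutoff ψ) {L : ℝ} (hL1 : 1 ≤ L)
    (hL : ∀ a b : ℝ, a ≠ 0 → |ψ a - ψ b| ≤ L * (|a - b| / |a|)) (τ μ : ℝ) :
    PVData (4000 * L) (fun ξ => τ - Phi ξ μ) (fun ξ => ξ ^ 2 * chi1 ψ ξ μ) := by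
  set p := 100 * max 1 |μ| with hp
  have hp1 : 100 ≤ p := by have := le_max_left 1 |μ|; linarith
  have hp2 : 100 * |μ| ≤ p := by have := le_max_right 1 |μ|; linarith
  rcases le_or_gt (Phi p μ) τ with h | h
  · obtain ⟨η, h1, h2⟩ := exists_root_ge hp1 hp2 h
    exact pvData_chi1_of_root hψ hL1 hL hp hp1 hp2 (η := η) (h1.trans (le_abs_self _)) h2
  rcases le_or_gt τ (Phi (-p) μ) with h' | h'
  · obtain ⟨η, h1, h2⟩ := exists_root_le hp1 hp2 h'
    exact pvData_chi1_of_root hψ hL1 hL hp hp1 hp2 (η := η) (by have := neg_le_abs η; linarith) h2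
  exact pvData_chi1_of_no_root hψ hL1 hL hp hp1 hp2 h' h

/-! ### The quotient in the second region -/

/-- Growth of the quadratic `b (μ² - λ)` beyond the scale `M`, where `|λ| ≤ M²`. -/
theorem farPower_quadratic {b lam M l : ℝ} (hb : b ≠ 0) (hl : 2 ≤ l) (hM : 0 < M)
    (hlam : |lam| ≤ M ^ 2) : FarPower l (2 * M) (fun μ => b * (μ ^ 2 - lam)) := by
  have hb' := abs_pos.2 hb
  apply FarPower.of_leading (a := b) (K := |b| * |lam|) 1 hb (by linarith)
  · intro u hu
    have hl2 : 4 ≤ l ^ (1 + 1) := by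
      calc (4 : ℝ) = 2 ^ 2 := by norm_num
        _ ≤ l ^ 2 := by gcongr
    have h1 : M ^ 2 ≤ |u| ^ 2 / 4 := by nlinarith
    have h2 := abs_le.1 hlam
    have h3 : 3 / 4 * |u| ^ 2 ≤ u ^ 2 - lam := by rw [← sq_abs u]; linarith
    have h4 : u ^ 2 - lam ≤ 5 / 4 * |u| ^ 2 := by rw [← sq_abs u]; linarith
    have h0 : 0 ≤ |u| ^ 2 := by positivity
    rw [abs_mul, abs_of_nonneg (by linarith : 0 ≤ u ^ 2 - lam)]
    norm_num
    norm_num at hl2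
    rw [sq_abs] at h3 h4 h0
    constructor
    · calc |b| * u ^ 2 ≤ 4 * (|b| * (u ^ 2 - lam)) := by nlinarith
        _ ≤ _ := by gcongr; exact mul_nonneg hb'.le (by linarith)
    · calc |b| * (u ^ 2 - lam) ≤ 4 * |b| * u ^ 2 := by nlinarith
        _ ≤ _ := by gcongr
  · intro u hu
    rw [show b * (u ^ 2 - lam) - b * u ^ (1 + 1) = -(b * lam) by ring, abs_neg, abs_mul, pow_one]
    have : 0 ≤ |b| * |lam| := by positivity
    nlinarith

/-- For large `μ` the quotient `s b μ c / (b (μ² - λ))` is `s c / μ` up to an error of order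
`M / μ²`. -/
theorem abs_far_error_quadratic_le {s b lam M c μ : ℝ} (hM : 0 < M) (hlam : |lam| ≤ M ^ 2)
    (hs : |s| ≤ 4) (hc : |c| ≤ 1) (hμ : 2 * M < |μ|) (hb : b ≠ 0) :
    |s * b * μ * c / (b * (μ ^ 2 - lam)) - s * c * μ⁻¹| ≤ 4 * (M / μ ^ 2) := by
  have h0 : 0 < |μ| := by linarith
  have hμ0 : μ ≠ 0 := abs_pos.1 h0
  have h1 : M ^ 2 ≤ μ ^ 2 / 4 := by rw [← sq_abs μ]; nlinarith
  have h2 := abs_le.1 hlam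
  have h3 : 3 / 4 * μ ^ 2 ≤ μ ^ 2 - lam := by linarith
  have hμ2 : 0 < μ ^ 2 := by positivity
  have h4 : 0 < μ ^ 2 - lam := by linarith
  have e : s * b * μ * c / (b * (μ ^ 2 - lam)) - s * c * μ⁻¹ =
      s * c * (lam / (μ * (μ ^ 2 - lam))) := by
    have := h4.ne'
    field_simp
    ring
  rw [e, abs_mul, abs_mul, abs_div, abs_mul, abs_of_pos h4]
  calc |s| * |c| * (|lam| / (|μ| * (μ ^ 2 - lam)))
      ≤ 4 * 1 * (M ^ 2 / (2 * M * (3 / 4 * μ ^ 2))) := by gcongr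
    _ = 8 / 3 * (M / μ ^ 2) := by field_simp; ring
    _ ≤ _ := by
      have : 0 ≤ M / μ ^ 2 := by positivity
      linarith

/-- The pole of `s μ χ(μ) / (μ² - r²)` at a root `r`, where `χ` is Lipschitz at the scale `r`. -/
theorem abs_near_error_quadratic_le {s b L r μ c c' : ℝ} (hL : 1 ≤ L) (hs : |s| ≤ 4)
    (hb : b ≠ 0) (hr : r ≠ 0) (hc' : |c'| ≤ 1)
    (hlip : |c - c'| ≤ L * (|μ - r| / |r|)) (hn : |μ - r| < |r| / 2) (hμ : μ ≠ r) :
    |s * b * μ * c / (b * (μ ^ 2 - r ^ 2)) - s * c' / 2 * (μ - r)⁻¹| ≤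
      4000 * L * (1 / (5 * |r|)) := by
  have hr0 : 0 < |r| := abs_pos.2 hr
  have h1 : 3 / 2 * |r| ≤ |μ + r| := by
    have := abs_sub_abs_le_abs_sub (2 * r) (r - μ)
    rw [show 2 * r - (r - μ) = μ + r by ring, abs_mul, abs_sub_comm r μ] at this
    norm_num at this
    linarith
  have h2 : |μ| ≤ |μ + r| := by
    have := abs_add_le (μ - r) r
    rw [sub_add_cancel] at this
    linarith
  have hp : μ + r ≠ 0 := abs_pos.1 (by linarith)
  have hm : μ - r ≠ 0 := sub_ne_zero.2 hμ
  have hp0 := abs_pos.2 hp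
  have e : s * b * μ * c / (b * (μ ^ 2 - r ^ 2)) - s * c' / 2 * (μ - r)⁻¹ =
      s * ((c - c') * (μ / (μ + r)) + c' * ((μ - r) / (2 * (μ + r)))) / (μ - r) := by
    rw [show μ ^ 2 - r ^ 2 = (μ - r) * (μ + r) by ring]
    field_simp
    ring
  rw [e, abs_div, abs_mul, div_le_iff₀ (abs_pos.2 hm)]
  have k1 : |(c - c') * (μ / (μ + r))| ≤ L * (|μ - r| / |r|) * 1 := by
    rw [abs_mul, abs_div]
    gcongr
    rw [div_le_one hp0]
    exact h2
  have k2 : |c' * ((μ - r) / (2 * (μ + r)))| ≤ 1 * (|μ - r| / |r|) := by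
    rw [abs_mul, abs_div, abs_mul]
    gcongr
    norm_num
    linarith
  have k3 := (abs_add_le _ _).trans (add_le_add k1 k2)
  have h0 : 0 ≤ |μ - r| / |r| := by positivity
  calc |s| * |(c - c') * (μ / (μ + r)) + c' * ((μ - r) / (2 * (μ + r)))|
      ≤ 4 * (L * (|μ - r| / |r|) * 1 + 1 * (|μ - r| / |r|)) := by gcongr
    _ ≤ 800 * L * (|μ - r| / |r|) := by nlinarith
    _ = _ := by field_simp; ring

theorem nearRoot_quadratic {b r l : ℝ} (hb : b ≠ 0) (hr : r ≠ 0) (hl : 2 ≤ l) :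
    NearRoot l (|r| / 2) (fun μ => b * (μ ^ 2 - r ^ 2)) r := by
  have hb' := abs_pos.2 hb
  have hr' := abs_pos.2 hr
  apply NearRoot.of_factor (h := fun u => |b| * |2 * r + u|) (d := 2 * |b| * |r|) (by positivity)
  · intro u
    rw [show b * ((r + u) ^ 2 - r ^ 2) = u * (b * (2 * r + u)) by ring, abs_mul, abs_mul]
  · intro u hu
    have h1 : |2 * r + u| ≤ 4 * |r| := by
      have := abs_add_le (2 * r) u
      rw [abs_mul] at this
      norm_num at this
      linarith
    have h2 : |r| ≤ |2 * r + u| := by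
      have := abs_sub_abs_le_abs_sub (2 * r) (-u)
      rw [sub_neg_eq_add, abs_neg, abs_mul] at this
      norm_num at this
      linarith
    constructor
    · rw [div_le_iff₀ (by linarith)]
      calc 2 * |b| * |r| = |b| * |r| * 2 := by ring
        _ ≤ |b| * |2 * r + u| * l := by gcongr
    · calc |b| * |2 * r + u| ≤ |b| * (4 * |r|) := by gcongr
        _ = 2 * (2 * |b| * |r|) := by ring
        _ ≤ _ := by gcongr
  · fun_prop
  · simp only [add_zero, abs_mul]
    positivity

/-- The data for the quotient `s b μ χ(μ) / (b (μ² - λ))`, where `χ` vanishes for `|μ| ≤ p`, is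
constant for `|μ| ≥ 2p` and Lipschitz in the scale invariant sense. -/
theorem pvData_quadratic {χ : ℝ → ℝ} {s b lam L p c : ℝ} (hL : 1 ≤ L) (hs : |s| ≤ 4) (hb : b ≠ 0)
    (hp : 0 < p) (hχ : ∀ μ, |χ μ| ≤ 1) (h0 : ∀ μ, |μ| ≤ p → χ μ = 0)
    (hc : ∀ μ, 2 * p ≤ |μ| → χ μ = c)
    (hlip : ∀ μ η, η ≠ 0 → |χ μ - χ η| ≤ L * (|μ - η| / |η|)) :
    PVData (4000 * L) (fun μ => b * (μ ^ 2 - lam)) (fun μ => s * b * μ * χ μ) := by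
  have hc1 : |c| ≤ 1 := by
    rw [← hc (2 * p) (le_abs_self _)]
    exact hχ _
  have hsc : |s * c| ≤ 4000 * L := by
    rw [abs_mul]
    nlinarith [abs_nonneg s, abs_nonneg c]
  have far : ∀ M μ, p ≤ M → |lam| ≤ M ^ 2 → 2 * M < |μ| →
      |s * b * μ * χ μ / (b * (μ ^ 2 - lam)) - s * c * μ⁻¹| ≤
        4000 * L * (M / (M ^ 2 + μ ^ 2)) := by
    intro M μ hpM hlam hμ
    have hM : 0 < M := by linarith
    rw [hc μ (by linarith)]
    refine (abs_far_error_quadratic_le hM hlam hs hc1 hμ hb).trans ?_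
    refine le_trans ?_ (mul_le_mul_of_nonneg_left (cauchy_ge_of_ge hM hμ) (by linarith))
    have : 0 ≤ M / μ ^ 2 := by positivity
    nlinarith
  have hone : (1 : ℝ) ≤ 4000 * L := by linarith
  rcases le_or_gt (p ^ 2) lam with hlam | hlam
  · -- two real roots `± r` with `r ≥ p`
    set r := √lam with hr
    have hr2 : r ^ 2 = lam := Real.sq_sqrt (by nlinarith)
    have hpr : p ≤ r := Real.le_sqrt_of_sq_le hlam
    have hr0 : 0 < r := by linarith
    have har : |r| = r := abs_of_pos hr0
    have har' : |(-r)| = r := by rw [abs_neg, har]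
    have hcr : ∀ η, |s * χ η / 2| ≤ 4000 * L := by
      intro η
      rw [abs_div, abs_mul]
      have := hχ η
      norm_num
      nlinarith [abs_nonneg s, abs_nonneg (χ η)]
    have hal : |lam| ≤ r ^ 2 := by rw [hr2, abs_of_nonneg (by nlinarith)]
    refine ⟨r, hr0, r, -r, s * χ r / 2, s * χ (-r) / 2, s * c, hcr r, hcr (-r), hsc, Or.inr ?_,
      Or.inr ?_, farPower_quadratic hb (by linarith) hr0 hal, ?_⟩
    · have := nearRoot_quadratic (l := 4000 * L) hb hr0.ne' (by linarith)
      rwa [har, hr2] at this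
    · have := nearRoot_quadratic (l := 4000 * L) hb (neg_ne_zero.2 hr0.ne') (by linarith)
      rwa [har', neg_sq, hr2] at this
    intro μ hg
    beta_reduce at hg ⊢
    have hne1 : μ ≠ r := by
      rintro h
      exact hg (by rw [h, hr2]; simp)
    have hne2 : μ ≠ -r := by
      rintro h
      exact hg (by rw [h, neg_sq, hr2]; simp)
    rcases lt_or_ge (2 * r) |μ| with hm | hm
    · have n1 : nearKer (r / 2) r μ = 0 := by
        refine if_neg (not_lt.2 ?_)
        have := abs_sub_abs_le_abs_sub μ r
        linarith
      have n2 : nearKer (r / 2) (-r) μ = 0 := by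
        refine if_neg (not_lt.2 ?_)
        have := abs_sub_abs_le_abs_sub μ (-r)
        linarith
      rw [n1, n2, farKer, if_pos hm]
      simp only [mul_zero, zero_add]
      exact far r μ hpr hal hm
    · have hfar : farKer (2 * r) μ = 0 := if_neg (not_lt.2 hm)
      rw [hfar]
      refine le_trans ?_ (mul_le_mul_of_nonneg_left (cauchy_ge_of_le hr0 hm) (by linarith))
      rcases lt_or_ge |μ - r| (r / 2) with hn1 | hn1
      · have n1 : nearKer (r / 2) r μ = (μ - r)⁻¹ := if_pos hn1
        have n2 : nearKer (r / 2) (-r) μ = 0 := by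
          refine if_neg (not_lt.2 ?_)
          have h1 := abs_lt.1 hn1
          rw [abs_of_pos (by linarith)]
          linarith
        rw [n1, n2]
        simp only [mul_zero, add_zero]
        have := abs_near_error_quadratic_le (s := s) (b := b) (c := χ μ) (c' := χ r) (μ := μ)
          hL hs hb hr0.ne' (hχ r)
          (hlip μ r hr0.ne') (by rwa [har]) hne1
        rwa [har, hr2] at this
      · have n1 : nearKer (r / 2) r μ = 0 := if_neg (not_lt.2 hn1)
        rw [n1]
        simp only [mul_zero, zero_add, add_zero]
        rcases lt_or_ge |μ - -r| (r / 2) with hn2 | hn2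
        · have n2 : nearKer (r / 2) (-r) μ = (μ - -r)⁻¹ := if_pos hn2
          rw [n2]
          have := abs_near_error_quadratic_le (s := s) (b := b) (c := χ μ) (c' := χ (-r))
            (μ := μ) hL hs hb
            (neg_ne_zero.2 hr0.ne') (hχ (-r))
            (hlip μ (-r) (neg_ne_zero.2 hr0.ne')) (by rwa [har']) hne2
          rwa [har', neg_sq, hr2] at this
        · have n2 : nearKer (r / 2) (-r) μ = 0 := if_neg (not_lt.2 hn2)
          rw [n2, mul_zero, sub_zero]
          rw [sub_neg_eq_add] at hn2
          have e : s * b * μ * χ μ / (b * (μ ^ 2 - lam)) = s * χ μ * μ / ((μ - r) * (μ + r)) := by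
            rw [← hr2, show μ ^ 2 - r ^ 2 = (μ - r) * (μ + r) by ring]
            field_simp
          rw [e, abs_div, abs_mul, abs_mul, abs_mul]
          calc |s| * |χ μ| * |μ| / (|μ - r| * |μ + r|)
              ≤ 4 * 1 * (2 * r) / (r / 2 * (r / 2)) := by
                gcongr
                exact hχ μ
            _ = 32 / r := by field_simp; ring
            _ ≤ _ := by
              rw [mul_one_div, div_le_div_iff₀ hr0 (by positivity)]
              nlinarith
  · -- no root in the support of the cut-off
    -- for `λ < 0` the quadratic `μ² - λ` is elliptic at the scale `√(-λ)`
    set M := max p (√(-lam)) with hM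
    have hpM : p ≤ M := le_max_left _ _
    have hM0 : 0 < M := by linarith
    have hal : |lam| ≤ M ^ 2 := by
      rw [abs_le]
      constructor
      · rcases le_or_gt 0 lam with h | h
        · nlinarith
        · have h1 : √(-lam) ^ 2 = -lam := Real.sq_sqrt (by linarith)
          have h2 : √(-lam) ≤ M := le_max_right _ _
          nlinarith [Real.sqrt_nonneg (-lam)]
      · nlinarith
    refine ⟨M, hM0, 0, 0, 0, 0, s * c, by simp; linarith, by simp; linarith, hsc, Or.inl rfl,
      Or.inl rfl, farPower_quadratic hb (by linarith) hM0 hal, ?_⟩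
    intro μ hg
    beta_reduce at hg ⊢
    simp only [zero_mul, zero_add]
    rcases lt_or_ge (2 * M) |μ| with hm | hm
    · rw [farKer, if_pos hm]
      exact far M μ hpM hal hm
    · have hfar : farKer (2 * M) μ = 0 := if_neg (not_lt.2 hm)
      rw [hfar, mul_zero, sub_zero]
      refine le_trans ?_ (mul_le_mul_of_nonneg_left (cauchy_ge_of_le hM0 hm) (by linarith))
      rcases le_or_gt |μ| p with hz | hz
      · rw [h0 μ hz]
        simp only [mul_zero, zero_div, abs_zero]
        positivity
      · have hpos : 0 < μ ^ 2 - lam := by rw [← sq_abs μ]; nlinarith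
        have e : s * b * μ * χ μ / (b * (μ ^ 2 - lam)) = s * χ μ * μ / (μ ^ 2 - lam) := by
          have := hpos.ne'
          field_simp
        rw [e, abs_div, abs_mul, abs_mul, abs_of_pos hpos, div_le_iff₀ hpos]
        have hR : 4000 * L * (1 / (5 * M)) * (μ ^ 2 - lam) = 800 * L / M * (μ ^ 2 - lam) := by
          field_simp
          ring
        rw [hR]
        rcases le_total p (√(-lam)) with hcase | hcase
        · have hM' : M = √(-lam) := max_eq_right hcase
          have hneg : 0 < -lam := by
            by_contra hcon
            rw [Real.sqrt_eq_zero_of_nonpos (not_lt.1 hcon)] at hcase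
            linarith
          have hM2 : M ^ 2 = -lam := by rw [hM', Real.sq_sqrt hneg.le]
          calc |s| * |χ μ| * |μ| ≤ 4 * 1 * (2 * M) := by gcongr; exact hχ μ
            _ = 8 / M * M ^ 2 := by field_simp; ring
            _ ≤ 800 * L / M * (μ ^ 2 - lam) := by
              gcongr
              · linarith
              · rw [hM2]; nlinarith [sq_nonneg μ]
        · have hM' : M = p := max_eq_left hcase
          -- the cut-off vanishes to first order at the boundary of its support
          obtain ⟨η, hη, hd⟩ : ∃ η : ℝ, |η| = p ∧ |μ - η| = |μ| - p := by
            rcases lt_abs.1 hz with h | h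
            · exact ⟨p, abs_of_pos hp, by rw [abs_of_pos (by linarith), abs_of_pos (by linarith)]⟩
            · refine ⟨-p, by rw [abs_neg, abs_of_pos hp], ?_⟩
              rw [abs_of_neg (by linarith), abs_of_neg (by linarith)]
              ring
          have hη0 : η ≠ 0 := abs_pos.1 (by linarith)
          have hl := hlip μ η hη0
          rw [h0 η hη.le, sub_zero, hη, hd] at hl
          have hd0 : 0 ≤ |μ| - p := by linarith
          rw [hM'] at hm ⊢
          calc |s| * |χ μ| * |μ| ≤ 4 * (L * ((|μ| - p) / p)) * (2 * p) := by gcongr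
            _ = 8 * L / p * ((|μ| - p) * p) := by field_simp; ring
            _ ≤ 800 * L / p * (μ ^ 2 - lam) := by
              gcongr
              · linarith
              · rw [← sq_abs μ]; nlinarith

/-- The principal values of the second region, uniformly in the frozen variables. -/
theorem pvBounded_chi2 {ψ : ℝ → ℝ} (hψ : IsCutoff ψ) {L : ℝ} (hL1 : 1 ≤ L)
    (hL : ∀ a b : ℝ, a ≠ 0 → |ψ a - ψ b| ≤ L * (|a - b| / |a|)) (τ ξ : ℝ) :
    PVBounded (pvConst (4000 * L)) (fun μ => τ - Phi ξ μ)
      (fun μ => ξ * μ * chi2 ψ ξ μ / (τ - Phi ξ μ)) := by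
  have hΛ : 1 ≤ 4000 * L := by linarith
  have hlog := Real.log_nonneg hΛ
  have hpi := Real.pi_pos
  rcases le_or_gt |ξ| 100 with h | h
  -- the factor `1 - ψ(ξ)` vanishes for `|ξ| ≤ 100`
  · have : (fun μ => ξ * μ * chi2 ψ ξ μ / (τ - Phi ξ μ)) = fun _ => 0 := by
      ext μ
      simp [chi2, hψ.eq_one' h]
    rw [this]
    apply PVBounded.zero
    unfold pvConst
    positivity
  · have hm2 : Measurable (fun μ => chi2 ψ ξ μ) :=
      (measurable_chi2 hψ).comp (measurable_const.prodMk measurable_id)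
    apply pvBounded_of_data hΛ (by unfold Phi; fun_prop) (by fun_prop)
    set b := 3 / 8 * ξ - 1 / 4 with hb
    have hbabs : |ξ| / 4 ≤ |b| := by
      have := abs_sub_abs_le_abs_sub (3 / 8 * ξ) (1 / 4)
      rw [abs_mul] at this
      norm_num at this
      rw [hb]
      norm_num
      linarith
    have hb0 : b ≠ 0 := abs_pos.1 (by linarith)
    set lam := -(τ - ξ ^ 3 / 16 + ξ ^ 2 / 8 - ξ / 2) / b with hlam
    have e1 : (fun μ => τ - Phi ξ μ) = fun μ => b * (μ ^ 2 - lam) := by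
      ext μ
      have : b * lam = -(τ - ξ ^ 3 / 16 + ξ ^ 2 / 8 - ξ / 2) := by
        rw [hlam]
        field_simp
      rw [mul_sub, this, hb]
      unfold Phi
      ring
    have e2 : (fun μ => ξ * μ * chi2 ψ ξ μ) = fun μ => ξ / b * b * μ * chi2 ψ ξ μ := by
      ext μ
      rw [div_mul_cancel₀ _ hb0]
    rw [e1, e2]
    apply pvData_quadratic (p := |ξ| / 200) (c := 1 - ψ ξ) hL1 _ hb0 (by linarith)
    · intro μ
      have := chi2_mem hψ ξ μ
      rw [abs_of_nonneg this.1]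
      exact this.2
    · intro μ hμ
      exact chi2_eq_zero hψ (by linarith)
    · intro μ hμ
      refine chi2_eq hψ (by linarith) (abs_pos.1 (by linarith))
    · intro μ η hη
      exact abs_chi2_sub_le hψ hL1 hL ξ μ hη
    · rw [abs_div, div_le_iff₀ (by linarith)]
      linarith

/-- The principal values of the first region, uniformly in the frozen variables. -/
theorem pvBounded_chi1 {ψ : ℝ → ℝ} (hψ : IsCutoff ψ) {L : ℝ} (hL1 : 1 ≤ L)
    (hL : ∀ a b : ℝ, a ≠ 0 → |ψ a - ψ b| ≤ L * (|a - b| / |a|)) (τ μ : ℝ) :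
    PVBounded (pvConst (4000 * L)) (fun ξ => τ - Phi ξ μ)
      (fun ξ => ξ ^ 2 * chi1 ψ ξ μ / (τ - Phi ξ μ)) := by
  have hm1 : Measurable (fun ξ => chi1 ψ ξ μ) :=
    (measurable_chi1 hψ).comp (measurable_id.prodMk measurable_const)
  exact pvBounded_of_data (by linarith) (by unfold Phi; fun_prop) (by fun_prop)
    (pvData_chi1 hψ hL1 hL τ μ)

/-! ### Band limited functions -/

/-- The partial Fourier transform in `(x, y)` of a space-time function. -/
def spaceFT (F : ℝ × ℝ × ℝ → ℂ) (s ξ μ : ℝ) : ℂ := FTxy (fun z => F (s, z)) ξ μ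

/-- Space-time functions that are supported in a bounded time interval, decay in space, and have
bounded frequency support in space. -/
structure BandLimited (R : ℝ) (F : ℝ × ℝ × ℝ → ℂ) : Prop where
  measurable : Measurable F
  decay : ∃ C, ∀ p, ‖F p‖ ≤ C * ((1 + p.2.1 ^ 2)⁻¹ * (1 + p.2.2 ^ 2)⁻¹)
  eq_zero : ∀ p, R < |p.1| → F p = 0
  spaceFT_eq_zero : ∀ s ξ μ, R < |ξ| ∨ R < |μ| → spaceFT F s ξ μ = 0

/-- The decay `(1 + x²)⁻¹` is stable under convolution with compactly supported functions. -/
theorem one_add_sq_inv_sub_le {T x x' : ℝ} (h : |x'| ≤ T) :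
    (1 + (x - x') ^ 2)⁻¹ ≤ 2 * (1 + T ^ 2) * (1 + x ^ 2)⁻¹ := by
  have h1 : x' ^ 2 ≤ T ^ 2 := by rw [← sq_abs x']; nlinarith [abs_nonneg x']
  rw [← div_eq_mul_inv, inv_eq_one_div, div_le_div_iff₀ (by positivity) (by positivity)]
  nlinarith [sq_nonneg (x - 2 * x'), mul_nonneg (sq_nonneg T) (sq_nonneg (x - x'))]

/-- The convolution kernel of the Fourier multiplier with symbol `m`. -/
def symbolKernel (m : ℝ × ℝ → ℂ) (z : ℝ × ℝ) : ℂ :=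
  (((2 * Real.pi) ^ 2 : ℝ) : ℂ)⁻¹ * ∫ ζ : ℝ × ℝ, cexpI (z.1 * ζ.1 + z.2 * ζ.2) * m ζ

theorem integrable_decay :
    Integrable (fun z : ℝ × ℝ => (1 + z.1 ^ 2)⁻¹ * (1 + z.2 ^ 2)⁻¹) :=
  integrable_inv_one_add_sq.mul_prod integrable_inv_one_add_sq

open scoped FourierTransform SchwartzMap in
/-- The kernel of a test symbol decays, and its Fourier transform is the symbol. -/
theorem symbolKernel_facts {m : ℝ × ℝ → ℂ} (hm : ContDiff ℝ ∞ m) (hc : HasCompactSupport m) :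
    Continuous (symbolKernel m) ∧
    (∃ C, 0 ≤ C ∧ ∀ z, ‖symbolKernel m z‖ ≤ C * ((1 + z.1 ^ 2)⁻¹ * (1 + z.2 ^ 2)⁻¹)) ∧
    ∀ ζ, ∫ z : ℝ × ℝ, cexpI (-(z.1 * ζ.1 + z.2 * ζ.2)) * symbolKernel m z = m ζ := by
  set e := Complex.measurableEquivRealProd
  have hmp : MeasurePreserving e volume volume := measurePreserving_equivRealProd
  have hcoe : ∀ v : ℂ, e v = Complex.equivRealProdCLM v := fun v => rfl
  have hsm : ContDiff ℝ ∞ (fun v : ℂ => m (Complex.equivRealProdCLM v)) :=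
    hm.comp Complex.equivRealProdCLM.contDiff
  have hcs : HasCompactSupport (fun v : ℂ => m (Complex.equivRealProdCLM v)) :=
    hc.comp_homeomorph Complex.equivRealProdCLM.toHomeomorph
  set n : 𝓢(ℂ, ℂ) := hcs.toSchwartzMap hsm with hn
  set G : 𝓢(ℂ, ℂ) := 𝓕⁻ n with hG
  have hpi : (2 * Real.pi) ≠ 0 := by positivity
  have hker : ∀ w : ℂ, symbolKernel m (e ((2 * Real.pi) • w)) =
      (((2 * Real.pi) ^ 2 : ℝ) : ℂ)⁻¹ * G w := by
    intro w
    rw [symbolKernel, hG, SchwartzMap.fourierInv_coe, Real.fourierInv_eq',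
      ← hmp.integral_comp e.measurableEmbedding]
    congr 2
    ext v
    simp only [smul_eq_mul, cexpI, Complex.inner]
    have hnv : n v = m (e v) := rfl
    rw [hnv]
    congr 2
    simp [hcoe]
    ring
  have hker' : ∀ z : ℝ × ℝ, symbolKernel m z = (((2 * Real.pi) ^ 2 : ℝ) : ℂ)⁻¹ *
      G ((2 * Real.pi)⁻¹ • Complex.equivRealProdCLM.symm z) := by
    intro z
    rw [← hker, smul_inv_smul₀ hpi, hcoe, ContinuousLinearEquiv.apply_symm_apply]
  refine ⟨?_, ?_, ?_⟩
  · have : symbolKernel m = fun z => (((2 * Real.pi) ^ 2 : ℝ) : ℂ)⁻¹ *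
      G ((2 * Real.pi)⁻¹ • Complex.equivRealProdCLM.symm z) := funext hker'
    rw [this]
    have := G.continuous
    fun_prop
  · obtain ⟨C0, hC0⟩ := G.decay 0 0
    obtain ⟨C4, hC4⟩ := G.decay 4 0
    set D := ‖(((2 * Real.pi) ^ 2 : ℝ) : ℂ)⁻¹‖ with hD
    have hbd : ∀ z : ℝ × ℝ, ‖symbolKernel m z‖ * ((1 + z.1 ^ 2) * (1 + z.2 ^ 2)) ≤
        D * (2 * C0 + 2 * ((2 * Real.pi) ^ 4 * C4)) := by
      intro z
      rw [hker', norm_mul, ← hD, mul_assoc]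
      set v := (2 * Real.pi)⁻¹ • Complex.equivRealProdCLM.symm z with hv
      have h0 := hC0.2 v
      have h4 := hC4.2 v
      simp only [pow_zero, one_mul, norm_iteratedFDeriv_zero] at h0 h4
      gcongr
      have hz : Complex.equivRealProdCLM.symm z = (2 * Real.pi) • v := by
        rw [hv, smul_inv_smul₀ hpi]
      have hzn : z.1 ^ 2 + z.2 ^ 2 = (2 * Real.pi) ^ 2 * ‖v‖ ^ 2 := by
        have h1 : ‖Complex.equivRealProdCLM.symm z‖ ^ 2 = z.1 ^ 2 + z.2 ^ 2 := by
          rw [Complex.sq_norm, Complex.normSq_apply]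
          have : (Complex.equivRealProdCLM.symm z).re = z.1 ∧
            (Complex.equivRealProdCLM.symm z).im = z.2 := ⟨by simp, by simp⟩
          rw [this.1, this.2]
          ring
        rw [← h1, hz, norm_smul, mul_pow, Real.norm_eq_abs, sq_abs]
      have hprod : (1 + z.1 ^ 2) * (1 + z.2 ^ 2) ≤ 2 + 2 * ((2 * Real.pi) ^ 4 * ‖v‖ ^ 4) := by
        have : (2 * Real.pi) ^ 4 * ‖v‖ ^ 4 = (z.1 ^ 2 + z.2 ^ 2) ^ 2 := by rw [hzn]; ring
        rw [this]
        nlinarith [sq_nonneg (z.1 ^ 2 + z.2 ^ 2 - 1), sq_nonneg (z.1 ^ 2 - z.2 ^ 2), sq_nonneg z.1,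
          sq_nonneg z.2, mul_nonneg (sq_nonneg z.1) (sq_nonneg z.2)]
      calc ‖G v‖ * ((1 + z.1 ^ 2) * (1 + z.2 ^ 2))
          ≤ ‖G v‖ * (2 + 2 * ((2 * Real.pi) ^ 4 * ‖v‖ ^ 4)) := by gcongr
        _ = 2 * ‖G v‖ + 2 * ((2 * Real.pi) ^ 4 * (‖v‖ ^ 4 * ‖G v‖)) := by ring
        _ ≤ _ := by gcongr
    refine ⟨D * (2 * C0 + 2 * ((2 * Real.pi) ^ 4 * C4)), by positivity [hC0.1, hC4.1], fun z => ?_⟩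
    rw [← mul_inv, ← div_eq_mul_inv, le_div_iff₀ (by positivity)]
    exact hbd z
  · intro ζ
    rw [← hmp.integral_comp e.measurableEmbedding]
    have h1 := Measure.integral_comp_smul (volume : Measure ℂ)
      (fun v => cexpI (-((e v).1 * ζ.1 + (e v).2 * ζ.2)) * symbolKernel m (e v)) (2 * Real.pi)
    rw [Complex.finrank_real_complex, abs_of_pos (by positivity)] at h1
    have h2 : ∫ v : ℂ, cexpI (-((e v).1 * ζ.1 + (e v).2 * ζ.2)) * symbolKernel m (e v) =
      ((2 * Real.pi) ^ 2 : ℝ) • ∫ v : ℂ, cexpI (-((e ((2 * Real.pi) • v)).1 * ζ.1 +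
        (e ((2 * Real.pi) • v)).2 * ζ.2)) * symbolKernel m (e ((2 * Real.pi) • v)) := by
      rw [h1, smul_inv_smul₀ (by positivity)]
    rw [h2]
    simp only [hker]
    have h3 : 𝓕 G (Complex.equivRealProdCLM.symm ζ) = m ζ := by
      rw [hG, FourierTransform.fourier_fourierInv_eq]
      change m (Complex.equivRealProdCLM (Complex.equivRealProdCLM.symm ζ)) = m ζ
      rw [ContinuousLinearEquiv.apply_symm_apply]
    rw [← h3, SchwartzMap.fourier_coe, Real.fourier_eq', ← integral_smul]
    congr 1
    ext v
    simp only [smul_eq_mul, cexpI, Complex.inner, Complex.real_smul]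
    have hp2 : (((2 * Real.pi) ^ 2 : ℝ) : ℂ) ≠ 0 := by
      exact_mod_cast (by positivity : (2 * Real.pi) ^ 2 ≠ 0)
    rw [mul_left_comm, ← mul_assoc (((2 * Real.pi) ^ 2 : ℝ) : ℂ), mul_inv_cancel₀ hp2, one_mul]
    congr 2
    simp [hcoe]
    ring

theorem measurable_spaceFT {F : ℝ × ℝ × ℝ → ℂ} (hF : Measurable F) :
    Measurable (fun q : ℝ × ℝ × ℝ => spaceFT F q.1 q.2.1 q.2.2) := by
  unfold spaceFT FTxy
  apply StronglyMeasurable.measurable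
  apply StronglyMeasurable.integral_prod_right'
    (f := fun r : (ℝ × ℝ × ℝ) × (ℝ × ℝ) =>
      cexpI (-(r.2.1 * r.1.2.1 + r.2.2 * r.1.2.2)) * F (r.1.1, r.2))
  apply Measurable.stronglyMeasurable
  exact (continuous_cexpI.measurable.comp (by fun_prop)).mul (hF.comp (by fun_prop))

/-- The frequency projections of test functions are band limited. -/
theorem bandLimited_Q {m : ℝ × ℝ → ℂ} (hm : ContDiff ℝ ∞ m) (hc : HasCompactSupport m)
    {f : ℝ × ℝ × ℝ → ℂ} (hf : ContDiff ℝ ∞ f) (hfc : HasCompactSupport f) :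
    ∃ R, BandLimited R (Q m f) := by
  obtain ⟨kc, ⟨C, hC0, hC⟩, kinv⟩ := symbolKernel_facts hm hc
  have hpi : (((2 * Real.pi) ^ 2 : ℝ) : ℂ) ≠ 0 := by
    exact_mod_cast (by positivity : (2 * Real.pi) ^ 2 ≠ 0)
  have fcont := hf.continuous
  have mcont := hm.continuous
  obtain ⟨Cf, hCf⟩ := hfc.exists_bound_of_continuous fcont
  have hCf0 : 0 ≤ Cf := (norm_nonneg _).trans (hCf 0)
  obtain ⟨T, hT0, hT⟩ : ∃ T : ℝ, 0 < T ∧ ∀ p, T < ‖p‖ → f p = 0 := by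
    obtain ⟨T, hT, h⟩ := hfc.isCompact.isBounded.exists_pos_norm_le
    refine ⟨T, hT, fun p hp => ?_⟩
    by_contra hne
    exact absurd (h p (subset_tsupport f hne)) (not_le.2 hp)
  obtain ⟨T', hT'0, hT'⟩ : ∃ T : ℝ, 0 < T ∧ ∀ p, T < ‖p‖ → m p = 0 := by
    obtain ⟨T, hT, h⟩ := hc.isCompact.isBounded.exists_pos_norm_le
    refine ⟨T, hT, fun p hp => ?_⟩
    by_contra hne
    exact absurd (h p (subset_tsupport m hne)) (not_le.2 hp)
  have fsc : ∀ s, HasCompactSupport (fun z => f (s, z)) := fun s =>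
    HasCompactSupport.of_support_subset_isCompact (isCompact_closedBall (0 : ℝ × ℝ) T) (by
      intro z hz
      rw [mem_closedBall_zero_iff]
      by_contra hlt
      exact hz (hT (s, z) (lt_of_lt_of_le (not_le.1 hlt) (norm_snd_le (s, z)))))
  have fint : ∀ s, Integrable (fun z => f (s, z)) := fun s =>
    Continuous.integrable_of_hasCompactSupport (by fun_prop) (fsc s)
  have mint : Integrable m := mcont.integrable_of_hasCompactSupport hc
  have kint : Integrable (symbolKernel m) :=
    (integrable_decay.const_mul C).mono' kc.aestronglyMeasurable (ae_of_all _ hC)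
  -- the projection is the convolution with the kernel of the symbol
  have hconv : ∀ s z, Q m f (s, z) = ∫ z', f (s, z') * symbolKernel m (z - z') := by
    intro s z
    simp only [Q, multiplier, FTxy, symbolKernel]
    have e1 : ∀ ζ : ℝ × ℝ, cexpI (z.1 * ζ.1 + z.2 * ζ.2) *
        (m ζ * ∫ z' : ℝ × ℝ, cexpI (-(z'.1 * ζ.1 + z'.2 * ζ.2)) * f (s, z')) =
        ∫ z' : ℝ × ℝ, cexpI ((z - z').1 * ζ.1 + (z - z').2 * ζ.2) * (m ζ * f (s, z')) := by
      intro ζ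
      rw [← mul_assoc, ← integral_const_mul]
      congr 1
      ext z'
      rw [show (z - z').1 * ζ.1 + (z - z').2 * ζ.2 =
        (z.1 * ζ.1 + z.2 * ζ.2) + (-(z'.1 * ζ.1 + z'.2 * ζ.2)) by
          simp only [Prod.fst_sub, Prod.snd_sub]; ring,
        cexpI_add (z.1 * ζ.1 + z.2 * ζ.2) (-(z'.1 * ζ.1 + z'.2 * ζ.2))]
      ring
    simp only [e1]
    rw [integral_integral_swap, ← integral_const_mul]
    · congr 1
      ext z'
      rw [mul_left_comm, ← integral_const_mul (f (s, z'))]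
      congr 1
      refine integral_congr_ae (ae_of_all _ fun ζ => ?_)
      beta_reduce
      ring
    · have hp : Integrable (fun q : (ℝ × ℝ) × (ℝ × ℝ) => m q.1 * f (s, q.2)) :=
        mint.mul_prod (fint s)
      refine hp.norm.mono' ?_ (ae_of_all _ fun q => ?_)
      · apply Continuous.aestronglyMeasurable
        unfold Function.uncurry
        fun_prop
      · simp [Function.uncurry, norm_cexpI]
  refine ⟨max T T', ?_, ?_, ?_, ?_⟩
  · have : Q m f = fun p => ∫ z', f (p.1, z') * symbolKernel m (p.2 - z') := by
      ext ⟨s, z⟩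
      exact hconv s z
    rw [this]
    apply StronglyMeasurable.measurable
    apply StronglyMeasurable.integral_prod_right'
      (f := fun r : (ℝ × ℝ × ℝ) × (ℝ × ℝ) => f (r.1.1, r.2) * symbolKernel m (r.1.2 - r.2))
    exact Continuous.stronglyMeasurable (by fun_prop)
  · set K := 2 * (1 + T ^ 2) with hK
    refine ⟨Cf * C * K ^ 2 * volume.real (Metric.closedBall (0 : ℝ × ℝ) T), ?_⟩
    rintro ⟨s, x, y⟩
    rw [hconv]
    have hset : ∫ z', f (s, z') * symbolKernel m ((x, y) - z') =
        ∫ z' in Metric.closedBall (0 : ℝ × ℝ) T, f (s, z') * symbolKernel m ((x, y) - z') := by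
      refine (setIntegral_eq_integral_of_forall_compl_eq_zero fun z' hz' => ?_).symm
      rw [mem_closedBall_zero_iff, not_le] at hz'
      rw [hT (s, z') (hz'.trans_le (norm_snd_le (s, z'))), zero_mul]
    rw [hset]
    refine (norm_setIntegral_le_of_norm_le_const
      (C := Cf * (C * ((K * (1 + x ^ 2)⁻¹) * (K * (1 + y ^ 2)⁻¹))))
      (measure_closedBall_lt_top) fun z' hz' => ?_).trans (le_of_eq (by ring))
    rw [mem_closedBall_zero_iff] at hz'
    rw [norm_mul]
    refine mul_le_mul (hCf _) ((hC _).trans ?_) (norm_nonneg _) hCf0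
    have a1 : |z'.1| ≤ T := (norm_fst_le z').trans hz'
    have a2 : |z'.2| ≤ T := (norm_snd_le z').trans hz'
    have b1 := one_add_sq_inv_sub_le (x := x) a1
    have b2 := one_add_sq_inv_sub_le (x := y) a2
    simp only [Prod.fst_sub, Prod.snd_sub]
    gcongr
  · rintro ⟨s, z⟩ hs
    rw [hconv]
    have : ∀ z', f (s, z') = 0 := fun z' => hT _ (((le_max_left T T').trans_lt hs).trans_le
      (norm_fst_le (s, z')))
    simp [this]
  · intro s ξ μ h
    have hm0 : m (ξ, μ) = 0 := by
      apply hT'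
      rw [Prod.norm_mk]
      rcases h with h | h
      · exact lt_max_of_lt_left ((le_max_right T T').trans_lt h)
      · exact lt_max_of_lt_right ((le_max_right T T').trans_lt h)
    have hpi' := integrable_decay
    simp only [spaceFT, FTxy, hconv]
    have e1 : ∀ z : ℝ × ℝ, cexpI (-(z.1 * ξ + z.2 * μ)) *
        ∫ z', f (s, z') * symbolKernel m (z - z') =
        ∫ z', cexpI (-(z.1 * ξ + z.2 * μ)) * (f (s, z') * symbolKernel m (z - z')) := fun z => by
      rw [integral_const_mul]
    simp only [e1]
    rw [integral_integral_swap]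
    · have e2 : ∀ z' : ℝ × ℝ, ∫ z : ℝ × ℝ, cexpI (-(z.1 * ξ + z.2 * μ)) *
          (f (s, z') * symbolKernel m (z - z')) = 0 := by
        intro z'
        rw [← integral_add_right_eq_self _ z']
        have : ∀ z : ℝ × ℝ, cexpI (-((z + z').1 * ξ + (z + z').2 * μ)) *
            (f (s, z') * symbolKernel m (z + z' - z')) =
            (cexpI (-(z'.1 * ξ + z'.2 * μ)) * f (s, z')) *
              (cexpI (-(z.1 * ξ + z.2 * μ)) * symbolKernel m z) := by
          intro z
          rw [add_sub_cancel_right, show -((z + z').1 * ξ + (z + z').2 * μ) =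
            -(z'.1 * ξ + z'.2 * μ) + -(z.1 * ξ + z.2 * μ) by
              simp only [Prod.fst_add, Prod.snd_add]; ring, cexpI_add]
          ring
        simp only [this]
        rw [integral_const_mul, kinv (ξ, μ), hm0, mul_zero]
      simp only [e2, integral_zero]
    · have hp := (fint s).convolution_integrand (ContinuousLinearMap.mul ℝ ℂ) kint
      refine hp.norm.mono' ?_ (ae_of_all _ fun q => ?_)
      · apply Continuous.aestronglyMeasurable
        unfold Function.uncurry
        fun_prop
      · simp [Function.uncurry, norm_cexpI]

/-! ### Exchanging coordinates -/

theorem measurePreserving_swap12 :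
    MeasurePreserving (fun p : ℝ × ℝ × ℝ => (p.2.1, p.1, p.2.2)) volume volume := by
  have h1 : MeasurePreserving (fun p : (ℝ × ℝ) × ℝ => (p.1.1, p.1.2, p.2)) volume volume :=
    volume_preserving_prodAssoc
  have h2 : MeasurePreserving (fun p : ℝ × ℝ × ℝ => ((p.1, p.2.1), p.2.2)) volume volume :=
    volume_preserving_prodAssoc.symm MeasurableEquiv.prodAssoc
  have h3 : MeasurePreserving (fun p : (ℝ × ℝ) × ℝ => ((p.1.2, p.1.1), p.2)) volume volume :=
    (Measure.measurePreserving_swap (μ := (volume : Measure ℝ)) (ν := (volume : Measure ℝ))).prod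
      (MeasurePreserving.id (volume : Measure ℝ))
  exact h1.comp (h3.comp h2)

theorem measurePreserving_swap23 :
    MeasurePreserving (fun p : ℝ × ℝ × ℝ => (p.1, p.2.2, p.2.1)) volume volume :=
  (MeasurePreserving.id (volume : Measure ℝ)).prod
    (Measure.measurePreserving_swap (μ := (volume : Measure ℝ)) (ν := (volume : Measure ℝ)))

/-- Exchange of the first two coordinates. -/
def swap12 : (ℝ × ℝ × ℝ) ≃ᵐ (ℝ × ℝ × ℝ) where
  toFun p := (p.2.1, p.1, p.2.2)
  invFun p := (p.2.1, p.1, p.2.2)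
  left_inv _ := rfl
  right_inv _ := rfl
  measurable_toFun := by
    change Measurable fun p : ℝ × ℝ × ℝ => (p.2.1, p.1, p.2.2)
    fun_prop
  measurable_invFun := by
    change Measurable fun p : ℝ × ℝ × ℝ => (p.2.1, p.1, p.2.2)
    fun_prop

/-- Exchange of the last two coordinates. -/
def swap23 : (ℝ × ℝ × ℝ) ≃ᵐ (ℝ × ℝ × ℝ) where
  toFun p := (p.1, p.2.2, p.2.1)
  invFun p := (p.1, p.2.2, p.2.1)
  left_inv _ := rfl
  right_inv _ := rfl
  measurable_toFun := by
    change Measurable fun p : ℝ × ℝ × ℝ => (p.1, p.2.2, p.2.1)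
    fun_prop
  measurable_invFun := by
    change Measurable fun p : ℝ × ℝ × ℝ => (p.1, p.2.2, p.2.1)
    fun_prop

theorem integral_swap23 (g : ℝ × ℝ × ℝ → ℂ) :
    ∫ p : ℝ × ℝ × ℝ, g (p.1, p.2.2, p.2.1) = ∫ p, g p :=
  MeasurePreserving.integral_comp' (f := swap23) measurePreserving_swap23 g

theorem integrable_swap12 {g : ℝ × ℝ × ℝ → ℂ} (hg : Integrable g) :
    Integrable (fun p : ℝ × ℝ × ℝ => g (p.2.1, p.1, p.2.2)) :=
  (measurePreserving_swap12.integrable_comp_emb swap12.measurableEmbedding).2 hg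

/-- Fubini's theorem with the middle variable integrated last. -/
theorem integral_eq_integral_mid {g : ℝ × ℝ × ℝ → ℂ} (hg : Integrable g) :
    ∫ p, g p = ∫ x : ℝ, ∫ z : ℝ × ℝ, g (z.1, x, z.2) := by
  rw [← MeasurePreserving.integral_comp' (f := swap12) measurePreserving_swap12 g]
  exact integral_prod _ (integrable_swap12 hg)

/-- Fubini's theorem with the middle variable integrated first. -/
theorem integral_eq_integral_integral_mid {g : ℝ × ℝ × ℝ → ℂ} (hg : Integrable g) :
    ∫ p, g p = ∫ z : ℝ × ℝ, ∫ x : ℝ, g (z.1, x, z.2) := by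
  rw [← MeasurePreserving.integral_comp' (f := swap12) measurePreserving_swap12 g]
  exact integral_prod_symm _ (integrable_swap12 hg)

theorem integrable_of_bounded_of_eq_zero {X : Type*} [NormedAddCommGroup X] [ProperSpace X]
    [MeasurableSpace X] [OpensMeasurableSpace X] {μ : Measure X} [IsFiniteMeasureOnCompacts μ]
    {J : X → ℂ} (hm : Measurable J) {C R : ℝ} (hC : ∀ q, ‖J q‖ ≤ C)
    (hR : ∀ q, R < ‖q‖ → J q = 0) : Integrable J μ := by
  have h1 : IntegrableOn J (Metric.closedBall (0 : X) R) μ := by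
    refine Measure.integrableOn_of_bounded (M := C) ?_ hm.aestronglyMeasurable
      (ae_of_all _ hC)
    exact (isCompact_closedBall (0 : X) R).measure_lt_top.ne
  have hs : MeasurableSet (Metric.closedBall (0 : X) R) := Metric.isClosed_closedBall.measurableSet
  rw [← integrable_indicator_iff hs] at h1
  have he : (Metric.closedBall (0 : X) R).indicator J = J := by
    refine indicator_eq_self.2 fun q hq => ?_
    rw [mem_closedBall_zero_iff]
    by_contra h
    exact hq (hR q (not_le.1 h))
  rwa [he] at h1

theorem memLp_two_of_bounded {X : Type*} [MeasurableSpace X] {μ : Measure X} {g : X → ℂ}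
    (hg : Integrable g μ) {C : ℝ} (hC : ∀ x, ‖g x‖ ≤ C) : MemLp g 2 μ := by
  rw [memLp_two_iff_integrable_sq_norm hg.1]
  refine (hg.norm.const_mul C).mono' (hg.1.norm.pow 2) (ae_of_all _ fun x => ?_)
  rw [Real.norm_eq_abs, abs_of_nonneg (by positivity), sq]
  exact mul_le_mul_of_nonneg_right (hC x) (norm_nonneg _)

/-! ### Transforms of band limited functions -/

namespace BandLimited
variable {R : ℝ} {F : ℝ × ℝ × ℝ → ℂ}

theorem decay' (hF : BandLimited R F) :
    ∃ C, 0 ≤ C ∧ ∀ p, ‖F p‖ ≤ (Icc (-R) R).indicator (fun _ => C) p.1 *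
      ((1 + p.2.1 ^ 2)⁻¹ * (1 + p.2.2 ^ 2)⁻¹) := by
  obtain ⟨C, hC⟩ := hF.decay
  have hC0 : 0 ≤ C := by simpa using (norm_nonneg _).trans (hC 0)
  refine ⟨C, hC0, fun p => ?_⟩
  by_cases h : p.1 ∈ Icc (-R) R
  · rw [indicator_of_mem h]
    exact hC p
  · rw [hF.eq_zero p, norm_zero, indicator_of_notMem h, zero_mul]
    rwa [mem_Icc, ← abs_le, not_le] at h

theorem integrable_indicator (R C : ℝ) :
    Integrable ((Icc (-R) R).indicator fun _ : ℝ => C) := by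
  rw [integrable_indicator_iff measurableSet_Icc]
  simp

theorem integrable (hF : BandLimited R F) : Integrable F := by
  obtain ⟨C, hC0, hC⟩ := hF.decay'
  exact ((integrable_indicator R C).mul_prod integrable_decay).mono'
    hF.measurable.aestronglyMeasurable (ae_of_all _ hC)

theorem bounded (hF : BandLimited R F) : ∃ C, ∀ p, ‖F p‖ ≤ C := by
  obtain ⟨C, hC⟩ := hF.decay
  have hC0 : 0 ≤ C := by simpa using (norm_nonneg _).trans (hC 0)
  refine ⟨C, fun p => (hC p).trans ?_⟩
  have h1 : (1 + p.2.1 ^ 2)⁻¹ ≤ 1 := inv_le_one_of_one_le₀ (by nlinarith [sq_nonneg p.2.1])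
  have h2 : (1 + p.2.2 ^ 2)⁻¹ ≤ 1 := inv_le_one_of_one_le₀ (by nlinarith [sq_nonneg p.2.2])
  have h3 : (1 + p.2.1 ^ 2)⁻¹ * (1 + p.2.2 ^ 2)⁻¹ ≤ 1 := mul_le_one₀ h1 (by positivity) h2
  nlinarith

theorem integrable_slice (hF : BandLimited R F) (x : ℝ) :
    Integrable (fun z : ℝ × ℝ => F (z.1, x, z.2)) := by
  obtain ⟨C, hC0, hC⟩ := hF.decay'
  have hd : Integrable (fun z : ℝ × ℝ => (Icc (-R) R).indicator (fun _ => C) z.1 *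
      (1 + z.2 ^ 2)⁻¹) := (integrable_indicator R C).mul_prod integrable_inv_one_add_sq
  refine (hd.const_mul (1 + x ^ 2)⁻¹).mono'
    (hF.measurable.comp (by fun_prop)).aestronglyMeasurable (ae_of_all _ fun z => ?_)
  refine (hC _).trans (le_of_eq ?_)
  ring

theorem memLp_slice (hF : BandLimited R F) (x : ℝ) :
    MemLp (fun z : ℝ × ℝ => F (z.1, x, z.2)) 2 := by
  obtain ⟨C, hC⟩ := hF.bounded
  exact memLp_two_of_bounded (hF.integrable_slice x) fun z => hC _

theorem measurable_FTty (hF : BandLimited R F) :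
    Measurable (fun q : ℝ × ℝ × ℝ => FTty F q.1 q.2.1 q.2.2) := by
  unfold FTty
  apply StronglyMeasurable.measurable
  apply StronglyMeasurable.integral_prod_right'
    (f := fun r : (ℝ × ℝ × ℝ) × (ℝ × ℝ) =>
      cexpI (-(r.2.1 * r.1.1 + r.2.2 * r.1.2.2)) * F (r.2.1, r.1.2.1, r.2.2))
  apply Measurable.stronglyMeasurable
  exact (continuous_cexpI.measurable.comp (by fun_prop)).mul (hF.measurable.comp (by fun_prop))

theorem integrable_FTty (hF : BandLimited R F) (τ μ : ℝ) :
    Integrable (fun x => FTty F τ x μ) := by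
  obtain ⟨C, hC0, hC⟩ := hF.decay'
  have hd : Integrable (fun z : ℝ × ℝ => (Icc (-R) R).indicator (fun _ => C) z.1 *
      (1 + z.2 ^ 2)⁻¹) := (integrable_indicator R C).mul_prod integrable_inv_one_add_sq
  refine (integrable_inv_one_add_sq.const_mul (∫ z : ℝ × ℝ,
    (Icc (-R) R).indicator (fun _ => C) z.1 *
      (1 + z.2 ^ 2)⁻¹)).mono' (hF.measurable_FTty.comp (by fun_prop :
        Measurable fun x : ℝ => (τ, x, μ))).aestronglyMeasurable (ae_of_all _ fun x => ?_)
  rw [FTty, mul_comm, ← integral_const_mul]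
  refine norm_integral_le_of_norm_le (hd.const_mul _) (ae_of_all _ fun z => ?_)
  rw [norm_mul, norm_cexpI, one_mul]
  refine (hC _).trans (le_of_eq ?_)
  ring

theorem spaceFT_bounded (hF : BandLimited R F) : ∃ C, 0 ≤ C ∧ ∀ s ξ μ, ‖spaceFT F s ξ μ‖ ≤ C := by
  obtain ⟨C, hC⟩ := hF.decay
  refine ⟨∫ z : ℝ × ℝ, C * ((1 + z.1 ^ 2)⁻¹ * (1 + z.2 ^ 2)⁻¹), ?_, fun s ξ μ => ?_⟩
  · have hC0 : 0 ≤ C := by simpa using (norm_nonneg _).trans (hC 0)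
    exact integral_nonneg fun z => by positivity
  · refine norm_integral_le_of_norm_le (integrable_decay.const_mul C) (ae_of_all _ fun z => ?_)
    rw [norm_mul, norm_cexpI, one_mul]
    exact hC _

theorem spaceFT_eq_zero' (hF : BandLimited R F) (q : ℝ × ℝ × ℝ) (hq : R < ‖q‖) :
    spaceFT F q.1 q.2.1 q.2.2 = 0 := by
  rw [Prod.norm_def, Prod.norm_def, lt_max_iff, lt_max_iff] at hq
  rcases hq with h | h
  · have : ∀ z, F (q.1, z) = 0 := fun z => hF.eq_zero _ h
    simp [spaceFT, FTxy, this]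
  · exact hF.spaceFT_eq_zero _ _ _ h

/-- The space-time transform is the transform in time of `spaceFT`. -/
theorem FTtxy_eq (hF : BandLimited R F) (τ ξ μ : ℝ) :
    FTtxy F τ ξ μ = ∫ s : ℝ, cexpI (-(s * τ)) * spaceFT F s ξ μ := by
  have hi : Integrable (fun p : ℝ × ℝ × ℝ => cexpI (-(p.1 * τ + p.2.1 * ξ + p.2.2 * μ)) * F p) := by
    refine hF.integrable.norm.mono' ?_ (ae_of_all _ fun p => ?_)
    · exact (Continuous.aestronglyMeasurable (by fun_prop)).mul hF.integrable.1
    · simp [norm_cexpI]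
  rw [FTtxy]
  refine (integral_prod _ hi).trans ?_
  congr 1
  ext s
  rw [spaceFT, FTxy, ← integral_const_mul]
  congr 1
  ext z
  rw [← mul_assoc, ← cexpI_add]
  congr 2
  ring

/-- The space-time transform is the transform in `x` of `FTty`. -/
theorem FTtxy_eq' (hF : BandLimited R F) (τ ξ μ : ℝ) :
    FTtxy F τ ξ μ = ∫ x : ℝ, cexpI (-(x * ξ)) * FTty F τ x μ := by
  have hi : Integrable (fun p : ℝ × ℝ × ℝ => cexpI (-(p.1 * τ + p.2.1 * ξ + p.2.2 * μ)) * F p) := by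
    refine hF.integrable.norm.mono' ?_ (ae_of_all _ fun p => ?_)
    · exact (Continuous.aestronglyMeasurable (by fun_prop)).mul hF.integrable.1
    · simp [norm_cexpI]
  rw [FTtxy, integral_eq_integral_mid hi]
  congr 1
  ext x
  rw [FTty, ← integral_const_mul]
  congr 1
  ext z
  rw [← mul_assoc, ← cexpI_add]
  congr 2
  ring

theorem measurable_FTtxy (hF : BandLimited R F) :
    Measurable (fun q : ℝ × ℝ × ℝ => FTtxy F q.1 q.2.1 q.2.2) := by
  unfold FTtxy
  apply StronglyMeasurable.measurable
  apply StronglyMeasurable.integral_prod_right'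
    (f := fun r : (ℝ × ℝ × ℝ) × (ℝ × ℝ × ℝ) =>
      cexpI (-(r.2.1 * r.1.1 + r.2.2.1 * r.1.2.1 + r.2.2.2 * r.1.2.2)) * F r.2)
  apply Measurable.stronglyMeasurable
  exact (continuous_cexpI.measurable.comp (by fun_prop)).mul (hF.measurable.comp (by fun_prop))

theorem FTtxy_bounded (hF : BandLimited R F) : ∃ C, ∀ τ ξ μ, ‖FTtxy F τ ξ μ‖ ≤ C := by
  refine ⟨∫ p, ‖F p‖, fun τ ξ μ => norm_integral_le_of_norm_le hF.integrable.norm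
    (ae_of_all _ fun p => ?_)⟩
  simp [norm_cexpI]

theorem FTtxy_eq_zero (hF : BandLimited R F) (τ ξ μ : ℝ) (h : R < |ξ| ∨ R < |μ|) :
    FTtxy F τ ξ μ = 0 := by
  rw [hF.FTtxy_eq]
  simp [hF.spaceFT_eq_zero _ _ _ h]

/-- Multiplication by functions of time preserves band limitation in space. -/
theorem time_mul (hF : BandLimited R F) {β : ℝ → ℂ} (hβ : Measurable β) (h1 : ∀ s, ‖β s‖ ≤ 1) :
    BandLimited R (fun p => β p.1 * F p) where
  measurable := (hβ.comp measurable_fst).mul hF.measurable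
  decay := by
    obtain ⟨C, hC⟩ := hF.decay
    refine ⟨C, fun p => ?_⟩
    rw [norm_mul]
    exact (mul_le_of_le_one_left (norm_nonneg _) (h1 _)).trans (hC p)
  eq_zero p hp := by rw [hF.eq_zero p hp, mul_zero]
  spaceFT_eq_zero s ξ μ h := by
    have : spaceFT (fun p => β p.1 * F p) s ξ μ = β s * spaceFT F s ξ μ := by
      simp only [spaceFT, FTxy]
      rw [← integral_const_mul]
      congr 1
      ext z
      ring
    rw [this, hF.spaceFT_eq_zero s ξ μ h, mul_zero]

end BandLimited

theorem spaceFT_time_mul (F : ℝ × ℝ × ℝ → ℂ) (β : ℝ → ℂ) (s ξ μ : ℝ) :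
    spaceFT (fun p => β p.1 * F p) s ξ μ = β s * spaceFT F s ξ μ := by
  simp only [spaceFT, FTxy]
  rw [← integral_const_mul]
  congr 1
  ext z
  ring

/-- Multiplication by an integrable function of `ξ` on the Fourier side is a convolution in `x`. -/
theorem integral_cexpI_mul_FTtxy {R : ℝ} {F : ℝ × ℝ × ℝ → ℂ} (hF : BandLimited R F) {k : ℝ → ℂ}
    (hk : Integrable k) (τ x μ : ℝ) :
    ∫ ξ, cexpI (x * ξ) * (k ξ * FTtxy F τ ξ μ) =
      ∫ x', (∫ ξ, cexpI ((x - x') * ξ) * k ξ) * FTty F τ x' μ := by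
  have e1 : ∀ ξ, cexpI (x * ξ) * (k ξ * FTtxy F τ ξ μ) =
      ∫ x', cexpI ((x - x') * ξ) * k ξ * FTty F τ x' μ := by
    intro ξ
    rw [hF.FTtxy_eq', ← integral_const_mul, ← integral_const_mul]
    congr 1
    ext x'
    rw [show (x - x') * ξ = x * ξ + -(x' * ξ) by ring, cexpI_add]
    ring
  simp only [e1]
  rw [integral_integral_swap]
  · congr 1
    ext x'
    rw [← integral_mul_const]
  · have := hk.mul_prod (hF.integrable_FTty τ μ)
    refine this.norm.mono' ?_ (ae_of_all _ fun q => ?_)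
    · have h1 : AEStronglyMeasurable (fun q : ℝ × ℝ => cexpI ((x - q.2) * q.1))
          (volume.prod volume) := Continuous.aestronglyMeasurable (by fun_prop)
      have h2 := h1.mul this.1
      refine h2.congr (ae_of_all _ fun q => ?_)
      simp [Function.uncurry, mul_assoc]
    · simp [Function.uncurry, norm_cexpI]

/-! ### Oscillatory integrals in space -/

theorem hasDerivAt_cexpI_mul (a s : ℝ) :
    HasDerivAt (fun s : ℝ => cexpI (s * a)) (cexpI (s * a) * (Complex.I * a)) s := by
  have h : HasDerivAt (fun s : ℝ => Complex.I * ((s * a : ℝ) : ℂ)) (Complex.I * a) s := by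
    have := ((hasDerivAt_id s).mul_const a).ofReal_comp.const_mul Complex.I
    simpa using this
  exact h.cexp

/-- Differentiation under the integral multiplies the amplitude by `i` times the frequency. -/
theorem hasDerivAt_integral_cexpI {X : Type*} [MeasurableSpace X] {μ : Measure X} {l : X → ℝ}
    (hl : Measurable l) {J : X → ℂ} (hJ : Integrable J μ)
    (hlJ : Integrable (fun q => (l q : ℂ) * J q) μ) (s : ℝ) :
    HasDerivAt (fun s => ∫ q, cexpI (s * l q) * J q ∂μ)
      (∫ q, cexpI (s * l q) * (Complex.I * l q * J q) ∂μ) s := by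
  have hm : ∀ s, Measurable fun q => cexpI (s * l q) := fun s =>
    measurable_cexpI.comp (hl.const_mul s)
  refine (hasDerivAt_integral_of_dominated_loc_of_deriv_le (s := univ)
    (F := fun s q => cexpI (s * l q) * J q)
    (F' := fun s q => cexpI (s * l q) * (Complex.I * l q * J q))
    (bound := fun q => ‖(l q : ℂ) * J q‖) univ_mem
    (Eventually.of_forall fun s => (hm s).aestronglyMeasurable.mul hJ.1) ?_ ?_
    (ae_of_all _ fun q s _ => ?_) hlJ.norm (ae_of_all _ fun q s _ => ?_)).2
  · exact hJ.norm.mono' ((hm s).aestronglyMeasurable.mul hJ.1)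
      (ae_of_all _ fun q => by simp [norm_cexpI])
  · refine (hm s).aestronglyMeasurable.mul ((hlJ.1.const_mul Complex.I).congr
      (ae_of_all _ fun q => ?_))
    exact (mul_assoc _ _ _).symm
  · simp [norm_cexpI]
  · have := (hasDerivAt_cexpI_mul (l q) s).mul_const (J q)
    rwa [mul_assoc] at this

/-- Integrals of characters against a boundedly supported amplitude are smooth, as they are Fourier
integrals for the pairing of `z` with the last two coordinates of `q`. -/
theorem contDiff_integral_cexpI {J : ℝ × ℝ × ℝ → ℂ} (hJ : Integrable J) {R : ℝ}
    (hR : ∀ q, R < ‖q‖ → J q = 0) :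
    ContDiff ℝ 2 (fun z : ℝ × ℝ => ∫ q : ℝ × ℝ × ℝ, cexpI (z.1 * q.2.1 + z.2 * q.2.2) * J q) := by
  let L1 : (ℝ × ℝ × ℝ) →L[ℝ] ℝ :=
    (ContinuousLinearMap.fst ℝ ℝ ℝ).comp (ContinuousLinearMap.snd ℝ ℝ (ℝ × ℝ))
  let L2 : (ℝ × ℝ × ℝ) →L[ℝ] ℝ :=
    (ContinuousLinearMap.snd ℝ ℝ ℝ).comp (ContinuousLinearMap.snd ℝ ℝ (ℝ × ℝ))
  let L : (ℝ × ℝ × ℝ) →L[ℝ] (ℝ × ℝ) →L[ℝ] ℝ :=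
    (-(2 * Real.pi)⁻¹) • (L1.smulRight (ContinuousLinearMap.fst ℝ ℝ ℝ) +
      L2.smulRight (ContinuousLinearMap.snd ℝ ℝ ℝ))
  have h := VectorFourier.contDiff_fourierIntegral L (f := J) (μ := volume) (N := 2) (fun n _ => by
    refine (hJ.norm.const_mul (max R 0 ^ n)).mono'
      ((continuous_norm.pow n).aestronglyMeasurable.mul hJ.1.norm) (ae_of_all _ fun q => ?_)
    rw [norm_mul, norm_norm, norm_pow, norm_norm]
    by_cases hq : R < ‖q‖
    · simp [hR q hq]
    · gcongr
      exact (not_lt.1 hq).trans (le_max_left _ _))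
  suffices he : (fun z : ℝ × ℝ => ∫ q : ℝ × ℝ × ℝ, cexpI (z.1 * q.2.1 + z.2 * q.2.2) * J q) =
      VectorFourier.fourierIntegral Real.fourierChar volume L.toLinearMap₁₂ J by
    rw [he]
    exact h
  funext z
  simp only [VectorFourier.fourierIntegral, Circle.smul_def, Real.fourierChar_apply, smul_eq_mul]
  congr 1
  ext q
  rw [cexpI]
  congr 2
  have hL : L q z = -(2 * Real.pi)⁻¹ * (q.2.1 * z.1 + q.2.2 * z.2) := by
    simp [L, L1, L2]
    ring
  change _ = ((2 * Real.pi * -(L q z) : ℝ) : ℂ) * Complex.I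
  rw [hL]
  have : (Real.pi : ℂ) ≠ 0 := by exact_mod_cast Real.pi_ne_zero
  push_cast
  field_simp

/-! ### The evolution operators -/

/-- Measurable functions of two real variables that are bounded on bounded sets. -/
structure LocBounded {E : Type*} [NormedAddCommGroup E] [MeasurableSpace E] (w : ℝ → ℝ → E) :
    Prop where
  measurable : Measurable (fun q : ℝ × ℝ => w q.1 q.2)
  bound : ∀ R, ∃ C, ∀ ξ μ, |ξ| ≤ R → |μ| ≤ R → ‖w ξ μ‖ ≤ C

/-- Bounded measurable functions of two real variables. -/
structure Bounded₂ (κ : ℝ → ℝ → ℂ) : Prop where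
  measurable : Measurable (fun q : ℝ × ℝ => κ q.1 q.2)
  bound : ∃ C, ∀ t s, ‖κ t s‖ ≤ C

/-- The operator `F ↦ ∫ κ(t, s) e^{i(t-s)φ(D)} w(D) F(s) ds` (without the factor `(2π)^{-2}`), where
`φ(D)` and `w(D)` are Fourier multipliers in space. The integration variable is `q = (s, ξ, μ)`. -/
def evolution (φ : ℝ → ℝ → ℝ) (w : ℝ → ℝ → ℂ) (κ : ℝ → ℝ → ℂ) (F : ℝ × ℝ × ℝ → ℂ)
    (p : ℝ × ℝ × ℝ) : ℂ :=
  ∫ q : ℝ × ℝ × ℝ, cexpI (p.2.1 * q.2.1 + p.2.2 * q.2.2) *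
    (cexpI ((p.1 - q.1) * φ q.2.1 q.2.2) * κ p.1 q.1 *
      (w q.2.1 q.2.2 * spaceFT F q.1 q.2.1 q.2.2))

section
variable {φ : ℝ → ℝ → ℝ} {w : ℝ → ℝ → ℂ} {κ : ℝ → ℝ → ℂ} {F : ℝ × ℝ × ℝ → ℂ} {R : ℝ}

theorem LocBounded.mul_spaceFT (hw : LocBounded w) (hF : BandLimited R F) :
    Measurable (fun q : ℝ × ℝ × ℝ => w q.2.1 q.2.2 * spaceFT F q.1 q.2.1 q.2.2) ∧
    (∃ C, 0 ≤ C ∧ ∀ q : ℝ × ℝ × ℝ, ‖w q.2.1 q.2.2 * spaceFT F q.1 q.2.1 q.2.2‖ ≤ C) ∧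
    ∀ q : ℝ × ℝ × ℝ, R < ‖q‖ → w q.2.1 q.2.2 * spaceFT F q.1 q.2.1 q.2.2 = 0 := by
  refine ⟨(hw.measurable.comp measurable_snd).mul (measurable_spaceFT hF.measurable), ?_,
    fun q hq => by rw [hF.spaceFT_eq_zero' q hq, mul_zero]⟩
  obtain ⟨C, hC⟩ := hw.bound R
  obtain ⟨D, hD0, hD⟩ := hF.spaceFT_bounded
  refine ⟨|C| * D, by positivity, fun q => ?_⟩
  by_cases h : R < |q.2.1| ∨ R < |q.2.2|
  · rw [hF.spaceFT_eq_zero _ _ _ h, mul_zero, norm_zero]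
    positivity
  · push Not at h
    rw [norm_mul]
    exact mul_le_mul ((hC _ _ h.1 h.2).trans (le_abs_self C)) (hD _ _ _) (norm_nonneg _)
      (abs_nonneg C)

theorem LocBounded.integrable_mul_spaceFT (hw : LocBounded w) (hF : BandLimited R F) :
    Integrable (fun q : ℝ × ℝ × ℝ => w q.2.1 q.2.2 * spaceFT F q.1 q.2.1 q.2.2) := by
  obtain ⟨h1, ⟨C, -, h2⟩, h3⟩ := hw.mul_spaceFT hF
  exact integrable_of_bounded_of_eq_zero h1 h2 h3

theorem measurable_evolution_factor (hφ : LocBounded φ) (hκ : Bounded₂ κ) :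
    Measurable (fun r : ℝ × ℝ × ℝ × ℝ =>
      cexpI ((r.1 - r.2.1) * φ r.2.2.1 r.2.2.2) * κ r.1 r.2.1) := by
  have h1 : Measurable fun r : ℝ × ℝ × ℝ × ℝ => φ r.2.2.1 r.2.2.2 :=
    hφ.measurable.comp measurable_snd.snd
  have h2 : Measurable fun r : ℝ × ℝ × ℝ × ℝ => κ r.1 r.2.1 :=
    hκ.measurable.comp (measurable_fst.prodMk measurable_snd.fst)
  exact (measurable_cexpI.comp ((measurable_fst.sub measurable_snd.fst).mul h1)).mul h2

theorem integrable_evolution (hφ : LocBounded φ) (hw : LocBounded w) (hκ : Bounded₂ κ)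
    (hF : BandLimited R F) (t : ℝ) :
    Integrable (fun q : ℝ × ℝ × ℝ => cexpI ((t - q.1) * φ q.2.1 q.2.2) * κ t q.1 *
      (w q.2.1 q.2.2 * spaceFT F q.1 q.2.1 q.2.2)) := by
  obtain ⟨C, hC⟩ := hκ.bound
  refine (hw.integrable_mul_spaceFT hF).bdd_mul (c := C)
    ((measurable_evolution_factor hφ hκ).comp measurable_prodMk_left).aestronglyMeasurable
    (ae_of_all _ fun q => ?_)
  simpa [norm_cexpI] using hC t q.1

theorem measurable_evolution (hφ : LocBounded φ) (hw : LocBounded w) (hκ : Bounded₂ κ)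
    (hF : BandLimited R F) : Measurable (evolution φ w κ F) := by
  have h1 : Measurable fun r : (ℝ × ℝ × ℝ) × (ℝ × ℝ × ℝ) =>
      cexpI ((r.1.1 - r.2.1) * φ r.2.2.1 r.2.2.2) * κ r.1.1 r.2.1 := by
    have hg : Measurable fun r : (ℝ × ℝ × ℝ) × (ℝ × ℝ × ℝ) => (r.1.1, r.2) := by fun_prop
    have h0 := (measurable_evolution_factor hφ hκ).comp hg
    exact h0
  have h2 : Measurable fun r : (ℝ × ℝ × ℝ) × (ℝ × ℝ × ℝ) =>
      w r.2.2.1 r.2.2.2 * spaceFT F r.2.1 r.2.2.1 r.2.2.2 :=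
    (hw.mul_spaceFT hF).1.comp measurable_snd
  have h3 : Measurable fun r : (ℝ × ℝ × ℝ) × (ℝ × ℝ × ℝ) =>
      cexpI (r.1.2.1 * r.2.2.1 + r.1.2.2 * r.2.2.2) := by fun_prop
  exact (h3.mul (h1.mul h2)).stronglyMeasurable.integral_prod_right'.measurable

theorem spaceC2_evolution (hφ : LocBounded φ) (hw : LocBounded w) (hκ : Bounded₂ κ)
    (hF : BandLimited R F) : SpaceC2 (evolution φ w κ F) := by
  intro t
  refine contDiff_integral_cexpI (integrable_evolution hφ hw hκ hF t) (R := R) fun q hq => ?_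
  rw [(hw.mul_spaceFT hF).2.2 q hq, mul_zero]

theorem LocBounded.fst_mul (hw : LocBounded w) :
    LocBounded (fun ξ μ => Complex.I * (ξ : ℂ) * w ξ μ) where
  measurable := by
    have := hw.measurable
    fun_prop
  bound S := by
    obtain ⟨C, hC⟩ := hw.bound S
    refine ⟨S * C, fun ξ μ h1 h2 => ?_⟩
    have := hC ξ μ h1 h2
    simp only [norm_mul, Complex.norm_I, one_mul, Complex.norm_real, Real.norm_eq_abs]
    gcongr
    exact (abs_nonneg _).trans h1

theorem LocBounded.snd_mul (hw : LocBounded w) :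
    LocBounded (fun ξ μ => Complex.I * (μ : ℂ) * w ξ μ) where
  measurable := by
    have := hw.measurable
    fun_prop
  bound S := by
    obtain ⟨C, hC⟩ := hw.bound S
    refine ⟨S * C, fun ξ μ h1 h2 => ?_⟩
    have := hC ξ μ h1 h2
    simp only [norm_mul, Complex.norm_I, one_mul, Complex.norm_real, Real.norm_eq_abs]
    gcongr
    exact (abs_nonneg _).trans h1

theorem dx_evolution (hφ : LocBounded φ) (hw : LocBounded w) (hκ : Bounded₂ κ)
    (hF : BandLimited R F) :
    dx (evolution φ w κ F) = evolution φ (fun ξ μ => Complex.I * (ξ : ℂ) * w ξ μ) κ F := by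
  ext ⟨t, x, y⟩
  have hi := integrable_evolution hφ hw hκ hF t
  have hi' := integrable_evolution hφ hw.fst_mul hκ hF t
  set J : ℝ × ℝ × ℝ → ℂ := fun q => cexpI ((t - q.1) * φ q.2.1 q.2.2) * κ t q.1 *
      (w q.2.1 q.2.2 * spaceFT F q.1 q.2.1 q.2.2) with hJ
  have hc : Measurable fun q : ℝ × ℝ × ℝ => cexpI (y * q.2.2) := by fun_prop
  have hd := hasDerivAt_integral_cexpI (μ := volume) (l := fun q : ℝ × ℝ × ℝ => q.2.1)
    (J := fun q => cexpI (y * q.2.2) * J q) (by fun_prop)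
    (hi.bdd_mul (c := 1) hc.aestronglyMeasurable (ae_of_all _ fun q => (norm_cexpI _).le))
    (((hi'.bdd_mul (c := 1) hc.aestronglyMeasurable
      (ae_of_all _ fun q => (norm_cexpI _).le)).const_mul (-Complex.I)).congr
      (ae_of_all _ fun q => by
        simp only [hJ]
        linear_combination (-(q.2.1 : ℂ) * (cexpI (y * q.2.2) *
          (cexpI ((t - q.1) * φ q.2.1 q.2.2) * κ t q.1 *
          (w q.2.1 q.2.2 * spaceFT F q.1 q.2.1 q.2.2)))) * Complex.I_mul_I)) x
  refine Eq.trans ?_ (hd.deriv.trans ?_)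
  · simp only [dx, evolution, cexpI_add, hJ, mul_assoc]
  · simp only [evolution, cexpI_add, hJ]
    refine integral_congr_ae (ae_of_all _ fun q => ?_)
    beta_reduce
    ring

theorem dy_evolution (hφ : LocBounded φ) (hw : LocBounded w) (hκ : Bounded₂ κ)
    (hF : BandLimited R F) :
    dy (evolution φ w κ F) = evolution φ (fun ξ μ => Complex.I * (μ : ℂ) * w ξ μ) κ F := by
  ext ⟨t, x, y⟩
  have hi := integrable_evolution hφ hw hκ hF t
  have hi' := integrable_evolution hφ hw.snd_mul hκ hF t
  set J : ℝ × ℝ × ℝ → ℂ := fun q => cexpI ((t - q.1) * φ q.2.1 q.2.2) * κ t q.1 *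
      (w q.2.1 q.2.2 * spaceFT F q.1 q.2.1 q.2.2) with hJ
  have hc : Measurable fun q : ℝ × ℝ × ℝ => cexpI (x * q.2.1) := by fun_prop
  have hd := hasDerivAt_integral_cexpI (μ := volume) (l := fun q : ℝ × ℝ × ℝ => q.2.2)
    (J := fun q => cexpI (x * q.2.1) * J q) (by fun_prop)
    (hi.bdd_mul (c := 1) hc.aestronglyMeasurable (ae_of_all _ fun q => (norm_cexpI _).le))
    (((hi'.bdd_mul (c := 1) hc.aestronglyMeasurable
      (ae_of_all _ fun q => (norm_cexpI _).le)).const_mul (-Complex.I)).congr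
      (ae_of_all _ fun q => by
        simp only [hJ]
        linear_combination (-(q.2.2 : ℂ) * (cexpI (x * q.2.1) *
          (cexpI ((t - q.1) * φ q.2.1 q.2.2) * κ t q.1 *
          (w q.2.1 q.2.2 * spaceFT F q.1 q.2.1 q.2.2)))) * Complex.I_mul_I)) y
  refine Eq.trans ?_ (hd.deriv.trans ?_)
  · simp only [dy, evolution, cexpI_add, hJ, mul_assoc, mul_left_comm]
  · simp only [evolution, cexpI_add, hJ]
    refine integral_congr_ae (ae_of_all _ fun q => ?_)
    beta_reduce
    ring

theorem ae_fst_ne (t : ℝ) : ∀ᵐ q : ℝ × ℝ × ℝ, q.1 ≠ t := by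
  have h : ∀ᵐ s : ℝ, s ≠ t := Measure.ae_ne volume t
  exact Measure.quasiMeasurePreserving_fst.ae h

/-- The evolution depends continuously on its time kernel. -/
theorem tendsto_evolution (hφ : LocBounded φ) (hw : LocBounded w) (hF : BandLimited R F)
    {ι : Type*} {l : Filter ι} [l.IsCountablyGenerated] {κs : ι → ℝ → ℝ → ℂ} {C : ℝ}
    (hκs : ∀ᶠ n in l, Measurable (fun q : ℝ × ℝ => κs n q.1 q.2) ∧ ∀ t s, ‖κs n t s‖ ≤ C)
    (hlim : ∀ t s, s ≠ t → Tendsto (fun n => κs n t s) l (𝓝 (κ t s))) (p : ℝ × ℝ × ℝ) :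
    Tendsto (fun n => evolution φ w (κs n) F p) l (𝓝 (evolution φ w κ F p)) := by
  have hi := hw.integrable_mul_spaceFT hF
  refine tendsto_integral_filter_of_dominated_convergence
    (fun q => C * ‖w q.2.1 q.2.2 * spaceFT F q.1 q.2.1 q.2.2‖) ?_ ?_ (hi.norm.const_mul C) ?_
  · filter_upwards [hκs] with n hn
    refine (Continuous.aestronglyMeasurable (by fun_prop)).mul
      (integrable_evolution hφ hw ⟨hn.1, C, hn.2⟩ hF p.1).1
  · filter_upwards [hκs] with n hn
    refine ae_of_all _ fun q => ?_
    rw [norm_mul, norm_cexpI, one_mul, norm_mul, norm_mul, norm_cexpI, one_mul]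
    exact mul_le_mul_of_nonneg_right (hn.2 _ _) (norm_nonneg _)
  · filter_upwards [ae_fst_ne p.1] with q hq
    exact (((hlim p.1 q.1 hq).const_mul _).mul_const _).const_mul _

end

/-! ### The `L²` estimate -/

/-- The oscillatory integral `∫ e^{irσ} h(σ) dσ`. -/
def osc (h : ℝ → ℂ) (r : ℝ) : ℂ := ∫ σ, cexpI (r * σ) * h σ

/-- Bounded measurable functions with bounded support. -/
structure BoundedSupport (h : ℝ → ℂ) : Prop where
  measurable : Measurable h
  bound : ∃ C, 0 ≤ C ∧ ∀ σ, ‖h σ‖ ≤ C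
  support : ∃ S, ∀ σ, S < |σ| → h σ = 0

theorem BoundedSupport.integrable {h : ℝ → ℂ} (hh : BoundedSupport h) : Integrable h := by
  obtain ⟨C, -, hC⟩ := hh.bound
  obtain ⟨S, hS⟩ := hh.support
  exact integrable_of_bounded_of_eq_zero hh.measurable hC hS

theorem measurable_osc {h : ℝ → ℂ} (hh : Measurable h) : Measurable (osc h) := by
  have h1 : Measurable fun r : ℝ × ℝ => cexpI (r.1 * r.2) * h r.2 :=
    Measurable.mul (by fun_prop) (hh.comp measurable_snd)
  exact h1.stronglyMeasurable.integral_prod_right'.measurable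

theorem BoundedSupport.bounded₂_osc {h : ℝ → ℂ} (hh : BoundedSupport h) :
    Bounded₂ (fun t s => osc h (t - s)) where
  measurable := (measurable_osc hh.measurable).comp (measurable_fst.sub measurable_snd)
  bound := ⟨∫ σ, ‖h σ‖, fun t s => norm_integral_le_of_norm_le hh.integrable.norm
    (ae_of_all _ fun σ => by simp [norm_cexpI])⟩

section
variable {φ : ℝ → ℝ → ℝ} {w : ℝ → ℝ → ℂ} {h : ℝ → ℂ} {F : ℝ × ℝ × ℝ → ℂ} {R : ℝ}

/-- The space-time Fourier multiplier `h(τ - φ) w` applied to a band limited function has a bounded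
and compactly supported space-time Fourier transform. -/
theorem multiplier_facts (hφ : LocBounded φ) (hw : LocBounded w) (hh : BoundedSupport h)
    (hF : BandLimited R F) :
    Measurable (fun q : ℝ × ℝ × ℝ =>
      w q.2.1 q.2.2 * h (q.1 - φ q.2.1 q.2.2) * FTtxy F q.1 q.2.1 q.2.2) ∧
    (∃ C, 0 ≤ C ∧ ∀ τ ξ μ, ‖w ξ μ * h (τ - φ ξ μ) * FTtxy F τ ξ μ‖ ≤ C) ∧
    ∃ S, ∀ q : ℝ × ℝ × ℝ, S < ‖q‖ →
      w q.2.1 q.2.2 * h (q.1 - φ q.2.1 q.2.2) * FTtxy F q.1 q.2.1 q.2.2 = 0 := by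
  obtain ⟨Ch, hCh0, hCh⟩ := hh.bound
  obtain ⟨Sh, hSh⟩ := hh.support
  obtain ⟨Cw, hCw⟩ := hw.bound R
  obtain ⟨Cp, hCp⟩ := hφ.bound R
  obtain ⟨D, hD⟩ := hF.FTtxy_bounded
  refine ⟨?_, ⟨|Cw| * Ch * |D|, by positivity, fun τ ξ μ => ?_⟩, max R (Sh + Cp), fun q hq => ?_⟩
  · have h1 : Measurable fun q : ℝ × ℝ × ℝ => φ q.2.1 q.2.2 := hφ.measurable.comp measurable_snd
    exact ((hw.measurable.comp measurable_snd).mul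
      (hh.measurable.comp (measurable_fst.sub h1))).mul hF.measurable_FTtxy
  · by_cases hb : R < |ξ| ∨ R < |μ|
    · rw [hF.FTtxy_eq_zero _ _ _ hb, mul_zero, norm_zero]
      positivity
    · push Not at hb
      rw [norm_mul, norm_mul]
      have h1 := (hCw ξ μ hb.1 hb.2).trans (le_abs_self Cw)
      have h2 := hCh (τ - φ ξ μ)
      have h3 := (hD τ ξ μ).trans (le_abs_self D)
      gcongr
  · by_cases hb : R < |q.2.1| ∨ R < |q.2.2|
    · rw [hF.FTtxy_eq_zero _ _ _ hb, mul_zero]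
    · rw [hSh, mul_zero, zero_mul]
      push Not at hb
      have h1 : max R (Sh + Cp) < |q.1| := by
        rw [Prod.norm_def, Prod.norm_def, lt_max_iff, lt_max_iff] at hq
        rcases hq with hq | hq | hq
        · exact hq
        · exact absurd hb.1 (not_le.2 ((le_max_left _ _).trans_lt hq))
        · exact absurd hb.2 (not_le.2 ((le_max_left _ _).trans_lt hq))
      have h2 := hCp _ _ hb.1 hb.2
      have h3 := (le_max_right R (Sh + Cp)).trans_lt h1
      rw [Real.norm_eq_abs] at h2
      have h4 := abs_sub_abs_le_abs_sub q.1 (φ q.2.1 q.2.2)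
      linarith

theorem integrable_multiplier (hφ : LocBounded φ) (hw : LocBounded w) (hh : BoundedSupport h)
    (hF : BandLimited R F) :
    Integrable (fun q : ℝ × ℝ × ℝ =>
      w q.2.1 q.2.2 * h (q.1 - φ q.2.1 q.2.2) * FTtxy F q.1 q.2.1 q.2.2) := by
  obtain ⟨h1, ⟨C, -, h2⟩, S, h3⟩ := multiplier_facts hφ hw hh hF
  exact integrable_of_bounded_of_eq_zero h1 (fun q => h2 _ _ _) h3

theorem integral_cexpI_mul_comp_sub (h : ℝ → ℂ) (a r : ℝ) :
    ∫ τ, cexpI (r * τ) * h (τ - a) = cexpI (r * a) * osc h r := by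
  rw [← integral_add_right_eq_self _ a, osc, ← integral_const_mul]
  congr 1
  ext τ
  rw [add_sub_cancel_right, mul_add, cexpI_add]
  ring

/-- On the Fourier side in time, evolutions with time kernel `κ(t, s) = ĥ(s - t)` are multiplication
by `h(τ - φ)`. -/
theorem evolution_osc_eq (hφ : LocBounded φ) (hw : LocBounded w) (hh : BoundedSupport h)
    (hF : BandLimited R F) (p : ℝ × ℝ × ℝ) :
    evolution φ w (fun t s => osc h (t - s)) F p =
      ∫ q : ℝ × ℝ × ℝ, cexpI (p.2.1 * q.2.1 + p.2.2 * q.2.2 + p.1 * q.1) *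
        (w q.2.1 q.2.2 * h (q.1 - φ q.2.1 q.2.2) * FTtxy F q.1 q.2.1 q.2.2) := by
  have hi1 := integrable_evolution hφ hw hh.bounded₂_osc hF p.1
  have hi2 := integrable_multiplier hφ hw hh hF
  have hc1 : Measurable fun q : ℝ × ℝ × ℝ => cexpI (p.2.1 * q.2.1 + p.2.2 * q.2.2) := by fun_prop
  have hc2 : Measurable fun q : ℝ × ℝ × ℝ =>
    cexpI (p.2.1 * q.2.1 + p.2.2 * q.2.2 + p.1 * q.1) := by fun_prop
  have hi1' := hi1.bdd_mul (c := 1) hc1.aestronglyMeasurable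
    (ae_of_all _ fun q => (norm_cexpI _).le)
  have hi2' := hi2.bdd_mul (c := 1) hc2.aestronglyMeasurable
    (ae_of_all _ fun q => (norm_cexpI _).le)
  refine (integral_prod_symm _ hi1').trans (Eq.trans ?_ (integral_prod_symm _ hi2').symm)
  refine integral_congr_ae (ae_of_all _ fun ζ => ?_)
  obtain ⟨ξ, μ⟩ := ζ
  beta_reduce
  dsimp only
  simp only [hF.FTtxy_eq]
  have hg : Integrable (fun s => spaceFT F s ξ μ) := by
    obtain ⟨C, -, hC⟩ := hF.spaceFT_bounded
    refine integrable_of_bounded_of_eq_zero (C := C) (R := R) ?_ (fun s => hC s ξ μ) fun s hs => ?_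
    · have h1 : Measurable fun s : ℝ => (s, ξ, μ) := by fun_prop
      have h2 := (measurable_spaceFT hF.measurable).comp h1
      exact h2
    · have := hF.spaceFT_eq_zero' (s, ξ, μ) (hs.trans_le (norm_fst_le (s, ξ, μ)))
      exact this
  have e1 : ∀ τ, cexpI (p.2.1 * ξ + p.2.2 * μ + p.1 * τ) *
      (w ξ μ * h (τ - φ ξ μ) * ∫ s, cexpI (-(s * τ)) * spaceFT F s ξ μ) =
      ∫ s, cexpI (p.2.1 * ξ + p.2.2 * μ) * w ξ μ * spaceFT F s ξ μ *
        (cexpI ((p.1 - s) * τ) * h (τ - φ ξ μ)) := by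
    intro τ
    rw [← mul_assoc, ← integral_const_mul]
    congr 1
    ext s
    rw [show (p.1 - s) * τ = p.1 * τ + -(s * τ) by ring, cexpI_add _ (p.1 * τ),
      cexpI_add (p.1 * τ)]
    ring
  simp only [e1]
  rw [integral_integral_swap]
  · congr 1
    ext s
    rw [integral_const_mul, integral_cexpI_mul_comp_sub]
    ring
  · have hp : Integrable (fun r : ℝ × ℝ => h (r.1 - φ ξ μ) * spaceFT F r.2 ξ μ) :=
      (hh.integrable.comp_sub_right (φ ξ μ)).mul_prod hg
    have hm : Measurable fun r : ℝ × ℝ => cexpI ((p.1 - r.2) * r.1) := by fun_prop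
    have := (hp.bdd_mul (c := 1) hm.aestronglyMeasurable
      (ae_of_all _ fun q => (norm_cexpI _).le)).const_mul
      (cexpI (p.2.1 * ξ + p.2.2 * μ) * w ξ μ)
    refine this.congr (ae_of_all _ fun r => ?_)
    simp only [Function.uncurry]
    ring

/-- The Fourier transform in `(t, y)` of the multiplier `h(τ - φ) w` applied to `F`, as a function
of `v = (τ, μ)`. -/
def sliceFT (φ : ℝ → ℝ → ℝ) (w : ℝ → ℝ → ℂ) (h : ℝ → ℂ) (F : ℝ × ℝ × ℝ → ℂ) (x : ℝ)
    (v : ℝ × ℝ) : ℂ :=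
  ∫ ξ, cexpI (x * ξ) * (w ξ v.2 * h (v.1 - φ ξ v.2) * FTtxy F v.1 ξ v.2)

theorem integrable_sliceFT (hφ : LocBounded φ) (hw : LocBounded w) (hh : BoundedSupport h)
    (hF : BandLimited R F) (x : ℝ) : Integrable (sliceFT φ w h F x) := by
  have hi := integrable_multiplier hφ hw hh hF
  have hc : Measurable fun q : ℝ × ℝ × ℝ => cexpI (x * q.2.1) := by fun_prop
  have h1 := hi.bdd_mul (c := 1) hc.aestronglyMeasurable (ae_of_all _ fun q => (norm_cexpI _).le)
  have h2 := (integrable_swap12 h1).integral_prod_right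
  exact h2

theorem sliceFT_bounded (hφ : LocBounded φ) (hw : LocBounded w) (hh : BoundedSupport h)
    (hF : BandLimited R F) (x : ℝ) : ∃ C, ∀ v, ‖sliceFT φ w h F x v‖ ≤ C := by
  obtain ⟨-, ⟨C, hC0, hC⟩, -⟩ := multiplier_facts hφ hw hh hF
  refine ⟨∫ ξ, (Icc (-R) R).indicator (fun _ : ℝ => C) ξ, fun v => ?_⟩
  refine norm_integral_le_of_norm_le (BandLimited.integrable_indicator R C)
    (ae_of_all _ fun ξ => ?_)
  rw [norm_mul, norm_cexpI, one_mul]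
  by_cases hξ : ξ ∈ Icc (-R) R
  · rw [indicator_of_mem hξ]
    exact hC _ _ _
  · rw [indicator_of_notMem hξ, hF.FTtxy_eq_zero, mul_zero, norm_zero]
    rw [mem_Icc, ← abs_le, not_le] at hξ
    exact Or.inl hξ

theorem evolution_osc_eq_integral_sliceFT (hφ : LocBounded φ) (hw : LocBounded w)
    (hh : BoundedSupport h) (hF : BandLimited R F) (x : ℝ) (z : ℝ × ℝ) :
    evolution φ w (fun t s => osc h (t - s)) F (z.1, x, z.2) =
      ∫ v : ℝ × ℝ, cexpI (v.1 * z.1 + v.2 * z.2) * sliceFT φ w h F x v := by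
  have hi := integrable_multiplier hφ hw hh hF
  rw [evolution_osc_eq hφ hw hh hF]
  have hc : Measurable fun q : ℝ × ℝ × ℝ => cexpI (x * q.2.1 + z.2 * q.2.2 + z.1 * q.1) := by
    fun_prop
  have h1 := hi.bdd_mul (c := 1) hc.aestronglyMeasurable (ae_of_all _ fun q => (norm_cexpI _).le)
  refine (integral_eq_integral_integral_mid h1).trans ?_
  refine integral_congr_ae (ae_of_all _ fun v => ?_)
  beta_reduce
  rw [sliceFT, ← integral_const_mul]
  refine integral_congr_ae (ae_of_all _ fun ξ => ?_)
  beta_reduce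
  rw [← mul_assoc (cexpI (v.1 * z.1 + v.2 * z.2)), ← cexpI_add]
  congr 2
  ring

/-- For fixed `(τ, μ)` the multiplier is a convolution in `x` with a kernel bounded by `B`. -/
theorem enorm_sliceFT_le (hF : BandLimited R F) {B : ℝ}
    (hint : ∀ τ μ, Integrable (fun ξ => w ξ μ * h (τ - φ ξ μ)))
    (hB : ∀ τ x μ, ‖∫ ξ, cexpI (x * ξ) * (w ξ μ * h (τ - φ ξ μ))‖ ≤ B) (x : ℝ) (v : ℝ × ℝ) :
    ‖sliceFT φ w h F x v‖ₑ ≤ ∫⁻ x', ENNReal.ofReal B * ‖FTty F v.1 x' v.2‖ₑ := by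
  rw [sliceFT, integral_cexpI_mul_FTtxy hF (hint v.1 v.2)]
  refine (enorm_integral_le_lintegral_enorm _).trans (lintegral_mono fun x' => ?_)
  rw [enorm_mul]
  gcongr
  rw [← ofReal_norm]
  exact ENNReal.ofReal_le_ofReal (hB _ _ _)

/-- Minkowski's inequality in `(τ, μ)`, and Plancherel's theorem on each slice. -/
theorem eLpNorm_lintegral_FTty_le (hF : BandLimited R F) {B : ℝ} (hB0 : 0 ≤ B) :
    eLpNorm (fun v : ℝ × ℝ => ∫⁻ x', ENNReal.ofReal B * ‖FTty F v.1 x' v.2‖ₑ) 2 ≤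
      ENNReal.ofReal (2 * Real.pi * B) * ∫⁻ x', eLpNorm (fun z : ℝ × ℝ => F (z.1, x', z.2)) 2 := by
  have hFm : Measurable (Function.uncurry fun (v : ℝ × ℝ) (x' : ℝ) =>
      ENNReal.ofReal B * ‖FTty F v.1 x' v.2‖ₑ) := by
    have h1 : Measurable fun r : (ℝ × ℝ) × ℝ => FTty F r.1.1 r.2 r.1.2 := by
      have h2 : Measurable fun r : (ℝ × ℝ) × ℝ => (r.1.1, r.2, r.1.2) := by fun_prop
      have h3 := hF.measurable_FTty.comp h2
      exact h3
    exact h1.enorm.const_mul _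
  have hpl : ∀ x', eLpNorm (fun v : ℝ × ℝ => FTty F v.1 x' v.2) 2 =
      ENNReal.ofReal (2 * Real.pi) * eLpNorm (fun z : ℝ × ℝ => F (z.1, x', z.2)) 2 := fun x' =>
    eLpNorm_fourier_prod_eq _ (hF.integrable_slice x') (hF.memLp_slice x')
  refine (eLpNorm_two_lintegral_le _ hFm).trans (le_of_eq ?_)
  have h1 : ∀ x', eLpNorm (fun v : ℝ × ℝ => ENNReal.ofReal B * ‖FTty F v.1 x' v.2‖ₑ) 2 =
      ENNReal.ofReal (2 * Real.pi * B) * eLpNorm (fun z : ℝ × ℝ => F (z.1, x', z.2)) 2 := by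
    intro x'
    rw [mul_comm (2 * Real.pi) B, ENNReal.ofReal_mul hB0, mul_assoc, ← hpl x',
      ← Real.enorm_of_nonneg hB0, ← eLpNorm_const_smul B]
    refine eLpNorm_congr_enorm_ae (ae_of_all _ fun v => ?_)
    have hBe : ‖(B : ℂ)‖ₑ = ‖B‖ₑ := by rw [← ofReal_norm, ← ofReal_norm, Complex.norm_real]
    simp [enorm_mul, hBe]
  simp only [h1]
  rw [lintegral_const_mul' _ _ ENNReal.ofReal_ne_top]

/-- Plancherel's theorem in time and one space variable reduces bounds for `h(τ - φ) w` to uniform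
bounds for the Fourier transform of its symbol in the remaining frequency. -/
theorem eLpNorm_evolution_osc_le (hφ : LocBounded φ) (hw : LocBounded w) (hh : BoundedSupport h)
    (hF : BandLimited R F) {B : ℝ}
    (hint : ∀ τ μ, Integrable (fun ξ => w ξ μ * h (τ - φ ξ μ)))
    (hB : ∀ τ x μ, ‖∫ ξ, cexpI (x * ξ) * (w ξ μ * h (τ - φ ξ μ))‖ ≤ B) (x : ℝ) :
    eLpNorm (fun z : ℝ × ℝ => evolution φ w (fun t s => osc h (t - s)) F (z.1, x, z.2)) 2 ≤
      ENNReal.ofReal ((2 * Real.pi) ^ 2 * B) *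
        ∫⁻ x', eLpNorm (fun z : ℝ × ℝ => F (z.1, x', z.2)) 2 := by
  have hB0 : 0 ≤ B := (norm_nonneg _).trans (hB 0 0 0)
  obtain ⟨C, hC⟩ := sliceFT_bounded hφ hw hh hF x
  have hi := integrable_sliceFT hφ hw hh hF x
  have h1 := eLpNorm_fourierInv_prod_eq _ hi (memLp_two_of_bounded hi hC)
  have h2 : eLpNorm (sliceFT φ w h F x) 2 ≤
      eLpNorm (fun v : ℝ × ℝ => ∫⁻ x', ENNReal.ofReal B * ‖FTty F v.1 x' v.2‖ₑ) 2 :=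
    eLpNorm_mono_enorm fun v => by simpa using enorm_sliceFT_le hF hint hB x v
  have h3 := h2.trans (eLpNorm_lintegral_FTty_le hF hB0)
  simp only [evolution_osc_eq_integral_sliceFT hφ hw hh hF]
  rw [h1]
  refine (mul_le_mul_right h3 _).trans (le_of_eq ?_)
  rw [← mul_assoc, ← ENNReal.ofReal_mul (by positivity)]
  congr 2
  ring

end

/-! ### Time kernels -/

/-- The truncation of `1/σ` to `{ε < |σ| < 1/ε}`. -/
def pvTrunc (ε σ : ℝ) : ℂ := (shell ε (1 / ε)).indicator (fun σ => ((σ⁻¹ : ℝ) : ℂ)) σ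

/-- The normalized indicator function of `{ε < |σ| < 2ε}`, an approximate identity. -/
def meanTrunc (ε σ : ℝ) : ℂ := (shell ε (2 * ε)).indicator (fun _ => (((2 * ε)⁻¹ : ℝ) : ℂ)) σ

/-- The time kernel `2i (∫₀^∞ sin v / v dv) sgn(t - s)`, the Fourier transform of the principal
value of `1/σ`. -/
def pvKer (t s : ℝ) : ℂ := 2 * Complex.I * ((SiTop * SignType.sign (t - s) : ℝ) : ℂ)

theorem boundedSupport_pvTrunc {ε : ℝ} (hε : 0 < ε) : BoundedSupport (pvTrunc ε) where
  measurable := Measurable.indicator (by fun_prop) (measurableSet_shell _ _)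
  bound := by
    refine ⟨ε⁻¹, by positivity, fun σ => ?_⟩
    rw [pvTrunc]
    by_cases h : σ ∈ shell ε (1 / ε)
    · rw [indicator_of_mem h, Complex.norm_real, norm_inv, Real.norm_eq_abs]
      exact inv_anti₀ hε h.1.le
    · rw [indicator_of_notMem h, norm_zero]
      positivity
  support := ⟨1 / ε, fun σ hσ => indicator_of_notMem (fun h => (h.2.trans hσ).false) _⟩

theorem boundedSupport_meanTrunc {ε : ℝ} (hε : 0 < ε) : BoundedSupport (meanTrunc ε) where
  measurable := measurable_const.indicator (measurableSet_shell _ _)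
  bound := by
    refine ⟨(2 * ε)⁻¹, by positivity, fun σ => ?_⟩
    rw [meanTrunc]
    by_cases h : σ ∈ shell ε (2 * ε)
    · rw [indicator_of_mem h, Complex.norm_real, Real.norm_of_nonneg (by positivity)]
    · rw [indicator_of_notMem h, norm_zero]
      positivity
  support := ⟨2 * ε, fun σ hσ => indicator_of_notMem (fun h => (h.2.trans hσ).false) _⟩

theorem osc_pvTrunc (ε r : ℝ) : osc (pvTrunc ε) r = ∫ σ in shell ε (1 / ε), oscKer r σ := by
  rw [osc, ← integral_indicator (measurableSet_shell _ _)]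
  congr 1
  ext σ
  by_cases h : σ ∈ shell ε (1 / ε)
  · rw [pvTrunc, indicator_of_mem h, indicator_of_mem h, oscKer]
  · rw [pvTrunc, indicator_of_notMem h, indicator_of_notMem h, mul_zero]

theorem norm_osc_pvTrunc_le {ε : ℝ} (hε : 0 < ε) (r : ℝ) : ‖osc (pvTrunc ε) r‖ ≤ 16 := by
  rw [osc_pvTrunc]
  exact norm_setIntegral_oscKer_shell_le r hε

/-- The truncated principal value transforms to a bounded approximation of a multiple of the
sign. -/
theorem tendsto_osc_pvTrunc (t s : ℝ) :
    Tendsto (fun ε => osc (pvTrunc ε) (t - s)) (𝓝[>] 0) (𝓝 (pvKer t s)) := by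
  have h1 : Tendsto (fun ε : ℝ => Si ((t - s) * (1 / ε))) (𝓝[>] 0)
      (𝓝 (SiTop * SignType.sign (t - s))) := by
    simp only [one_div]
    exact (tendsto_Si_mul (t - s)).comp tendsto_inv_nhdsGT_zero
  have h2 : Tendsto (fun ε : ℝ => Si ((t - s) * ε)) (𝓝[>] 0) (𝓝 0) := by
    have : Continuous fun ε : ℝ => Si ((t - s) * ε) := continuous_Si.comp (by fun_prop)
    have h := this.tendsto 0
    rw [mul_zero, Si_zero] at h
    exact h.mono_left nhdsWithin_le_nhds
  have h3 := (Complex.continuous_ofReal.tendsto _).comp (h1.sub h2)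
  rw [sub_zero] at h3
  refine (h3.const_mul (2 * Complex.I)).congr' ?_
  filter_upwards [Ioo_mem_nhdsGT (zero_lt_one : (0 : ℝ) < 1)] with ε hε
  rw [osc_pvTrunc, setIntegral_oscKer_shell _ hε.1]
  · rfl
  · rw [le_div_iff₀ hε.1]
    nlinarith [hε.1, hε.2]

theorem volume_shell {a b : ℝ} (ha : 0 ≤ a) (hab : a ≤ b) :
    volume (shell a b) = ENNReal.ofReal (2 * (b - a)) := by
  have h : shell a b = Ioo (-b) (-a) ∪ Ioo a b := by
    ext σ
    simp only [shell, mem_ofPred_eq, mem_union, mem_Ioo, lt_abs, abs_lt]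
    grind
  have hd : Disjoint (Ioo (-b) (-a)) (Ioo a b) := by
    rw [Set.disjoint_left]
    rintro σ ⟨-, h1⟩ ⟨h2, -⟩
    linarith
  rw [h, measure_union hd measurableSet_Ioo, Real.volume_Ioo, Real.volume_Ioo,
    ← ENNReal.ofReal_add (by linarith) (by linarith)]
  congr 1
  ring

theorem integral_norm_meanTrunc {ε : ℝ} (hε : 0 < ε) : ∫ σ, ‖meanTrunc ε σ‖ = 1 := by
  have h1 : ∀ σ, ‖meanTrunc ε σ‖ = (shell ε (2 * ε)).indicator (fun _ => (2 * ε)⁻¹) σ := by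
    intro σ
    rw [meanTrunc, norm_indicator_eq_indicator_norm]
    congr 1
    ext
    rw [Complex.norm_real, Real.norm_of_nonneg (by positivity)]
  simp only [h1]
  rw [integral_indicator (measurableSet_shell _ _), setIntegral_const, Measure.real,
    volume_shell hε.le (by linarith), ENNReal.toReal_ofReal (by linarith), smul_eq_mul]
  field_simp
  ring

theorem integral_meanTrunc {ε : ℝ} (hε : 0 < ε) : ∫ σ, meanTrunc ε σ = 1 := by
  have h1 : ∀ σ, meanTrunc ε σ = ((‖meanTrunc ε σ‖ : ℝ) : ℂ) := by
    intro σ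
    by_cases h : σ ∈ shell ε (2 * ε)
    · rw [meanTrunc, indicator_of_mem h, Complex.norm_real, Real.norm_of_nonneg (by positivity)]
    · rw [meanTrunc, indicator_of_notMem h, norm_zero, Complex.ofReal_zero]
  rw [integral_congr_ae (ae_of_all _ h1), integral_complex_ofReal, integral_norm_meanTrunc hε,
    Complex.ofReal_one]

theorem norm_osc_meanTrunc_le {ε : ℝ} (hε : 0 < ε) (r : ℝ) : ‖osc (meanTrunc ε) r‖ ≤ 1 := by
  rw [← integral_norm_meanTrunc hε]
  exact norm_integral_le_of_norm_le (boundedSupport_meanTrunc hε).integrable.norm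
    (ae_of_all _ fun σ => by simp [norm_cexpI])

theorem norm_cexpI_sub_one_le (a : ℝ) : ‖cexpI a - 1‖ ≤ |a| := by
  have := Real.norm_exp_I_mul_ofReal_sub_one_le (x := a)
  simpa [cexpI] using this

theorem tendsto_osc_meanTrunc (r : ℝ) :
    Tendsto (fun ε => osc (meanTrunc ε) r) (𝓝[>] 0) (𝓝 1) := by
  rw [tendsto_iff_norm_sub_tendsto_zero]
  have h1 : Tendsto (fun ε : ℝ => |r| * (2 * ε)) (𝓝[>] 0) (𝓝 0) := by
    have : Continuous fun ε : ℝ => |r| * (2 * ε) := by fun_prop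
    have h := this.tendsto 0
    rw [mul_zero, mul_zero] at h
    exact h.mono_left nhdsWithin_le_nhds
  refine squeeze_zero' (Eventually.of_forall fun ε => norm_nonneg _) ?_ h1
  filter_upwards [self_mem_nhdsWithin] with ε hε
  have hε : 0 < ε := hε
  have hi := (boundedSupport_meanTrunc hε).integrable
  have hi' : Integrable fun σ => cexpI (r * σ) * meanTrunc ε σ := hi.bdd_mul (c := 1)
    (Continuous.aestronglyMeasurable (by fun_prop)) (ae_of_all _ fun σ => (norm_cexpI _).le)
  rw [osc, ← integral_meanTrunc hε, ← integral_sub hi' hi,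
    ← mul_one (|r| * (2 * ε)), ← integral_norm_meanTrunc hε, ← integral_const_mul]
  refine norm_integral_le_of_norm_le (hi.norm.const_mul _) (ae_of_all _ fun σ => ?_)
  rw [← sub_one_mul, norm_mul]
  by_cases h : σ ∈ shell ε (2 * ε)
  · gcongr
    refine (norm_cexpI_sub_one_le _).trans ?_
    rw [abs_mul]
    gcongr
    exact h.2.le
  · rw [meanTrunc, indicator_of_notMem h]
    simp

theorem measurable_sign_real : Measurable fun x : ℝ => ((SignType.sign x : ℝ)) := by
  have : (fun x : ℝ => ((SignType.sign x : ℝ))) =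
      fun x => if 0 < x then 1 else if x < 0 then -1 else 0 := by
    ext x
    rw [sign_apply]
    split_ifs <;> simp
  rw [this]
  exact Measurable.ite measurableSet_Ioi measurable_const
    (Measurable.ite measurableSet_Iio measurable_const measurable_const)

theorem bounded₂_pvKer : Bounded₂ pvKer where
  measurable := by
    have h2 : Measurable fun q : ℝ × ℝ => ((SignType.sign (q.1 - q.2) : ℝ)) :=
      measurable_sign_real.comp (measurable_fst.sub measurable_snd)
    unfold pvKer
    fun_prop
  bound := by
    refine ⟨16, fun t s => ?_⟩
    refine le_of_tendsto (tendsto_osc_pvTrunc t s).norm ?_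
    filter_upwards [self_mem_nhdsWithin] with ε hε
    exact norm_osc_pvTrunc_le hε _

theorem bounded₂_one : Bounded₂ (fun _ _ => 1) := ⟨measurable_const, 1, by simp⟩

/-! ### Bounds for the limiting evolutions -/

section
variable {φ : ℝ → ℝ → ℝ} {w : ℝ → ℝ → ℂ} {F : ℝ × ℝ × ℝ → ℂ} {R : ℝ}

/-- Fatou's lemma carries the bounds for multipliers `h(τ - φ) w` to limits of the time kernels. -/
theorem eLpNorm_evolution_le_of_tendsto (hφ : LocBounded φ) (hw : LocBounded w)
    (hF : BandLimited R F) {B C : ℝ} {h : ℝ → ℝ → ℂ} {κ : ℝ → ℝ → ℂ}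
    (hh : ∀ ε, 0 < ε → BoundedSupport (h ε))
    (hC : ∀ ε, 0 < ε → ∀ r, ‖osc (h ε) r‖ ≤ C)
    (hlim : ∀ t s, s ≠ t → Tendsto (fun ε => osc (h ε) (t - s)) (𝓝[>] 0) (𝓝 (κ t s)))
    (hint : ∀ ε, 0 < ε → ∀ τ μ, Integrable (fun ξ => w ξ μ * h ε (τ - φ ξ μ)))
    (hB : ∀ ε, 0 < ε → ∀ τ x μ, ‖∫ ξ, cexpI (x * ξ) * (w ξ μ * h ε (τ - φ ξ μ))‖ ≤ B) (x : ℝ) :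
    eLpNorm (fun z : ℝ × ℝ => evolution φ w κ F (z.1, x, z.2)) 2 ≤
      ENNReal.ofReal ((2 * Real.pi) ^ 2 * B) *
        ∫⁻ x', eLpNorm (fun z : ℝ × ℝ => F (z.1, x', z.2)) 2 := by
  have hu : Tendsto (fun n : ℕ => 1 / ((n : ℝ) + 1)) atTop (𝓝[>] 0) :=
    tendsto_nhdsWithin_iff.2 ⟨tendsto_one_div_add_atTop_nhds_zero_nat,
      Eventually.of_forall fun n => by simp only [mem_Ioi]; positivity⟩
  have hpos : ∀ n : ℕ, 0 < 1 / ((n : ℝ) + 1) := fun n => by positivity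
  -- Fatou along the sequence `ε = 1 / (n + 1)`
  refine (Lp.eLpNorm_lim_le_liminf_eLpNorm
    (f := fun (n : ℕ) (z : ℝ × ℝ) =>
      evolution φ w (fun t s => osc (h (1 / ((n : ℝ) + 1))) (t - s)) F (z.1, x, z.2))
    (fun n => ?_) _ (ae_of_all _ fun z => ?_)).trans ?_
  · have h1 := measurable_evolution hφ hw (hh _ (hpos n)).bounded₂_osc hF
    have h2 : Measurable fun z : ℝ × ℝ => (z.1, x, z.2) := by fun_prop
    exact (h1.comp h2).aestronglyMeasurable
  · refine tendsto_evolution hφ hw hF (C := C) (Eventually.of_forall fun n =>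
      ⟨(hh _ (hpos n)).bounded₂_osc.measurable, fun t s => hC _ (hpos n) _⟩)
      (fun t s hts => (hlim t s hts).comp hu) _
  · refine (liminf_le_liminf (Eventually.of_forall fun n =>
      eLpNorm_evolution_osc_le hφ hw (hh _ (hpos n)) hF (hint _ (hpos n)) (hB _ (hpos n)) x)).trans
      (le_of_eq ?_)
    exact liminf_const _

variable {W : ℝ → ℝ → ℝ} {B : ℝ}

/-- The smoothing estimate for the time kernel `sgn(t - s)`, the limit of the transforms of
`pvTrunc`. -/
theorem eLpNorm_evolution_pvKer_le (hφ : LocBounded φ) (hw : LocBounded w)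
    (hwW : ∀ ξ μ, w ξ μ = -(W ξ μ : ℂ))
    (hPV : ∀ τ μ, PVBounded B (fun ξ => τ - φ ξ μ) (fun ξ => W ξ μ / (τ - φ ξ μ)))
    (hF : BandLimited R F) (x : ℝ) :
    eLpNorm (fun z : ℝ × ℝ => evolution φ w pvKer F (z.1, x, z.2)) 2 ≤
      ENNReal.ofReal ((2 * Real.pi) ^ 2 * B) *
        ∫⁻ x', eLpNorm (fun z : ℝ × ℝ => F (z.1, x', z.2)) 2 := by
  have hg : ∀ τ μ, Measurable fun ξ => τ - φ ξ μ := fun τ μ =>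
    (hφ.measurable.comp (measurable_id.prodMk measurable_const)).const_sub τ
  have e1 : ∀ ε τ μ, (fun ξ => w ξ μ * pvTrunc ε (τ - φ ξ μ)) =
      (band (fun ξ => τ - φ ξ μ) ε).indicator fun ξ => -((W ξ μ / (τ - φ ξ μ) : ℝ) : ℂ) := by
    intro ε τ μ
    ext ξ
    by_cases hξ : ξ ∈ band (fun ξ => τ - φ ξ μ) ε
    · have : τ - φ ξ μ ∈ shell ε (1 / ε) := hξ
      rw [pvTrunc, indicator_of_mem hξ, indicator_of_mem this, hwW]
      push_cast
      ring
    · have : τ - φ ξ μ ∉ shell ε (1 / ε) := hξ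
      rw [pvTrunc, indicator_of_notMem hξ, indicator_of_notMem this, mul_zero]
  refine eLpNorm_evolution_le_of_tendsto hφ hw hF (fun ε => boundedSupport_pvTrunc)
    (fun ε hε r => norm_osc_pvTrunc_le hε r) (fun t s _ => tendsto_osc_pvTrunc t s)
    (fun ε hε τ μ => ?_) (fun ε hε τ x μ => ?_) x
  · rw [e1, integrable_indicator_iff (measurableSet_band (hg τ μ) ε)]
    exact ((hPV τ μ).integrableOn_band ε hε).ofReal.neg
  · have e2 : ∀ ξ, cexpI (x * ξ) * (w ξ μ * pvTrunc ε (τ - φ ξ μ)) =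
        (band (fun ξ => τ - φ ξ μ) ε).indicator
          (fun ξ => -(cexpI (x * ξ) * ((W ξ μ / (τ - φ ξ μ) : ℝ) : ℂ))) ξ := by
      intro ξ
      rw [congrFun (e1 ε τ μ) ξ]
      by_cases hξ : ξ ∈ band (fun ξ => τ - φ ξ μ) ε
      · rw [indicator_of_mem hξ, indicator_of_mem hξ, mul_neg]
      · rw [indicator_of_notMem hξ, indicator_of_notMem hξ, mul_zero]
    simp only [e2]
    rw [integral_indicator (measurableSet_band (hg τ μ) ε), integral_neg, norm_neg]
    exact (hPV τ μ).norm_le ε hε x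

/-- The smoothing estimate for the constant time kernel, the limit of the transforms of `meanTrunc`:
on the layer `{ε < |τ - φ| < 2ε}` the symbol `W / (2ε)` is dominated by `|W / (τ - φ)|`. -/
theorem eLpNorm_evolution_one_le (hφ : LocBounded φ) (hw : LocBounded w)
    (hwW : ∀ ξ μ, w ξ μ = -(W ξ μ : ℂ))
    (hPV : ∀ τ μ, PVBounded B (fun ξ => τ - φ ξ μ) (fun ξ => W ξ μ / (τ - φ ξ μ)))
    (hF : BandLimited R F) (x : ℝ) :
    eLpNorm (fun z : ℝ × ℝ => evolution φ w (fun _ _ => 1) F (z.1, x, z.2)) 2 ≤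
      ENNReal.ofReal ((2 * Real.pi) ^ 2 * B) *
        ∫⁻ x', eLpNorm (fun z : ℝ × ℝ => F (z.1, x', z.2)) 2 := by
  have hg : ∀ τ μ, Measurable fun ξ => τ - φ ξ μ := fun τ μ =>
    (hφ.measurable.comp (measurable_id.prodMk measurable_const)).const_sub τ
  have hwm : ∀ μ, Measurable fun ξ => w ξ μ := fun μ =>
    hw.measurable.comp (measurable_id.prodMk measurable_const)
  have hle : ∀ ε, 0 < ε → ∀ τ μ ξ, ‖w ξ μ * meanTrunc ε (τ - φ ξ μ)‖ ≤
      (layer (fun ξ => τ - φ ξ μ) ε).indicator (fun ξ => |W ξ μ / (τ - φ ξ μ)|) ξ := by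
    intro ε hε τ μ ξ
    by_cases hξ : ξ ∈ layer (fun ξ => τ - φ ξ μ) ε
    · have : τ - φ ξ μ ∈ shell ε (2 * ε) := hξ
      rw [meanTrunc, indicator_of_mem hξ, indicator_of_mem this, hwW, norm_mul, norm_neg,
        Complex.norm_real, Complex.norm_real, Real.norm_of_nonneg (by positivity : 0 ≤ (2 * ε)⁻¹),
        abs_div, Real.norm_eq_abs, div_eq_mul_inv]
      gcongr
      · exact hε.trans this.1
      · exact this.2.le
    · have : τ - φ ξ μ ∉ shell ε (2 * ε) := hξ
      rw [meanTrunc, indicator_of_notMem hξ, indicator_of_notMem this, mul_zero, norm_zero]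
  have hli : ∀ ε, 0 < ε → ∀ τ μ, Integrable
      ((layer (fun ξ => τ - φ ξ μ) ε).indicator (fun ξ => |W ξ μ / (τ - φ ξ μ)|)) := by
    intro ε hε τ μ
    rw [integrable_indicator_iff (measurableSet_layer (hg τ μ) ε)]
    exact ((hPV τ μ).integrableOn_layer ε hε).abs
  refine eLpNorm_evolution_le_of_tendsto hφ hw hF (fun ε => boundedSupport_meanTrunc)
    (fun ε hε r => norm_osc_meanTrunc_le hε r) (fun t s _ => tendsto_osc_meanTrunc (t - s))
    (fun ε hε τ μ => ?_) (fun ε hε τ x μ => ?_) x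
  · exact (hli ε hε τ μ).mono' ((hwm μ).mul
      ((boundedSupport_meanTrunc hε).measurable.comp (hg τ μ))).aestronglyMeasurable
      (ae_of_all _ (hle ε hε τ μ))
  · refine (norm_integral_le_of_norm_le (hli ε hε τ μ) (ae_of_all _ fun ξ => ?_)).trans ?_
    · rw [norm_mul, norm_cexpI, one_mul]
      exact hle ε hε τ μ ξ
    · rw [integral_indicator (measurableSet_layer (hg τ μ) ε)]
      exact (hPV τ μ).layer_le ε hε

end

/-! ### The operators of the theorem as evolutions -/

theorem LocBounded.of_continuous {E : Type*} [NormedAddCommGroup E] [MeasurableSpace E]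
    [BorelSpace E] {w : ℝ → ℝ → E} (h : Continuous fun q : ℝ × ℝ => w q.1 q.2) :
    LocBounded w where
  measurable := h.measurable
  bound R := by
    obtain ⟨C, hC⟩ := ((isCompact_Icc (a := -R) (b := R)).prod
      (isCompact_Icc (a := -R) (b := R))).exists_bound_of_continuousOn h.continuousOn
    exact ⟨C, fun ξ μ h1 h2 => hC (ξ, μ) ⟨abs_le.1 h1, abs_le.1 h2⟩⟩

theorem locBounded_Phi : LocBounded Phi := by
  apply LocBounded.of_continuous
  unfold Phi
  fun_prop

theorem LocBounded.of_mem_unitInterval {χ : ℝ → ℝ → ℝ}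
    (hm : Measurable fun q : ℝ × ℝ => χ q.1 q.2) (h : ∀ ξ μ, 0 ≤ χ ξ μ ∧ χ ξ μ ≤ 1) :
    LocBounded (fun ξ μ => (χ ξ μ : ℂ)) where
  measurable := Complex.measurable_ofReal.comp hm
  bound R := ⟨1, fun ξ μ _ _ => by
    rw [Complex.norm_real, Real.norm_of_nonneg (h ξ μ).1]
    exact (h ξ μ).2⟩

/-- The time kernel `1_{0 < s ≤ t} - 1_{t < s ≤ 0}` of the Duhamel term. -/
def duhKer (t s : ℝ) : ℂ := if 0 < s ∧ s ≤ t then 1 else if t < s ∧ s ≤ 0 then -1 else 0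

theorem bounded₂_duhKer : Bounded₂ duhKer where
  measurable := by
    refine Measurable.ite ?_ measurable_const (Measurable.ite ?_ measurable_const measurable_const)
    · exact (measurableSet_lt measurable_const measurable_snd).inter
        (measurableSet_le measurable_snd measurable_fst)
    · exact (measurableSet_lt measurable_fst measurable_snd).inter
        (measurableSet_le measurable_snd measurable_const)
  bound := ⟨1, fun t s => by
    unfold duhKer
    split_ifs <;> simp⟩

section
variable {χ : ℝ → ℝ → ℝ} {F : ℝ × ℝ × ℝ → ℂ} {R : ℝ}

theorem WtildeEps_eq (hχ : LocBounded fun ξ μ => (χ ξ μ : ℂ)) (hF : BandLimited R F) {ε : ℝ}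
    (hε : 0 < ε) (p : ℝ × ℝ × ℝ) :
    WtildeEps χ ε F p =
      evolution Phi (fun ξ μ => (χ ξ μ : ℂ)) (fun t s => osc (pvTrunc ε) (t - s)) F p := by
  rw [evolution_osc_eq locBounded_Phi hχ (boundedSupport_pvTrunc hε) hF, WtildeEps,
    ← integral_indicator]
  · congr 1
    ext q
    by_cases hq : q.1 - Phi q.2.1 q.2.2 ∈ shell ε (1 / ε)
    · rw [indicator_of_mem (show q ∈ {q : ℝ × ℝ × ℝ | ε < |q.1 - Phi q.2.1 q.2.2| ∧
        |q.1 - Phi q.2.1 q.2.2| < 1 / ε} from hq), pvTrunc, indicator_of_mem hq]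
      push_cast
      ring
    · rw [indicator_of_notMem (show q ∉ {q : ℝ × ℝ × ℝ | ε < |q.1 - Phi q.2.1 q.2.2| ∧
        |q.1 - Phi q.2.1 q.2.2| < 1 / ε} from hq), pvTrunc, indicator_of_notMem hq]
      ring
  · have h1 : Measurable fun q : ℝ × ℝ × ℝ => q.1 - Phi q.2.1 q.2.2 :=
      measurable_fst.sub (locBounded_Phi.measurable.comp measurable_snd)
    exact (measurableSet_shell ε (1 / ε)).preimage h1

/-- The limit defining `Wtilde` exists and is the evolution with a multiple of `sgn(t - s)`. -/
theorem tendsto_WtildeEps (hχ : LocBounded fun ξ μ => (χ ξ μ : ℂ)) (hF : BandLimited R F)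
    (p : ℝ × ℝ × ℝ) :
    Tendsto (fun ε => WtildeEps χ ε F p) (𝓝[>] 0)
      (𝓝 (evolution Phi (fun ξ μ => (χ ξ μ : ℂ)) pvKer F p)) := by
  have h := tendsto_evolution (l := 𝓝[>] (0 : ℝ)) (κ := pvKer) locBounded_Phi hχ hF
    (κs := fun ε t s => osc (pvTrunc ε) (t - s)) (C := 16) (by
      filter_upwards [self_mem_nhdsWithin] with ε hε
      exact ⟨(boundedSupport_pvTrunc hε).bounded₂_osc.measurable,
        fun t s => norm_osc_pvTrunc_le hε _⟩)
    (fun t s _ => tendsto_osc_pvTrunc t s) p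
  refine h.congr' ?_
  filter_upwards [self_mem_nhdsWithin] with ε hε
  rw [WtildeEps_eq hχ hF hε]

theorem Wtilde_eq (hχ : LocBounded fun ξ μ => (χ ξ μ : ℂ)) (hF : BandLimited R F) :
    Wtilde χ F = evolution Phi (fun ξ μ => (χ ξ μ : ℂ)) pvKer F :=
  funext fun p => (tendsto_WtildeEps hχ hF p).limUnder_eq

theorem duhamel_eq (hχ : LocBounded fun ξ μ => (χ ξ μ : ℂ)) (hF : BandLimited R F) :
    duhamel χ F = evolution Phi (fun ξ μ => (χ ξ μ : ℂ)) duhKer F := by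
  ext ⟨t, x, y⟩
  have hc : Measurable fun q : ℝ × ℝ × ℝ => cexpI (x * q.2.1 + y * q.2.2) := by fun_prop
  have hi := (integrable_evolution locBounded_Phi hχ bounded₂_duhKer hF t).bdd_mul (c := 1)
    hc.aestronglyMeasurable (ae_of_all _ fun q => (norm_cexpI _).le)
  have h1 : evolution Phi (fun ξ μ => (χ ξ μ : ℂ)) duhKer F (t, x, y) =
      ∫ s, duhKer t s * W χ (t - s) (fun z => F (s, z)) (x, y) := by
    refine (integral_prod _ hi).trans (integral_congr_ae (ae_of_all _ fun s => ?_))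
    beta_reduce
    rw [W, ← integral_const_mul]
    refine integral_congr_ae (ae_of_all _ fun ζ => ?_)
    beta_reduce
    dsimp only
    rw [spaceFT, cexpI_add _ ((t - s) * _)]
    ring
  rw [h1, duhamel]
  dsimp only
  rcases le_total 0 t with ht | ht
  · rw [intervalIntegral.integral_of_le ht, ← integral_indicator measurableSet_Ioc]
    congr 1
    ext s
    by_cases hs : s ∈ Ioc 0 t
    · rw [indicator_of_mem hs, duhKer, if_pos (mem_Ioc.1 hs), one_mul]
    · have : ¬ (t < s ∧ s ≤ 0) := fun h => by linarith [h.1, h.2]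
      rw [indicator_of_notMem hs, duhKer, if_neg (mt mem_Ioc.2 hs), if_neg this, zero_mul]
  · rw [intervalIntegral.integral_of_ge ht, ← integral_indicator measurableSet_Ioc, ← integral_neg]
    congr 1
    ext s
    have h0 : ¬ (0 < s ∧ s ≤ t) := fun h => by linarith [h.1, h.2]
    by_cases hs : s ∈ Ioc t 0
    · rw [indicator_of_mem hs, duhKer, if_neg h0, if_pos (mem_Ioc.1 hs), neg_one_mul]
    · rw [indicator_of_notMem hs, duhKer, if_neg h0, if_neg (mt mem_Ioc.2 hs), zero_mul, neg_zero]

end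

/-! ### The Duhamel term -/

section
variable {φ : ℝ → ℝ → ℝ} {w : ℝ → ℝ → ℂ} {F : ℝ × ℝ × ℝ → ℂ} {R : ℝ}

/-- The Duhamel term is a combination of evolutions of `F`, multiplied by functions of time, with
the kernels `sgn(t - s)` and `1`. The identity of the kernels is needed at the time `t` only. -/
theorem evolution_duhKer_eq (hφ : LocBounded φ) (hw : LocBounded w) (hF : BandLimited R F)
    {β₁ β₂ : ℝ → ℂ} (h1 : Measurable β₁) (h2 : Measurable β₂) (h1' : ∀ s, ‖β₁ s‖ ≤ 1)
    (h2' : ∀ s, ‖β₂ s‖ ≤ 1) {c : ℂ} {t : ℝ}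
    (h : ∀ s, s ≠ t → s ≠ 0 → duhKer t s = c * (pvKer t s * β₁ s) + 2⁻¹ * β₂ s) (z : ℝ × ℝ) :
    evolution φ w duhKer F (t, z) = c * evolution φ w pvKer (fun p => β₁ p.1 * F p) (t, z) +
      2⁻¹ * evolution φ w (fun _ _ => 1) (fun p => β₂ p.1 * F p) (t, z) := by
  have hc : Measurable fun q : ℝ × ℝ × ℝ => cexpI (z.1 * q.2.1 + z.2 * q.2.2) := by fun_prop
  have i1 := ((integrable_evolution hφ hw bounded₂_pvKer (hF.time_mul h1 h1') t).bdd_mul (c := 1)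
    hc.aestronglyMeasurable (ae_of_all _ fun q => (norm_cexpI _).le)).const_mul c
  have i2 := ((integrable_evolution hφ hw bounded₂_one (hF.time_mul h2 h2') t).bdd_mul (c := 1)
    hc.aestronglyMeasurable (ae_of_all _ fun q => (norm_cexpI _).le)).const_mul 2⁻¹
  simp only [evolution]
  rw [← integral_const_mul, ← integral_const_mul, ← integral_add i1 i2]
  refine integral_congr_ae ?_
  filter_upwards [ae_fst_ne t, ae_fst_ne 0] with q hq hq0
  rw [h q.1 hq hq0, spaceFT_time_mul, spaceFT_time_mul]
  ring

theorem eLpNorm_time_mul_slice_le {β : ℝ → ℂ} {I : Set ℝ} (hI : MeasurableSet I)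
    (hβ : ∀ s, ‖β s‖ ≤ I.indicator 1 s) (F : ℝ × ℝ × ℝ → ℂ) (x : ℝ) :
    eLpNorm (fun z : ℝ × ℝ => β z.1 * F (z.1, x, z.2)) 2 ≤
      eLpNorm (fun z : ℝ × ℝ => F (z.1, x, z.2)) 2 ((volume.restrict I).prod volume) := by
  have hr : ((volume : Measure ℝ).restrict I).prod (volume : Measure ℝ) =
      (volume : Measure (ℝ × ℝ)).restrict (I ×ˢ univ) := by
    rw [Measure.volume_eq_prod, ← Measure.prod_restrict, Measure.restrict_univ]
  rw [hr, ← eLpNorm_indicator_eq_eLpNorm_restrict (hI.prod MeasurableSet.univ)]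
  refine eLpNorm_mono fun z => ?_
  rw [norm_mul]
  by_cases hz : z.1 ∈ I
  · have := hβ z.1
    rw [indicator_of_mem hz, Pi.one_apply] at this
    rw [indicator_of_mem (show z ∈ I ×ˢ univ from ⟨hz, mem_univ _⟩)]
    exact mul_le_of_le_one_left (norm_nonneg _) this
  · have := hβ z.1
    rw [indicator_of_notMem hz] at this
    rw [le_antisymm this (norm_nonneg _), zero_mul]
    exact norm_nonneg _

/-- The estimate on the time set `I`: the values of the Duhamel term for `t ∈ I` are given by data
cut off to `I`, for which the estimates on all of space-time apply. -/
theorem eLpNorm_evolution_duhKer_le {W : ℝ → ℝ → ℝ} {B : ℝ} (hφ : LocBounded φ)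
    (hw : LocBounded w) (hwW : ∀ ξ μ, w ξ μ = -(W ξ μ : ℂ))
    (hPV : ∀ τ μ, PVBounded B (fun ξ => τ - φ ξ μ) (fun ξ => W ξ μ / (τ - φ ξ μ)))
    (hF : BandLimited R F) {I : Set ℝ} (hI : MeasurableSet I)
    {β₁ β₂ : ℝ → ℂ} (h1 : Measurable β₁) (h2 : Measurable β₂) (h1' : ∀ s, ‖β₁ s‖ ≤ I.indicator 1 s)
    (h2' : ∀ s, ‖β₂ s‖ ≤ I.indicator 1 s) {c : ℂ}
    (h : ∀ t ∈ I, ∀ s, s ≠ t → s ≠ 0 → duhKer t s = c * (pvKer t s * β₁ s) + 2⁻¹ * β₂ s)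
    (x : ℝ) :
    eLpNorm (fun z : ℝ × ℝ => evolution φ w duhKer F (z.1, x, z.2)) 2
        ((volume.restrict I).prod volume) ≤
      ENNReal.ofReal ((‖c‖ + 1) * ((2 * Real.pi) ^ 2 * B)) *
        ∫⁻ x', eLpNorm (fun z : ℝ × ℝ => F (z.1, x', z.2)) 2 ((volume.restrict I).prod volume) := by
  have hB0 : 0 ≤ B := (norm_nonneg _).trans ((hPV 0 0).norm_le 1 one_pos 0)
  have hle : ∀ s, I.indicator (1 : ℝ → ℝ) s ≤ 1 := fun s =>
    indicator_apply_le' (fun _ => le_rfl) fun _ => zero_le_one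
  have b1 := hF.time_mul h1 fun s => (h1' s).trans (hle s)
  have b2 := hF.time_mul h2 fun s => (h2' s).trans (hle s)
  have hz : Measurable fun z : ℝ × ℝ => (z.1, x, z.2) := by fun_prop
  have m1 := (measurable_evolution hφ hw bounded₂_pvKer b1).comp hz
  have m2 := (measurable_evolution hφ hw bounded₂_one b2).comp hz
  have hr : ((volume : Measure ℝ).restrict I).prod (volume : Measure ℝ) =
      (volume : Measure (ℝ × ℝ)).restrict (I ×ˢ univ) := by
    rw [Measure.volume_eq_prod, ← Measure.prod_restrict, Measure.restrict_univ]
  set N := ∫⁻ x', eLpNorm (fun z : ℝ × ℝ => F (z.1, x', z.2)) 2 ((volume.restrict I).prod volume)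
  have e1 : eLpNorm (fun z : ℝ × ℝ => evolution φ w pvKer (fun p => β₁ p.1 * F p) (z.1, x, z.2)) 2 ≤
      ENNReal.ofReal ((2 * Real.pi) ^ 2 * B) * N :=
    (eLpNorm_evolution_pvKer_le hφ hw hwW hPV b1 x).trans
      (mul_le_mul_right (lintegral_mono fun x' => eLpNorm_time_mul_slice_le hI h1' F x') _)
  have e2 : eLpNorm (fun z : ℝ × ℝ =>
      evolution φ w (fun _ _ => 1) (fun p => β₂ p.1 * F p) (z.1, x, z.2)) 2 ≤
      ENNReal.ofReal ((2 * Real.pi) ^ 2 * B) * N :=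
    (eLpNorm_evolution_one_le hφ hw hwW hPV b2 x).trans
      (mul_le_mul_right (lintegral_mono fun x' => eLpNorm_time_mul_slice_le hI h2' F x') _)
  have hce : ENNReal.ofReal ((‖c‖ + 1) * ((2 * Real.pi) ^ 2 * B)) * N =
      ‖c‖ₑ * (ENNReal.ofReal ((2 * Real.pi) ^ 2 * B) * N) +
        ENNReal.ofReal ((2 * Real.pi) ^ 2 * B) * N := by
    rw [ENNReal.ofReal_mul (by positivity), ENNReal.ofReal_add (norm_nonneg _) zero_le_one,
      ENNReal.ofReal_one, ofReal_norm]
    ring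
  rw [hce]
  set u₁ : ℝ × ℝ → ℂ := fun z => evolution φ w pvKer (fun p => β₁ p.1 * F p) (z.1, x, z.2)
  set u₂ : ℝ × ℝ → ℂ := fun z =>
    evolution φ w (fun _ _ => 1) (fun p => β₂ p.1 * F p) (z.1, x, z.2)
  have hu : eLpNorm (fun z : ℝ × ℝ => evolution φ w duhKer F (z.1, x, z.2)) 2
        ((volume.restrict I).prod volume) =
      eLpNorm (c • u₁ + (2⁻¹ : ℂ) • u₂) 2 ((volume.restrict I).prod volume) := by
    refine eLpNorm_congr_ae ?_
    rw [hr]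
    filter_upwards [ae_restrict_mem (hI.prod MeasurableSet.univ)] with z hz
    exact evolution_duhKer_eq hφ hw hF h1 h2 (fun s => (h1' s).trans (hle s))
      (fun s => (h2' s).trans (hle s)) (h z.1 hz.1) (x, z.2)
  have m1' : Measurable u₁ := m1
  have m2' : Measurable u₂ := m2
  rw [hu]
  refine (eLpNorm_add_le (m1'.const_smul c).aestronglyMeasurable
    (m2'.const_smul _).aestronglyMeasurable one_le_two).trans ?_
  rw [eLpNorm_const_smul, eLpNorm_const_smul, hr]
  refine add_le_add
    (mul_le_mul_right ((eLpNorm_mono_measure _ Measure.restrict_le_self).trans e1) _)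
    ((mul_le_of_le_one_left' ?_).trans ((eLpNorm_mono_measure _ Measure.restrict_le_self).trans e2))
  rw [← ofReal_norm, ← ENNReal.ofReal_one]
  exact ENNReal.ofReal_le_ofReal (by norm_num)

end

/-! ### Exchanging the space variables -/

/-- The function `(t, x, y) ↦ F (t, y, x)`. -/
def swapXY (F : ℝ × ℝ × ℝ → ℂ) (p : ℝ × ℝ × ℝ) : ℂ := F (p.1, p.2.2, p.2.1)

theorem spaceFT_swapXY (F : ℝ × ℝ × ℝ → ℂ) (s ξ μ : ℝ) :
    spaceFT (swapXY F) s ξ μ = spaceFT F s μ ξ := by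
  simp only [spaceFT, FTxy, swapXY]
  refine Eq.trans (integral_congr_ae (ae_of_all _ fun z => ?_))
    (integral_prod_swap (μ := (volume : Measure ℝ)) (ν := (volume : Measure ℝ))
      fun z : ℝ × ℝ => cexpI (-(z.1 * μ + z.2 * ξ)) * F (s, z))
  simp only [Prod.swap]
  rw [add_comm]

theorem FTtxy_swapXY (F : ℝ × ℝ × ℝ → ℂ) (τ ξ μ : ℝ) :
    FTtxy (swapXY F) τ ξ μ = FTtxy F τ μ ξ := by
  simp only [FTtxy, swapXY]
  rw [← integral_swap23]
  refine integral_congr_ae (ae_of_all _ fun z => ?_)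
  simp only
  rw [add_right_comm]

theorem BandLimited.swapXY {R : ℝ} {F : ℝ × ℝ × ℝ → ℂ} (hF : BandLimited R F) :
    BandLimited R (swapXY F) where
  measurable := hF.measurable.comp (by fun_prop)
  decay := by
    obtain ⟨C, hC⟩ := hF.decay
    exact ⟨C, fun p => (hC _).trans (le_of_eq (by ring))⟩
  eq_zero p hp := hF.eq_zero _ hp
  spaceFT_eq_zero s ξ μ h := by
    rw [spaceFT_swapXY]
    exact hF.spaceFT_eq_zero s μ ξ h.symm

theorem LocBounded.swap {E : Type*} [NormedAddCommGroup E] [MeasurableSpace E] {w : ℝ → ℝ → E}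
    (hw : LocBounded w) : LocBounded (fun μ ξ => w ξ μ) where
  measurable := hw.measurable.comp measurable_swap
  bound R := by
    obtain ⟨C, hC⟩ := hw.bound R
    exact ⟨C, fun ξ μ h1 h2 => hC μ ξ h2 h1⟩

theorem evolution_swapXY (φ : ℝ → ℝ → ℝ) (w κ : ℝ → ℝ → ℂ) (F : ℝ × ℝ × ℝ → ℂ) :
    evolution φ w κ F =
      swapXY (evolution (fun μ ξ => φ ξ μ) (fun μ ξ => w ξ μ) κ (swapXY F)) := by
  ext p
  simp only [swapXY, evolution]
  rw [← integral_swap23]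
  refine integral_congr_ae (ae_of_all _ fun q => ?_)
  simp only
  rw [add_comm, ← spaceFT_swapXY]

/-! ### Principal value kernels -/

/-- The truncated oscillatory integral
`∫_{ε < |τ - φ(ξ,μ)| < 1/ε} e^{ixξ} W(ξ,μ) / (τ - φ(ξ,μ)) a(ξ) dξ`. -/
def pvTransform (φ W : ℝ → ℝ → ℝ) (a : ℝ → ℂ) (ε τ x μ : ℝ) : ℂ :=
  ∫ ξ in band (fun ξ => τ - φ ξ μ) ε, cexpI (x * ξ) * ((W ξ μ / (τ - φ ξ μ) : ℝ) : ℂ) * a ξ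

/-- The limit of `pvTransform φ W 1` as the truncation is removed. -/
def pvKernel (φ W : ℝ → ℝ → ℝ) (τ x μ : ℝ) : ℂ :=
  limUnder (𝓝[>] (0 : ℝ)) fun ε => pvTransform φ W (fun _ => 1) ε τ x μ

section
variable {φ W : ℝ → ℝ → ℝ} {B R : ℝ} {F : ℝ × ℝ × ℝ → ℂ}

theorem tendsto_pvKernel
    (hPV : ∀ τ μ, PVBounded B (fun ξ => τ - φ ξ μ) (fun ξ => W ξ μ / (τ - φ ξ μ))) (τ x μ : ℝ) :
    Tendsto (fun ε => pvTransform φ W (fun _ => 1) ε τ x μ) (𝓝[>] 0)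
      (𝓝 (pvKernel φ W τ x μ)) := by
  apply tendsto_nhds_limUnder
  obtain ⟨L, hL⟩ := (hPV τ μ).exists_tendsto x
  refine ⟨L, ?_⟩
  simpa only [pvTransform, mul_one] using hL

theorem norm_pvTransform_one_le
    (hPV : ∀ τ μ, PVBounded B (fun ξ => τ - φ ξ μ) (fun ξ => W ξ μ / (τ - φ ξ μ)))
    {ε : ℝ} (hε : 0 < ε) (τ x μ : ℝ) : ‖pvTransform φ W (fun _ => 1) ε τ x μ‖ ≤ B := by
  simpa only [pvTransform, mul_one] using (hPV τ μ).norm_le ε hε x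

theorem norm_pvKernel_le
    (hPV : ∀ τ μ, PVBounded B (fun ξ => τ - φ ξ μ) (fun ξ => W ξ μ / (τ - φ ξ μ))) (τ x μ : ℝ) :
    ‖pvKernel φ W τ x μ‖ ≤ B := by
  refine le_of_tendsto (tendsto_pvKernel hPV τ x μ).norm ?_
  filter_upwards [self_mem_nhdsWithin] with ε hε
  exact norm_pvTransform_one_le hPV hε τ x μ

theorem measurable_pvTransform_one (hφ : LocBounded φ) (hW : Measurable fun q : ℝ × ℝ => W q.1 q.2)
    (ε : ℝ) :
    Measurable (fun p : ℝ × ℝ × ℝ => pvTransform φ W (fun _ => 1) ε p.1 p.2.1 p.2.2) := by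
  have hs : Measurable fun r : (ℝ × ℝ × ℝ) × ℝ => (r.2, r.1.2.2) := by fun_prop
  have h1 : Measurable fun r : (ℝ × ℝ × ℝ) × ℝ => r.1.1 - φ r.2 r.1.2.2 :=
    measurable_fst.fst.sub (hφ.measurable.comp hs)
  have h2 : Measurable fun r : (ℝ × ℝ × ℝ) × ℝ => W r.2 r.1.2.2 := hW.comp hs
  have h3 : Measurable fun r : (ℝ × ℝ × ℝ) × ℝ => cexpI (r.1.2.1 * r.2) := by fun_prop
  have h4 : Measurable fun r : (ℝ × ℝ × ℝ) × ℝ =>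
      cexpI (r.1.2.1 * r.2) * ((W r.2 r.1.2.2 / (r.1.1 - φ r.2 r.1.2.2) : ℝ) : ℂ) * 1 :=
    (h3.mul (Complex.measurable_ofReal.comp (h2.div h1))).mul_const 1
  have h5 := ((h4.indicator ((measurableSet_shell ε (1 / ε)).preimage h1)).stronglyMeasurable
    |>.integral_prod_right' (ν := (volume : Measure ℝ))).measurable
  convert h5 using 1
  ext p
  have hφp : Measurable fun ξ => p.1 - φ ξ p.2.2 :=
    (hφ.measurable.comp (measurable_id.prodMk measurable_const)).const_sub p.1
  rw [pvTransform, ← integral_indicator (measurableSet_band hφp ε)]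
  rfl

theorem measurable_pvKernel (hφ : LocBounded φ) (hW : Measurable fun q : ℝ × ℝ => W q.1 q.2)
    (hPV : ∀ τ μ, PVBounded B (fun ξ => τ - φ ξ μ) (fun ξ => W ξ μ / (τ - φ ξ μ))) :
    Measurable (fun p : ℝ × ℝ × ℝ => pvKernel φ W p.1 p.2.1 p.2.2) := by
  have hu : Tendsto (fun n : ℕ => 1 / ((n : ℝ) + 1)) atTop (𝓝[>] 0) :=
    tendsto_nhdsWithin_iff.2 ⟨tendsto_one_div_add_atTop_nhds_zero_nat,
      Eventually.of_forall fun n => by simp only [mem_Ioi]; positivity⟩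
  refine measurable_of_tendsto_metrizable
    (fun n : ℕ => measurable_pvTransform_one hφ hW (1 / ((n : ℝ) + 1)))
    (tendsto_pi_nhds.2 fun p => ?_)
  exact (tendsto_pvKernel hPV p.1 p.2.1 p.2.2).comp hu

theorem aestronglyMeasurable_slice {K : ℝ → ℝ → ℝ → ℂ}
    (hK : Measurable fun p : ℝ × ℝ × ℝ => K p.1 p.2.1 p.2.2) (τ x μ : ℝ) :
    AEStronglyMeasurable (fun x' => K τ (x - x') μ) volume := by
  have h1 : Measurable fun x' : ℝ => (τ, x - x', μ) := by fun_prop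
  have h2 := hK.comp h1
  exact h2.aestronglyMeasurable

theorem integrable_pvKernel_mul (hφ : LocBounded φ) (hW : Measurable fun q : ℝ × ℝ => W q.1 q.2)
    (hPV : ∀ τ μ, PVBounded B (fun ξ => τ - φ ξ μ) (fun ξ => W ξ μ / (τ - φ ξ μ)))
    (hF : BandLimited R F) (τ x μ : ℝ) :
    Integrable (fun x' => pvKernel φ W τ (x - x') μ * FTty F τ x' μ) :=
  (hF.integrable_FTty τ μ).bdd_mul (c := B)
    (aestronglyMeasurable_slice (measurable_pvKernel hφ hW hPV) τ x μ)
    (ae_of_all _ fun _ => norm_pvKernel_le hPV _ _ _)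

/-- The principal value multiplier is the convolution with its kernel. -/
theorem tendsto_pvTransform (hφ : LocBounded φ) (hW : Measurable fun q : ℝ × ℝ => W q.1 q.2)
    (hPV : ∀ τ μ, PVBounded B (fun ξ => τ - φ ξ μ) (fun ξ => W ξ μ / (τ - φ ξ μ)))
    (hF : BandLimited R F) (τ x μ : ℝ) :
    Tendsto (fun ε => pvTransform φ W (fun ξ => FTtxy F τ ξ μ) ε τ x μ) (𝓝[>] 0)
      (𝓝 (∫ x', pvKernel φ W τ (x - x') μ * FTty F τ x' μ)) := by
  have hφp : Measurable fun ξ => τ - φ ξ μ :=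
    (hφ.measurable.comp (measurable_id.prodMk measurable_const)).const_sub τ
  have e1 : ∀ ε, 0 < ε → pvTransform φ W (fun ξ => FTtxy F τ ξ μ) ε τ x μ =
      ∫ x', pvTransform φ W (fun _ => 1) ε τ (x - x') μ * FTty F τ x' μ := by
    intro ε hε
    have hk : Integrable ((band (fun ξ => τ - φ ξ μ) ε).indicator
        fun ξ => ((W ξ μ / (τ - φ ξ μ) : ℝ) : ℂ)) := by
      rw [integrable_indicator_iff (measurableSet_band hφp ε)]
      exact ((hPV τ μ).integrableOn_band ε hε).ofReal
    have h := integral_cexpI_mul_FTtxy hF hk τ x μ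
    rw [pvTransform, ← integral_indicator (measurableSet_band hφp ε)]
    refine Eq.trans ?_ (h.trans ?_)
    · congr 1
      ext ξ
      by_cases hξ : ξ ∈ band (fun ξ => τ - φ ξ μ) ε
      · rw [indicator_of_mem hξ, indicator_of_mem hξ, mul_assoc]
      · rw [indicator_of_notMem hξ, indicator_of_notMem hξ, zero_mul, mul_zero]
    · congr 1
      ext x'
      rw [pvTransform, ← integral_indicator (measurableSet_band hφp ε)]
      congr 2
      ext ξ
      by_cases hξ : ξ ∈ band (fun ξ => τ - φ ξ μ) ε
      · rw [indicator_of_mem hξ, indicator_of_mem hξ, mul_one]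
      · rw [indicator_of_notMem hξ, indicator_of_notMem hξ, mul_zero]
  have h2 : Tendsto (fun ε => ∫ x', pvTransform φ W (fun _ => 1) ε τ (x - x') μ * FTty F τ x' μ)
      (𝓝[>] 0) (𝓝 (∫ x', pvKernel φ W τ (x - x') μ * FTty F τ x' μ)) := by
    refine tendsto_integral_filter_of_dominated_convergence (fun x' => B * ‖FTty F τ x' μ‖)
      (Eventually.of_forall fun ε => ?_) ?_ ((hF.integrable_FTty τ μ).norm.const_mul B)
      (ae_of_all _ fun x' => (tendsto_pvKernel hPV τ (x - x') μ).mul_const _)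
    · exact (aestronglyMeasurable_slice (K := fun τ x μ => pvTransform φ W (fun _ => 1) ε τ x μ)
        (measurable_pvTransform_one hφ hW ε) τ x μ).mul (hF.integrable_FTty τ μ).1
    · filter_upwards [self_mem_nhdsWithin] with ε hε
      refine ae_of_all _ fun x' => ?_
      rw [norm_mul]
      exact mul_le_mul_of_nonneg_right (norm_pvTransform_one_le hPV hε _ _ _) (norm_nonneg _)
  refine h2.congr' ?_
  filter_upwards [self_mem_nhdsWithin] with ε hε
  exact (e1 ε hε).symm

end

/-! ### Mixed norms -/

/-- The constant `1 / (4i ∫₀^∞ sin v / v dv)`, which turns half of `sgn(t - s)` into `pvKer`. -/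
def duhCoeff : ℂ := (4 * Complex.I * (SiTop : ℂ))⁻¹

/-- The constant in the smoothing estimates for kernels bounded by `B`. -/
def smoothingConst (B : ℝ) : ℝ := (‖duhCoeff‖ + 1) * ((2 * Real.pi) ^ 2 * B)

theorem duhCoeff_mul_pvKer (t s : ℝ) :
    duhCoeff * pvKer t s = 2⁻¹ * ((SignType.sign (t - s) : ℝ) : ℂ) := by
  have : (SiTop : ℂ) ≠ 0 := by exact_mod_cast SiTop_pos.ne'
  have := Complex.I_ne_zero
  rw [duhCoeff, pvKer]
  push_cast
  field_simp
  norm_num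

/-- For all times the Duhamel kernel is `(sgn(t - s) + sgn s) / 2`. -/
theorem duhKer_eq_univ (t s : ℝ) (hst : s ≠ t) (hs : s ≠ 0) :
    duhKer t s = duhCoeff * (pvKer t s * 1) + 2⁻¹ * ((SignType.sign s : ℝ) : ℂ) := by
  rw [mul_one, duhCoeff_mul_pvKer, duhKer]
  rcases lt_or_gt_of_ne hst with h1 | h1 <;> rcases lt_or_gt_of_ne hs with h2 | h2
  · rw [sign_pos (sub_pos.2 h1), sign_neg h2, if_neg (by grind), if_neg (by grind)]
    norm_num
  · rw [sign_pos (sub_pos.2 h1), sign_pos h2, if_pos (by grind)]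
    norm_num
  · rw [sign_neg (sub_neg.2 h1), sign_neg h2, if_neg (by grind), if_pos (by grind)]
    norm_num
  · rw [sign_neg (sub_neg.2 h1), sign_pos h2, if_neg (by grind), if_neg (by grind)]
    norm_num

/-- For `t ≥ 0` the Duhamel kernel is `(sgn(t - s) + 1) / 2` on positive times `s`, and vanishes on
negative ones. -/
theorem duhKer_eq_Ici {t : ℝ} (ht : 0 ≤ t) (s : ℝ) (hst : s ≠ t) :
    duhKer t s = duhCoeff * (pvKer t s * (Ioi 0).indicator 1 s) +
      2⁻¹ * (Ioi 0).indicator 1 s := by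
  rw [← mul_assoc, duhCoeff_mul_pvKer, duhKer]
  rcases le_or_gt s 0 with h2 | h2
  · rw [indicator_of_notMem (by simpa using h2), if_neg (by grind), if_neg (by grind)]
    norm_num
  · rw [indicator_of_mem (by simpa using h2)]
    rcases lt_or_gt_of_ne hst with h1 | h1
    · rw [sign_pos (sub_pos.2 h1), if_pos (by grind)]
      norm_num
    · rw [sign_neg (sub_neg.2 h1), if_neg (by grind), if_neg (by grind)]
      norm_num

theorem normX_top_le {I : Set ℝ} {u F : ℝ × ℝ × ℝ → ℂ} {K : ℝ}
    (h : ∀ x, eLpNorm (fun z : ℝ × ℝ => u (z.1, x, z.2)) 2 ((volume.restrict I).prod volume) ≤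
      ENNReal.ofReal K *
        ∫⁻ x', eLpNorm (fun z : ℝ × ℝ => F (z.1, x', z.2)) 2 ((volume.restrict I).prod volume)) :
    normX ∞ 2 I u ≤ K.toNNReal * normX 1 2 I F := by
  rw [normX, normX, eLpNorm_one_eq_lintegral_enorm, eLpNorm_exponent_top]
  simp only [enorm_eq_self]
  exact eLpNormEssSup_le_of_ae_enorm_bound (ae_of_all _ fun x => by
    rw [enorm_eq_self]
    exact h x)

section
variable {φ W : ℝ → ℝ → ℝ} {w : ℝ → ℝ → ℂ} {F : ℝ × ℝ × ℝ → ℂ} {B R : ℝ}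

theorem normX_evolution_pvKer_le (hφ : LocBounded φ) (hw : LocBounded w)
    (hwW : ∀ ξ μ, w ξ μ = -(W ξ μ : ℂ))
    (hPV : ∀ τ μ, PVBounded B (fun ξ => τ - φ ξ μ) (fun ξ => W ξ μ / (τ - φ ξ μ)))
    (hF : BandLimited R F) :
    normX ∞ 2 univ (evolution φ w pvKer F) ≤
      (smoothingConst B).toNNReal * normX 1 2 univ F := by
  refine normX_top_le fun x => ?_
  have hB0 : 0 ≤ B := (norm_nonneg _).trans ((hPV 0 0).norm_le 1 one_pos 0)
  simp only [Measure.restrict_univ, ← Measure.volume_eq_prod]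
  refine (eLpNorm_evolution_pvKer_le hφ hw hwW hPV hF x).trans ?_
  gcongr
  exact le_mul_of_one_le_left (by positivity) (by linarith [norm_nonneg duhCoeff])

theorem normX_evolution_duhKer_le (hφ : LocBounded φ) (hw : LocBounded w)
    (hwW : ∀ ξ μ, w ξ μ = -(W ξ μ : ℂ))
    (hPV : ∀ τ μ, PVBounded B (fun ξ => τ - φ ξ μ) (fun ξ => W ξ μ / (τ - φ ξ μ)))
    (hF : BandLimited R F) {I : Set ℝ} (hI : I = univ ∨ I = Ici 0) :
    normX ∞ 2 I (evolution φ w duhKer F) ≤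
      (smoothingConst B).toNNReal * normX 1 2 I F := by
  refine normX_top_le fun x => ?_
  rcases hI with rfl | rfl
  · refine eLpNorm_evolution_duhKer_le hφ hw hwW hPV hF MeasurableSet.univ
      (β₁ := fun _ => 1) (β₂ := fun s => ((SignType.sign s : ℝ) : ℂ)) measurable_const
      (Complex.measurable_ofReal.comp measurable_sign_real) (fun s => by simp) (fun s => ?_)
      (fun t _ s => duhKer_eq_univ t s) x
    rw [indicator_univ, Pi.one_apply, Complex.norm_real]
    rcases lt_trichotomy s 0 with h | h | h <;> simp [h]
  · have hβ : ∀ s : ℝ, ‖(Ioi 0).indicator (1 : ℝ → ℂ) s‖ ≤ (Ici 0).indicator (1 : ℝ → ℝ) s := by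
      intro s
      rw [norm_indicator_eq_indicator_norm]
      refine (indicator_le_indicator_of_subset Ioi_subset_Ici_self (fun _ => norm_nonneg _) s).trans
        (le_of_eq ?_)
      congr 1
      ext
      simp
    have hm : Measurable ((Ioi (0 : ℝ)).indicator (1 : ℝ → ℂ)) :=
      measurable_const.indicator measurableSet_Ioi
    exact eLpNorm_evolution_duhKer_le hφ hw hwW hPV hF measurableSet_Ici hm hm hβ hβ
      (fun t ht s hst _ => duhKer_eq_Ici ht s hst) x

end

/-! ### The symbols of the two regions -/

section
variable {ψ : ℝ → ℝ}

theorem trunc1_eq (a : ℝ → ℂ) (ε τ x μ : ℝ) :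
    trunc1 ψ a ε τ x μ = pvTransform Phi (fun ξ μ => ξ ^ 2 * chi1 ψ ξ μ) a ε τ x μ := by
  refine integral_congr_ae (ae_of_all _ fun ξ => ?_)
  push_cast
  ring

theorem trunc2_eq (a : ℝ → ℂ) (ε τ ξ y : ℝ) :
    trunc2 ψ a ε τ ξ y =
      pvTransform (fun μ ξ => Phi ξ μ) (fun μ ξ => ξ * μ * chi2 ψ ξ μ) a ε τ y ξ := by
  refine integral_congr_ae (ae_of_all _ fun μ => ?_)
  push_cast
  ring

theorem K1_eq (ψ : ℝ → ℝ) :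
    K1 ψ = pvKernel Phi (fun ξ μ => ξ ^ 2 * chi1 ψ ξ μ) := by
  ext τ x μ
  simp only [K1, pvKernel, trunc1_eq]

/-- In the second region the kernel is a principal value in `μ`, with `ξ` as the frozen
frequency. -/
theorem K2_eq (τ ξ y : ℝ) :
    K2 ψ τ ξ y = pvKernel (fun μ ξ => Phi ξ μ) (fun μ ξ => ξ * μ * chi2 ψ ξ μ) τ y ξ := by
  simp only [K2, pvKernel, trunc2_eq]

theorem locBounded_chi1 (hψ : IsCutoff ψ) : LocBounded (fun ξ μ => (chi1 ψ ξ μ : ℂ)) :=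
  .of_mem_unitInterval (measurable_chi1 hψ) (chi1_mem hψ)

theorem locBounded_chi2 (hψ : IsCutoff ψ) : LocBounded (fun ξ μ => (chi2 ψ ξ μ : ℂ)) :=
  .of_mem_unitInterval (measurable_chi2 hψ) (chi2_mem hψ)

/-- The symbol of `∂ₓ²` localized to the first region. -/
def symbol1 (ψ : ℝ → ℝ) (ξ μ : ℝ) : ℂ :=
  Complex.I * (ξ : ℂ) * (Complex.I * (ξ : ℂ) * (chi1 ψ ξ μ : ℂ))

/-- The symbol of `∂ₓ∂_y` localized to the second region. -/
def symbol2 (ψ : ℝ → ℝ) (ξ μ : ℝ) : ℂ :=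
  Complex.I * (ξ : ℂ) * (Complex.I * (μ : ℂ) * (chi2 ψ ξ μ : ℂ))

theorem locBounded_symbol1 (hψ : IsCutoff ψ) : LocBounded (symbol1 ψ) :=
  (locBounded_chi1 hψ).fst_mul.fst_mul

theorem locBounded_symbol2 (hψ : IsCutoff ψ) : LocBounded (symbol2 ψ) :=
  (locBounded_chi2 hψ).snd_mul.fst_mul

theorem symbol1_eq (ξ μ : ℝ) : symbol1 ψ ξ μ = -((ξ ^ 2 * chi1 ψ ξ μ : ℝ) : ℂ) := by
  rw [symbol1]
  push_cast
  linear_combination (ξ : ℂ) ^ 2 * (chi1 ψ ξ μ : ℂ) * Complex.I_mul_I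

theorem symbol2_eq (ξ μ : ℝ) : symbol2 ψ ξ μ = -((ξ * μ * chi2 ψ ξ μ : ℝ) : ℂ) := by
  rw [symbol2]
  push_cast
  linear_combination (ξ : ℂ) * (μ : ℂ) * (chi2 ψ ξ μ : ℂ) * Complex.I_mul_I

variable {κ : ℝ → ℝ → ℂ} {F : ℝ × ℝ × ℝ → ℂ} {R : ℝ}

theorem dx_dx_evolution (hψ : IsCutoff ψ) (hκ : Bounded₂ κ) (hF : BandLimited R F) :
    dx (dx (evolution Phi (fun ξ μ => (chi1 ψ ξ μ : ℂ)) κ F)) =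
      evolution Phi (symbol1 ψ) κ F := by
  rw [dx_evolution locBounded_Phi (locBounded_chi1 hψ) hκ hF,
    dx_evolution locBounded_Phi (locBounded_chi1 hψ).fst_mul hκ hF]
  rfl

theorem dx_dy_evolution (hψ : IsCutoff ψ) (hκ : Bounded₂ κ) (hF : BandLimited R F) :
    dx (dy (evolution Phi (fun ξ μ => (chi2 ψ ξ μ : ℂ)) κ F)) =
      evolution Phi (symbol2 ψ) κ F := by
  rw [dy_evolution locBounded_Phi (locBounded_chi2 hψ) hκ hF,
    dx_evolution locBounded_Phi (locBounded_chi2 hψ).snd_mul hκ hF]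
  rfl

end

end Dysthe

end

theorem mainTheorem4 (ψ : ℝ → ℝ) (hψ : Dysthe.IsCutoff ψ) :
    -- the principal value kernels exist at every point and are measurable
    (∀ τ x μ : ℝ, Tendsto (fun ε => Dysthe.trunc1 ψ (fun _ => 1) ε τ x μ) (𝓝[>] (0 : ℝ))
      (𝓝 (Dysthe.K1 ψ τ x μ))) ∧
    (∀ τ ξ y : ℝ, Tendsto (fun ε => Dysthe.trunc2 ψ (fun _ => 1) ε τ ξ y) (𝓝[>] (0 : ℝ))
      (𝓝 (Dysthe.K2 ψ τ ξ y))) ∧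
    Measurable (fun p : ℝ × ℝ × ℝ => Dysthe.K1 ψ p.1 p.2.1 p.2.2) ∧
    Measurable (fun p : ℝ × ℝ × ℝ => Dysthe.K2 ψ p.1 p.2.1 p.2.2) ∧
    ∃ C : ℝ≥0,
      -- they are uniformly bounded
      (∀ τ x μ : ℝ, ‖Dysthe.K1 ψ τ x μ‖ ≤ C) ∧
      (∀ τ ξ y : ℝ, ‖Dysthe.K2 ψ τ ξ y‖ ≤ C) ∧
      ∀ (j : ℕ) (m : ℝ × ℝ → ℂ), Dysthe.IsDyadicSymbol j m →
      ∀ f : ℝ × ℝ × ℝ → ℂ, ContDiff ℝ ∞ f → HasCompactSupport f →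
        -- convolution representations
        (∀ τ x μ : ℝ,
          Integrable (fun x' : ℝ =>
            Dysthe.K1 ψ τ (x - x') μ * Dysthe.FTty (Dysthe.Q m f) τ x' μ) ∧
          Tendsto (fun ε =>
              Dysthe.trunc1 ψ (fun ξ => Dysthe.FTtxy (Dysthe.Q m f) τ ξ μ) ε τ x μ)
            (𝓝[>] (0 : ℝ))
            (𝓝 (∫ x' : ℝ,
              Dysthe.K1 ψ τ (x - x') μ * Dysthe.FTty (Dysthe.Q m f) τ x' μ))) ∧
        (∀ τ ξ y : ℝ,
          Integrable (fun y' : ℝ =>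
            Dysthe.K2 ψ τ ξ (y - y') * Dysthe.FTtx (Dysthe.Q m f) τ ξ y') ∧
          Tendsto (fun ε =>
              Dysthe.trunc2 ψ (fun μ => Dysthe.FTtxy (Dysthe.Q m f) τ ξ μ) ε τ ξ y)
            (𝓝[>] (0 : ℝ))
            (𝓝 (∫ y' : ℝ,
              Dysthe.K2 ψ τ ξ (y - y') * Dysthe.FTtx (Dysthe.Q m f) τ ξ y'))) ∧
        -- smoothing effect for the first region
        (∀ p : ℝ × ℝ × ℝ,
          Tendsto (fun ε => Dysthe.WtildeEps (Dysthe.chi1 ψ) ε (Dysthe.Q m f) p) (𝓝[>] (0 : ℝ))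
            (𝓝 (Dysthe.Wtilde (Dysthe.chi1 ψ) (Dysthe.Q m f) p))) ∧
        Dysthe.SpaceC2 (Dysthe.Wtilde (Dysthe.chi1 ψ) (Dysthe.Q m f)) ∧
        Measurable (Dysthe.dx (Dysthe.dx (Dysthe.Wtilde (Dysthe.chi1 ψ) (Dysthe.Q m f)))) ∧
        Dysthe.normX ∞ 2 univ
            (Dysthe.dx (Dysthe.dx (Dysthe.Wtilde (Dysthe.chi1 ψ) (Dysthe.Q m f)))) ≤
          C * Dysthe.normX 1 2 univ (Dysthe.Q m f) ∧
        -- smoothing effect for the second region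
        (∀ p : ℝ × ℝ × ℝ,
          Tendsto (fun ε => Dysthe.WtildeEps (Dysthe.chi2 ψ) ε (Dysthe.Q m f) p) (𝓝[>] (0 : ℝ))
            (𝓝 (Dysthe.Wtilde (Dysthe.chi2 ψ) (Dysthe.Q m f) p))) ∧
        Dysthe.SpaceC2 (Dysthe.Wtilde (Dysthe.chi2 ψ) (Dysthe.Q m f)) ∧
        Measurable (Dysthe.dx (Dysthe.dy (Dysthe.Wtilde (Dysthe.chi2 ψ) (Dysthe.Q m f)))) ∧
        Dysthe.normY ∞ 2 univ
            (Dysthe.dx (Dysthe.dy (Dysthe.Wtilde (Dysthe.chi2 ψ) (Dysthe.Q m f)))) ≤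
          C * Dysthe.normY 1 2 univ (Dysthe.Q m f) ∧
        -- double smoothing effect for the Duhamel terms, for all times and for `t ≥ 0`
        Dysthe.SpaceC2 (Dysthe.duhamel (Dysthe.chi1 ψ) (Dysthe.Q m f)) ∧
        Measurable (Dysthe.dx (Dysthe.dx (Dysthe.duhamel (Dysthe.chi1 ψ) (Dysthe.Q m f)))) ∧
        Dysthe.SpaceC2 (Dysthe.duhamel (Dysthe.chi2 ψ) (Dysthe.Q m f)) ∧
        Measurable (Dysthe.dx (Dysthe.dy (Dysthe.duhamel (Dysthe.chi2 ψ) (Dysthe.Q m f)))) ∧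
        ∀ I : Set ℝ, I = univ ∨ I = Ici 0 →
          Dysthe.normX ∞ 2 I
              (Dysthe.dx (Dysthe.dx (Dysthe.duhamel (Dysthe.chi1 ψ) (Dysthe.Q m f)))) ≤
            C * Dysthe.normX 1 2 I (Dysthe.Q m f) ∧
          Dysthe.normY ∞ 2 I
              (Dysthe.dx (Dysthe.dy (Dysthe.duhamel (Dysthe.chi2 ψ) (Dysthe.Q m f)))) ≤
            C * Dysthe.normY 1 2 I (Dysthe.Q m f) := by
  obtain ⟨L, hL1, hL⟩ := hψ.exists_abs_sub_le
  set B := Dysthe.pvConst (4000 * L)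
  have hP1 : ∀ τ μ, Dysthe.PVBounded B (fun ξ => τ - Dysthe.Phi ξ μ)
      (fun ξ => (fun ξ μ => ξ ^ 2 * Dysthe.chi1 ψ ξ μ) ξ μ / (τ - Dysthe.Phi ξ μ)) :=
    fun τ μ => Dysthe.pvBounded_chi1 hψ hL1 hL τ μ
  have hP2 : ∀ τ ξ, Dysthe.PVBounded B (fun μ => τ - (fun μ ξ => Dysthe.Phi ξ μ) μ ξ)
      (fun μ => (fun μ ξ => ξ * μ * Dysthe.chi2 ψ ξ μ) μ ξ /
        (τ - (fun μ ξ => Dysthe.Phi ξ μ) μ ξ)) :=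
    fun τ ξ => Dysthe.pvBounded_chi2 hψ hL1 hL τ ξ
  have hB0 : 0 ≤ B := (norm_nonneg _).trans ((hP1 0 0).norm_le 1 one_pos 0)
  have hφ := Dysthe.locBounded_Phi
  have hφ' : Dysthe.LocBounded (fun μ ξ => Dysthe.Phi ξ μ) := hφ.swap
  have hW1 : Measurable fun q : ℝ × ℝ => q.1 ^ 2 * Dysthe.chi1 ψ q.1 q.2 :=
    (measurable_fst.pow_const 2).mul (Dysthe.measurable_chi1 hψ)
  have hW2 : Measurable fun q : ℝ × ℝ => q.2 * q.1 * Dysthe.chi2 ψ q.2 q.1 :=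
    (measurable_snd.mul measurable_fst).mul ((Dysthe.measurable_chi2 hψ).comp measurable_swap)
  -- the constant of the estimates also bounds the kernels themselves
  have hBK : B ≤ (Dysthe.smoothingConst B).toNNReal := by
    refine le_trans ?_ (Real.le_coe_toNNReal _)
    have h1 : 1 ≤ (2 * Real.pi) ^ 2 := by nlinarith [Real.pi_gt_three]
    rw [Dysthe.smoothingConst, ← mul_assoc]
    refine le_mul_of_one_le_left hB0 (one_le_mul_of_one_le_of_one_le ?_ h1)
    linarith [norm_nonneg Dysthe.duhCoeff]
  have hK2 : Measurable (fun p : ℝ × ℝ × ℝ => Dysthe.K2 ψ p.1 p.2.1 p.2.2) := by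
    have h := (Dysthe.measurable_pvKernel hφ' hW2 hP2).comp
      Dysthe.measurePreserving_swap23.measurable
    simp only [Dysthe.K2_eq]
    exact h
  refine ⟨fun τ x μ => ?_, fun τ ξ y => ?_, ?_, hK2, (Dysthe.smoothingConst B).toNNReal,
    fun τ x μ => ?_, fun τ ξ y => ?_, fun j m hm f hf hfc => ?_⟩
  · simp only [Dysthe.trunc1_eq, Dysthe.K1_eq]
    exact Dysthe.tendsto_pvKernel hP1 τ x μ
  · simp only [Dysthe.trunc2_eq, Dysthe.K2_eq]
    exact Dysthe.tendsto_pvKernel hP2 τ y ξ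
  · simp only [Dysthe.K1_eq]
    exact Dysthe.measurable_pvKernel hφ hW1 hP1
  · rw [Dysthe.K1_eq]
    exact (Dysthe.norm_pvKernel_le hP1 τ x μ).trans hBK
  · rw [Dysthe.K2_eq]
    exact (Dysthe.norm_pvKernel_le hP2 τ y ξ).trans hBK
  obtain ⟨R, hF⟩ := Dysthe.bandLimited_Q hm.smooth hm.compact hf hfc
  set F := Dysthe.Q m f
  have hχ1 := Dysthe.locBounded_chi1 hψ
  have hχ2 := Dysthe.locBounded_chi2 hψ
  have hs1 := Dysthe.locBounded_symbol1 hψ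
  have hs2 := Dysthe.locBounded_symbol2 hψ
  have hpv := Dysthe.bounded₂_pvKer
  have hdu := Dysthe.bounded₂_duhKer
  -- in the second region the lemmas are applied with `x` and `y` exchanged
  have hsw : ∀ τ ξ μ, Dysthe.FTtxy F τ ξ μ = Dysthe.FTtxy (Dysthe.swapXY F) τ μ ξ :=
    fun τ ξ μ => (Dysthe.FTtxy_swapXY F τ μ ξ).symm
  rw [Dysthe.Wtilde_eq hχ1 hF, Dysthe.Wtilde_eq hχ2 hF, Dysthe.duhamel_eq hχ1 hF,
    Dysthe.duhamel_eq hχ2 hF, Dysthe.dx_dx_evolution hψ hpv hF, Dysthe.dx_dx_evolution hψ hdu hF,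
    Dysthe.dx_dy_evolution hψ hpv hF, Dysthe.dx_dy_evolution hψ hdu hF]
  refine ⟨fun τ x μ => ?_, fun τ ξ y => ?_, Dysthe.tendsto_WtildeEps hχ1 hF,
    Dysthe.spaceC2_evolution hφ hχ1 hpv hF, Dysthe.measurable_evolution hφ hs1 hpv hF,
    Dysthe.normX_evolution_pvKer_le hφ hs1 Dysthe.symbol1_eq hP1 hF,
    Dysthe.tendsto_WtildeEps hχ2 hF,
    Dysthe.spaceC2_evolution hφ hχ2 hpv hF, Dysthe.measurable_evolution hφ hs2 hpv hF, ?_,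
    Dysthe.spaceC2_evolution hφ hχ1 hdu hF, Dysthe.measurable_evolution hφ hs1 hdu hF,
    Dysthe.spaceC2_evolution hφ hχ2 hdu hF, Dysthe.measurable_evolution hφ hs2 hdu hF,
    fun I hI => ⟨Dysthe.normX_evolution_duhKer_le hφ hs1 Dysthe.symbol1_eq hP1 hF hI, ?_⟩⟩
  · simp only [Dysthe.trunc1_eq, Dysthe.K1_eq]
    exact ⟨Dysthe.integrable_pvKernel_mul hφ hW1 hP1 hF τ x μ,
      Dysthe.tendsto_pvTransform hφ hW1 hP1 hF τ x μ⟩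
  · simp only [Dysthe.trunc2_eq, Dysthe.K2_eq, hsw]
    exact ⟨Dysthe.integrable_pvKernel_mul hφ' hW2 hP2 hF.swapXY τ y ξ,
      Dysthe.tendsto_pvTransform hφ' hW2 hP2 hF.swapXY τ y ξ⟩
  · rw [Dysthe.evolution_swapXY]
    exact Dysthe.normX_evolution_pvKer_le hφ' hs2.swap (fun μ ξ => Dysthe.symbol2_eq ξ μ) hP2
      hF.swapXY
  · rw [Dysthe.evolution_swapXY]
    exact Dysthe.normX_evolution_duhKer_le hφ' hs2.swap (fun μ ξ => Dysthe.symbol2_eq ξ μ) hP2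
      hF.swapXY hI
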